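/- **Setting.** Let $X$ be an infinite-dimensional real separable Hilbert space and $A$ a skew-adjoint operator on $X$ such that $A^*A=-A^2$ has compact resolvent. Let $(e_j)_{j\in\mathbb N}$ be an orthonormal basis of $X$ with $A^*Ae_j=\lambda_je_j$, where $0\le\lambda_0\le\lambda_1\le\dots$. Fix $\sigma\ge 0$ and let $X^\sigma=D((A^*A)^{\sigma/2})$, with norm $\|x\|_{X^\sigma}^2=\sum_j(1+\lambda_j)^\sigma\langle e_j,x\rangle^2$. Let $\mathcal Q_n$ be the projection onto the closed span of $\{e_j\}_{j\ge n}$ and $\mathcal P_n=I-\mathcal Q_n$; $\mathcal P_nX^\sigma$ and $\mathcal Q_nX^\sigma$ carry the norm of $X^\sigma$. For a real Hilbert space $Y$ with complexification $Y_{\mathbb C}=Y+iY$, $\|x+iy\|^2=\|x\|^2+\|y\|^2$, for $T,R,M,\delta>0$ and a set $\mathcal A$, put $$\mathcal B_R(Y)=\{y\in C^0([0,T],Y):\ \|y\|_{C^0}\le R\},\qquad \mathcal B_R(Y,\mathcal A)=\{y\in\mathcal B_R(Y):\ y(t)\in\mathcal A\ \ \forall t\},$$ $$\mathbb B_{M,\delta}(Y)=\{z\in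 Y_{\mathbb C}:\ \|\mathrm{Re}\,z\|\le M,\ \|\mathrm{Im}\,z\|\le\delta\},\qquad \mathcal B_{M,\delta}(Y)=\{z\in C^0([0,T],Y_{\mathbb C}):\ z(t)\in\mathbb B_{M,\delta}(Y)\ \ \forall t\}.$$ Solutions of evolution equations are mild solutions (given by Duhamel's formula with the group $e^{tA}$). **Hypotheses.** Let $T,R_0,R_1>0$ and $n_0\in\mathbb N$. 1. $\mathfrak f:X^\sigma\to X^\sigma$ is of class $C^2$ and bounded on bounded sets, and $D\mathfrak f$ is bounded and Lipschitz on the closed ball of radius $4R_0$ of $X^\sigma$. 2. $\mathcal A\subset X^\sigma$ is nonempty, compact and stable under $\mathcal P_n$ for every $n\ge n_0$. 3. $\mathbf C:X^\sigma\to X^\sigma$ is bounded and linear, and there is $\mathfrak C_{obs}>0$ such that for all $n\ge n_0$, all $v\in\mathcal B_{3R_0}(X^\sigma,\mathcal A+\mathcal A)$ and all mild solutions $w=S_n(v)(\cdot,0)w_0\in C^0([0,T],\mathcal Q_nX^\sigma)$ of $\partial_tw=(A+\mathcal Q_nD\mathfrak f(v))w$, $w(0)=w_0\in\mathcal Q_nX^\sigma$,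 $$\|w_0\|_{X^\sigma}^2\le\mathfrak C_{obs}^2\int_0^T\|\mathbf C\,w(t)\|_{X^\sigma}^2\,dt .$$ **Conclusion.** There exist $n\ge n_0$, $0<R<R_0$ and a Lipschitz map (for the $C^0$ norms) $$\mathcal R:\ \mathcal B_{R_0}(\mathcal P_nX^\sigma,\mathcal A)\times\mathcal B_{R_0}(X^\sigma,\mathcal A)\times\mathcal B_{R_1}(X^\sigma,\mathcal A)\longrightarrow\mathcal B_R(\mathcal Q_nX^\sigma)$$ such that, for all $u,\mathfrak h_1\in\mathcal B_{R_0}(X^\sigma,\mathcal A)$ and $\mathfrak h_2\in\mathcal B_{R_1}(X^\sigma,\mathcal A)$ satisfying $$\partial_tu=Au+\mathfrak f(u+\mathfrak h_1)+\mathfrak h_2\ \text{ in }[0,T],\qquad \mathbf C u(t)=0\ \text{ for all }t\in[0,T],\tag{$*$}$$ one has $\mathcal Q_nu=\mathcal R(\mathcal P_nu,\mathfrak h_1,\mathfrak h_2)$. Moreover, suppose in addition that, for some $\delta>0$ and some $L$, $\mathfrak f$ extends from the closed ball of radius $4R_0$ to a map $\mathbb B_{4R_0,2\delta}(X^\sigma)\to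 X^\sigma_{\mathbb C}$ that is holomorphic in the interior, continuous up to the boundary, bounded by $L$ and $L$-Lipschitz, and whose complex differential is $L$-Lipschitz. Let $\mathcal K\subset C^0([0,T],X^\sigma)$ be nonempty, compact and stable under $\mathcal P_n$. Then there are $\eta,\eta_1>0$ such that, for all $u,\mathfrak h_1\in\mathcal B_{R_0}(X^\sigma,\mathcal A)\cap\mathcal K$ and $\mathfrak h_2\in\mathcal B_{R_1}(X^\sigma,\mathcal A)$ satisfying $(*)$, $\mathcal R$, with its first variable restricted to the $\eta$-neighbourhood of $\mathcal P_nu$, extends to a map $$\big(\mathcal P_nu+\mathcal B_{\eta,\eta}(\mathcal P_nX^\sigma)\big)\times\big(\mathcal B_{R_0}(X^\sigma,\mathcal A)\cap\mathcal K+\mathcal B_{\eta,\eta}(X^\sigma)\big)\times\big(\mathcal B_{R_1}(X^\sigma,\mathcal A)+\mathcal B_{\eta,\eta}(X^\sigma)\big)\longrightarrow\mathcal B_{R,\eta_1}(\mathcal Q_nX^\sigma)$$ that is holomorphic on a neighbourhood of its domain; it coincides with $\mathcal R$ at the real points where both are defined. -/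

import Mathlib

open scoped NNReal Pointwise

namespace FreqSplit

noncomputable section

/-! ### Continuous paths on `[0, T]` -/

/-- `C⁰([0, T], Y)`; for a normed space `Y` it carries the supremum norm. -/
abbrev TPath (T : ℝ) (Y : Type*) [TopologicalSpace Y] : Type _ := C(Set.Icc (0 : ℝ) T, Y)

/-- The ball of radius `R` of `C⁰([0, T], Y)`, of the paths with values in `S`. -/
def pathBall {Y : Type*} [NormedAddCommGroup Y] (T R : ℝ) (S : Set Y) : Set (TPath T Y) :=
  {y | ‖y‖ ≤ R ∧ ∀ t, y t ∈ S}

/-! ### The canonical complexification of a real inner product space -/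

/-- `E_ℂ = E + iE`, normed by `‖x + iy‖² = ‖x‖² + ‖y‖²`; the pair `(x, y)` stands for `x + iy`. -/
def Cx (E : Type*) : Type _ := WithLp 2 (E × E)

namespace Cx

section
variable {E : Type*}

/-- The element `x + iy`. -/
def mk (x y : E) : Cx E := WithLp.toLp 2 (x, y)

/-- The real part. -/
def re (z : Cx E) : E := WithLp.fst (show WithLp 2 (E × E) from z)

/-- The imaginary part. -/
def im (z : Cx E) : E := WithLp.snd (show WithLp 2 (E × E) from z)

@[ext] theorem ext {z w : Cx E} (h₁ : z.re = w.re) (h₂ : z.im = w.im) : z = w :=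
  congrArg (WithLp.toLp 2) (Prod.ext h₁ h₂)

@[simp] theorem re_mk (x y : E) : (mk x y).re = x := rfl

@[simp] theorem im_mk (x y : E) : (mk x y).im = y := rfl

end

variable {E : Type*} [NormedAddCommGroup E]

instance : NormedAddCommGroup (Cx E) := inferInstanceAs (NormedAddCommGroup (WithLp 2 (E × E)))

@[simp] theorem re_add (z w : Cx E) : (z + w).re = z.re + w.re := rfl

@[simp] theorem im_add (z w : Cx E) : (z + w).im = z.im + w.im := rfl

@[simp] theorem re_zero : (0 : Cx E).re = 0 := rfl

@[simp] theorem im_zero : (0 : Cx E).im = 0 := rfl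

theorem norm_sq (z : Cx E) : ‖z‖ ^ 2 = ‖z.re‖ ^ 2 + ‖z.im‖ ^ 2 :=
  WithLp.prod_norm_sq_eq_of_L2 (show WithLp 2 (E × E) from z)

/-- The embedding `x ↦ x + i0` of `E` into `E_ℂ`. -/
def ofReal (x : E) : Cx E := mk x 0

theorem isometry_ofReal : Isometry (ofReal : E → Cx E) := by
  refine Isometry.of_dist_eq fun x y => ?_
  have h : ‖ofReal x - ofReal y‖ ^ 2 = ‖x - y‖ ^ 2 := by
    rw [norm_sq]
    have h₁ : (ofReal x - ofReal y).re = x - y := rfl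
    have h₂ : (ofReal x - ofReal y).im = (0 : E) - 0 := rfl
    rw [h₁, h₂]
    simp
  rw [dist_eq_norm, dist_eq_norm]
  exact (sq_eq_sq₀ (norm_nonneg _) (norm_nonneg _)).1 h

/-- A real path seen as a complex one. -/
def ofRealPath {T : ℝ} (y : TPath T E) : TPath T (Cx E) :=
  ⟨fun t => ofReal (y t), isometry_ofReal.continuous.comp y.continuous⟩

variable [InnerProductSpace ℝ E]

instance : SMul ℂ (Cx E) :=
  ⟨fun c z => mk (c.re • z.re - c.im • z.im) (c.re • z.im + c.im • z.re)⟩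

@[simp] theorem re_smul (c : ℂ) (z : Cx E) : (c • z).re = c.re • z.re - c.im • z.im := rfl

@[simp] theorem im_smul (c : ℂ) (z : Cx E) : (c • z).im = c.re • z.im + c.im • z.re := rfl

instance : Module ℂ (Cx E) where
  one_smul z := by ext <;> simp
  mul_smul a b z := by
    ext <;> simp only [re_smul, im_smul, Complex.mul_re, Complex.mul_im] <;> module
  smul_zero a := by ext <;> simp
  smul_add a z w := by ext <;> simp <;> module
  add_smul a b z := by ext <;> simp <;> module
  zero_smul z := by ext <;> simp

instance : NormedSpace ℂ (Cx E) where
  norm_smul_le c z := by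
    refine le_of_sq_le_sq ?_ (by positivity)
    rw [mul_pow, norm_sq, norm_sq, re_smul, im_smul, norm_sub_sq_real, norm_add_sq_real,
      Complex.sq_norm, Complex.normSq_apply]
    simp only [norm_smul, real_inner_smul_left, real_inner_smul_right, mul_pow, Real.norm_eq_abs,
      sq_abs, real_inner_comm]
    apply le_of_eq
    ring

end Cx

/-- The cylinder `‖Re z‖ ≤ M`, `‖Im z‖ ≤ δ` of `E_ℂ`. -/
def cylinder (E : Type*) [NormedAddCommGroup E] (M δ : ℝ) : Set (Cx E) :=
  {z | ‖z.re‖ ≤ M ∧ ‖z.im‖ ≤ δ}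

/-- The paths in `E_ℂ` that stay in the cylinder `‖Re z‖ ≤ M`, `‖Im z‖ ≤ δ`. -/
def pathCylinder (E : Type*) [NormedAddCommGroup E] (T M δ : ℝ) : Set (TPath T (Cx E)) :=
  {z | ∀ t, z t ∈ cylinder E M δ}

/-- `F` is holomorphic on a neighbourhood of the set `D` (in complex normed spaces, holomorphic on
an open set means complex Fréchet differentiable at each of its points). -/
def HolomorphicNear {V W : Type*} [NormedAddCommGroup V] [NormedSpace ℂ V]
    [NormedAddCommGroup W] [NormedSpace ℂ W] (F : V → W) (D : Set V) : Prop :=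
  ∃ U : Set V, IsOpen U ∧ D ⊆ U ∧ DifferentiableOn ℂ F U

/-! ### The operator `A` and the eigenbasis of `A*A` -/

section Operator

variable {X : Type*} [NormedAddCommGroup X] [InnerProductSpace ℝ X] [CompleteSpace X]

/-- `x ∈ D(A*A)` and `A*A x = y`. -/
def StarMulSelfEq (A : X →ₗ.[ℝ] X) (x y : X) : Prop :=
  ∃ (hx : x ∈ A.domain) (hy : A ⟨x, hx⟩ ∈ A.adjoint.domain), A.adjoint ⟨A ⟨x, hx⟩, hy⟩ = y

/-- `A` is a skew-adjoint operator and `A*A` has a compact resolvent: some real number `μ` and some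
compact operator `K` satisfy `(A*A - μ)⁻¹ = K`. -/
structure SkewAdjointCompactResolvent (A : X →ₗ.[ℝ] X) : Prop where
  dense_domain : Dense (A.domain : Set X)
  adjoint_eq_neg : A.adjoint = -A
  compact_resolvent : ∃ (μ : ℝ) (K : X →L[ℝ] X), IsCompactOperator K ∧
    ∀ x y, StarMulSelfEq A x (y + μ • x) ↔ x = K y

/-- `(e_j)` consists of eigenvectors of `A*A`, for eigenvalues `λ_j ≥ 0` ranged increasingly. -/
structure IsOrderedEigenbasis (A : X →ₗ.[ℝ] X) (e : HilbertBasis ℕ ℝ X) (lam : ℕ → ℝ≥0) :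
    Prop where
  monotone : Monotone lam
  eigen : ∀ j, StarMulSelfEq A (e j) ((lam j : ℝ) • e j)

open Classical in
/-- `A x` for `x` in the domain of `A` (and `0` elsewhere). -/
def applyOp (A : X →ₗ.[ℝ] X) (x : X) : X :=
  if h : x ∈ A.domain then A ⟨x, h⟩ else 0

/-- The unitary group `e^{tA}` of a skew-adjoint `A` with eigenbasis `(e_j)` of `A*A = -A²`.
Since `A² e_j = -λ_j e_j`, the exponential series gives
`e^{tA} e_j = cos (t √λ_j) e_j + (sin (t √λ_j) / √λ_j) A e_j`, where the quotient is `t` if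
`λ_j = 0`; `e^{tA}` is the continuous linear extension. -/
def expGroup (A : X →ₗ.[ℝ] X) (e : HilbertBasis ℕ ℝ X) (lam : ℕ → ℝ≥0) (t : ℝ) (x : X) : X :=
  ∑' j, e.repr x j • (Real.cos (t * √(lam j : ℝ)) • e j +
    (t * Real.sinc (t * √(lam j : ℝ))) • applyOp A (e j))

end Operator

/-! ### The spaces `X^σ = D((A*A)^{σ/2})`, for `σ ≥ 0` -/

section Scale

variable {X : Type*} [NormedAddCommGroup X] [InnerProductSpace ℝ X]
variable (e : HilbertBasis ℕ ℝ X) (lam : ℕ → ℝ≥0) (σ : ℝ≥0)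

/-- The weight `(1 + λ_j)^{σ/2}`. -/
def weight (j : ℕ) : ℝ := (1 + (lam j : ℝ)) ^ ((σ : ℝ) / 2)

theorem one_le_weight (j : ℕ) : 1 ≤ weight lam σ j :=
  Real.one_le_rpow (by simp) (by positivity)

/-- The vectors `x` of `X` with `∑ (1 + λ_j)^σ ⟨e_j, x⟩² < ∞`. -/
def scaleSubmodule : Submodule ℝ X where
  carrier := {x | Memℓp (fun j => weight lam σ j * e.repr x j) 2}
  add_mem' {x y} hx hy := by
    have h := Memℓp.add hx hy
    refine (congrArg (fun g : ℕ → ℝ => Memℓp g 2) ?_).mp h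
    funext j
    simp [mul_add]
  zero_mem' := by
    refine (congrArg (fun g : ℕ → ℝ => Memℓp g 2) ?_).mp (zero_memℓp (E := fun _ : ℕ => ℝ))
    funext j
    simp
  smul_mem' c x hx := by
    have h := Memℓp.const_smul hx c
    refine (congrArg (fun g : ℕ → ℝ => Memℓp g 2) ?_).mp h
    funext j
    simp [mul_left_comm]

/-- The space `X^σ`, with the norm `‖x‖² = ∑ (1 + λ_j)^σ ⟨e_j, x⟩²`. -/
def Scale : Type _ := ↥(scaleSubmodule e lam σ)

namespace Scale

instance : AddCommGroup (Scale e lam σ) := inferInstanceAs (AddCommGroup ↥(scaleSubmodule e lam σ))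

instance : Module ℝ (Scale e lam σ) := inferInstanceAs (Module ℝ ↥(scaleSubmodule e lam σ))

variable {e lam σ}

/-- The embedding of `X^σ` into `X`. -/
def incl : Scale e lam σ →ₗ[ℝ] X := (scaleSubmodule e lam σ).subtype

theorem incl_injective : Function.Injective (incl : Scale e lam σ → X) :=
  Subtype.val_injective

/-- The weighted coordinates `((1 + λ_j)^{σ/2} ⟨e_j, x⟩)_j`, an element of `ℓ²`. -/
def coords : Scale e lam σ →ₗ[ℝ] lp (fun _ : ℕ => ℝ) 2 where
  toFun x := ⟨fun j => weight lam σ j * e.repr (incl x) j, x.2⟩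
  map_add' x y := by
    ext j
    change weight lam σ j * e.repr (incl (x + y)) j =
      weight lam σ j * e.repr (incl x) j + weight lam σ j * e.repr (incl y) j
    simp [mul_add]
  map_smul' c x := by
    ext j
    simp [mul_left_comm]

theorem coords_apply (x : Scale e lam σ) (j : ℕ) :
    coords x j = weight lam σ j * e.repr (incl x) j := rfl

theorem coords_injective : Function.Injective (coords : Scale e lam σ → lp (fun _ : ℕ => ℝ) 2) := by
  intro x y h
  apply incl_injective
  apply e.repr.injective
  ext j
  have hj : coords x j = coords y j := by rw [h]
  rw [coords_apply, coords_apply] at hj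
  exact mul_left_cancel₀ (by have := one_le_weight lam σ j; positivity) hj

instance : NormedAddCommGroup (Scale e lam σ) :=
  NormedAddCommGroup.induced (Scale e lam σ) (lp (fun _ : ℕ => ℝ) 2) coords coords_injective

theorem norm_coords (x : Scale e lam σ) : ‖coords x‖ = ‖x‖ := rfl

instance : InnerProductSpace ℝ (Scale e lam σ) where
  norm_smul_le c x := by
    rw [← norm_coords, ← norm_coords, map_smul]
    exact norm_smul_le _ _
  inner x y := inner ℝ (coords x) (coords y)
  norm_sq_eq_re_inner x := by
    rw [← norm_coords]
    exact InnerProductSpace.norm_sq_eq_re_inner (𝕜 := ℝ) (coords x)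
  conj_inner_symm x y := InnerProductSpace.conj_inner_symm (coords x) (coords y)
  add_left x y z := by
    rw [map_add]
    exact inner_add_left _ _ _
  smul_left x y r := by
    rw [map_smul]
    exact inner_smul_left _ _ _

theorem coords_surjective :
    Function.Surjective (coords : Scale e lam σ → lp (fun _ : ℕ => ℝ) 2) := by
  intro y
  have hw : ∀ j, 0 < weight lam σ j := fun j => one_pos.trans_le (one_le_weight lam σ j)
  have hz : Memℓp (fun j => (weight lam σ j)⁻¹ * y j) 2 := by
    refine (lp.memℓp y).mono' fun j => ?_
    rw [norm_mul, Real.norm_of_nonneg (inv_nonneg.2 (hw j).le)]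
    exact mul_le_of_le_one_left (norm_nonneg _) (inv_le_one_of_one_le₀ (one_le_weight lam σ j))
  let z : lp (fun _ : ℕ => ℝ) 2 := ⟨_, hz⟩
  have hx : ∀ j, weight lam σ j * e.repr (e.repr.symm z) j = y j := fun j => by
    rw [LinearIsometryEquiv.apply_symm_apply]
    exact mul_inv_cancel_left₀ (hw j).ne' _
  refine ⟨⟨e.repr.symm z, ?_⟩, ?_⟩
  · change Memℓp (fun j => weight lam σ j * e.repr (e.repr.symm z) j) 2
    simp only [hx]
    exact lp.memℓp y
  · ext j
    exact hx j

instance : CompleteSpace (Scale e lam σ) :=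
  have h : Isometry (coords : Scale e lam σ → lp (fun _ : ℕ => ℝ) 2) :=
    AddMonoidHomClass.isometry_of_norm coords norm_coords
  (IsometryEquiv.mk (Equiv.ofBijective _ ⟨coords_injective, coords_surjective⟩) h).completeSpace

/-- The coordinate `x ↦ ⟨e_j, x⟩` (inner product of `X`) on `X^σ`. -/
def coord (j : ℕ) : Scale e lam σ →L[ℝ] ℝ :=
  LinearMap.mkContinuous ((innerₛₗ ℝ (e j)).comp incl) 1 fun x => by
    have h₁ : inner ℝ (e j) (incl x) = e.repr (incl x) j := (e.repr_apply_apply _ _).symm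
    have h₂ : ‖coords x j‖ ≤ ‖coords x‖ := lp.norm_apply_le_norm (by norm_num) _ _
    rw [coords_apply, norm_mul, norm_coords] at h₂
    have h₃ : 1 ≤ ‖weight lam σ j‖ := (one_le_weight lam σ j).trans (le_abs_self _)
    change ‖inner ℝ (e j) (incl x)‖ ≤ 1 * ‖x‖
    rw [h₁, one_mul]
    exact (le_mul_of_one_le_left (norm_nonneg _) h₃).trans h₂

theorem basis_mem (j : ℕ) : e j ∈ scaleSubmodule e lam σ := by
  change Memℓp (fun k => weight lam σ k * e.repr (e j) k) 2
  classical
  have h := lp.memℓp (lp.single (E := fun _ : ℕ => ℝ) 2 j (weight lam σ j))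
  refine (congrArg (fun g : ℕ → ℝ => Memℓp g 2) ?_).mp h
  funext k
  rw [e.repr_self]
  by_cases hk : k = j
  · subst hk
    simp
  · simp [hk]

variable (e lam σ)

/-- `e_j`, as an element of `X^σ`. -/
def basisVec (j : ℕ) : Scale e lam σ := ⟨e j, basis_mem j⟩

/-- The low-frequency projection `P_n = I - Q_n` of `X^σ`, that is, `P_n x = ∑_{j<n} ⟨e_j, x⟩ e_j`:
the high-frequency projection `Q_n` is the one onto the closed span of `(e_j)_{j ≥ n}`. -/
def lowProj (n : ℕ) : Scale e lam σ →L[ℝ] Scale e lam σ :=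
  ∑ j ∈ Finset.range n, (coord j).smulRight (basisVec e lam σ j)

/-- The high-frequency projection `Q_n = I - P_n` of `X^σ`. -/
def highProj (n : ℕ) : Scale e lam σ →L[ℝ] Scale e lam σ :=
  ContinuousLinearMap.id ℝ _ - lowProj e lam σ n

/-- The space `P_n X^σ`, with the norm of `X^σ`. -/
abbrev Low (n : ℕ) : Submodule ℝ (Scale e lam σ) := (lowProj e lam σ n).range

/-- The space `Q_n X^σ`, with the norm of `X^σ`. -/
abbrev High (n : ℕ) : Submodule ℝ (Scale e lam σ) := (highProj e lam σ n).range

end Scale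

end Scale

/-! ### Mild solutions and the assumptions on the nonlinearity and on the observation -/

section Evolution

variable {X : Type*} [NormedAddCommGroup X] [InnerProductSpace ℝ X] [CompleteSpace X]
variable {e : HilbertBasis ℕ ℝ X} {lam : ℕ → ℝ≥0} {σ : ℝ≥0}

open Scale

/-- The path `P_n u`, with values in `P_n X^σ`. -/
def lowPath {T : ℝ} (n : ℕ) (u : TPath T (Scale e lam σ)) : TPath T (Low e lam σ n) :=
  ⟨fun t => ⟨lowProj e lam σ n (u t), u t, rfl⟩,
    Continuous.subtype_mk ((lowProj e lam σ n).continuous.comp u.continuous) _⟩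

/-- The path `Q_n u`, with values in `Q_n X^σ`. -/
def highPath {T : ℝ} (n : ℕ) (u : TPath T (Scale e lam σ)) : TPath T (High e lam σ n) :=
  ⟨fun t => ⟨highProj e lam σ n (u t), u t, rfl⟩,
    Continuous.subtype_mk ((highProj e lam σ n).continuous.comp u.continuous) _⟩

/-- A path in a subspace of `X^σ`, seen in `X^σ`. -/
def subPath {T : ℝ} {S : Submodule ℝ (Scale e lam σ)} (w : TPath T S) : TPath T (Scale e lam σ) :=
  ⟨fun t => w t, continuous_subtype_val.comp w.continuous⟩

/-- `u` is a mild solution of `∂ₜ u = A u + g` on `[0, T]`, that is, Duhamel's formula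
`u(t) = e^{tA} u(0) + ∫₀ᵗ e^{(t-τ)A} g(τ) dτ` holds for every `t` in `[0, T]` (an equality of
elements of `X^σ`, tested in `X`). -/
def IsMildSolution (A : X →ₗ.[ℝ] X) {T : ℝ} (hT : 0 < T) (u : TPath T (Scale e lam σ))
    (g : Set.Icc (0 : ℝ) T → Scale e lam σ) : Prop :=
  ∀ t : Set.Icc (0 : ℝ) T, incl (u t) =
    expGroup A e lam t (incl (u ⟨0, Set.left_mem_Icc.2 hT.le⟩)) +
      ∫ τ in (0 : ℝ)..t, expGroup A e lam (t - τ) (incl (g (Set.projIcc 0 T hT.le τ)))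

/-- `u` solves `∂ₜ u = A u + f(u + h₁) + h₂`, `C u(t) = 0` on `[0, T]`. -/
def SolvesObserved (A : X →ₗ.[ℝ] X) {T : ℝ} (hT : 0 < T) (f : Scale e lam σ → Scale e lam σ)
    (C : Scale e lam σ →L[ℝ] Scale e lam σ) (u h₁ h₂ : TPath T (Scale e lam σ)) : Prop :=
  IsMildSolution A hT u (fun t => f (u t + h₁ t) + h₂ t) ∧ ∀ t, C (u t) = 0

/-- The uniform high-frequency observability assumption, for the set of inputs `V`. The path
`w` is `S_n(v)(·, 0) w₀`, the mild solution in `C⁰([0, T], Q_n X^σ)` of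
`∂ₜ w = (A + Q_n Df(v)) w`, `w(0) = w₀`. -/
def UniformObservability (A : X →ₗ.[ℝ] X) {T : ℝ} (hT : 0 < T)
    (f : Scale e lam σ → Scale e lam σ) (C : Scale e lam σ →L[ℝ] Scale e lam σ)
    (n₀ : ℕ) (V : Set (TPath T (Scale e lam σ))) : Prop :=
  ∃ Cobs : ℝ, 0 < Cobs ∧ ∀ n, n₀ ≤ n → ∀ v ∈ V, ∀ w : TPath T (High e lam σ n),
    IsMildSolution A hT (subPath w) (fun t => highProj e lam σ n (fderiv ℝ f (v t) (w t))) →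
      ‖w ⟨0, Set.left_mem_Icc.2 hT.le⟩‖ ^ 2 ≤
        Cobs ^ 2 * ∫ t in (0 : ℝ)..T, ‖C (w (Set.projIcc 0 T hT.le t))‖ ^ 2

end Evolution

section Nonlinearity

variable {E : Type*} [NormedAddCommGroup E] [InnerProductSpace ℝ E]

/-- `f` is of class `C²` and bounded on bounded sets, and `Df` is bounded and Lipschitz on the
closed ball of radius `4 R₀`. -/
structure RealNonlinearity (f : E → E) (R₀ : ℝ) : Prop where
  contDiff : ContDiff ℝ 2 f
  bounded : ∀ r : ℝ, ∃ M : ℝ, ∀ x, ‖x‖ ≤ r → ‖f x‖ ≤ M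
  fderiv_bounded : ∃ M : ℝ, ∀ x, ‖x‖ ≤ 4 * R₀ → ‖fderiv ℝ f x‖ ≤ M
  fderiv_lipschitz : ∃ L : ℝ≥0, LipschitzOnWith L (fderiv ℝ f) (Metric.closedBall 0 (4 * R₀))

/-- Moreover `f` extends to the cylinder `‖Re z‖ ≤ 4 R₀`, `‖Im z‖ ≤ 2δ` of the complexification,
for some `δ > 0`: the extension is holomorphic in the interior, continuous up to the boundary, and
bounded and Lipschitz with a Lipschitz derivative. -/
structure HolomorphicNonlinearity (f : E → E) (R₀ : ℝ) : Prop extends RealNonlinearity f R₀ where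
  extension : ∃ (δ L : ℝ) (F : Cx E → Cx E), 0 < δ ∧
    (∀ x : E, ‖x‖ ≤ 4 * R₀ → F (Cx.ofReal x) = Cx.ofReal (f x)) ∧
    DifferentiableOn ℂ F (interior (cylinder E (4 * R₀) (2 * δ))) ∧
    ContinuousOn F (cylinder E (4 * R₀) (2 * δ)) ∧
    (∀ z ∈ cylinder E (4 * R₀) (2 * δ), ‖F z‖ ≤ L) ∧
    (∀ z ∈ cylinder E (4 * R₀) (2 * δ), ∀ z' ∈ cylinder E (4 * R₀) (2 * δ),
      ‖F z - F z'‖ ≤ L * ‖z - z'‖) ∧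
    (∀ z ∈ interior (cylinder E (4 * R₀) (2 * δ)), ∀ z' ∈ interior (cylinder E (4 * R₀) (2 * δ)),
      ‖fderiv ℂ F z - fderiv ℂ F z'‖ ≤ L * ‖z - z'‖)

end Nonlinearity

/-! ### The domains of the reconstruction operator and of its extension -/

section Domains

variable {X : Type*} [NormedAddCommGroup X] [InnerProductSpace ℝ X]
variable {e : HilbertBasis ℕ ℝ X} {lam : ℕ → ℝ≥0} {σ : ℝ≥0}

open Scale

/-- The real domain: triples `(v, h₁, h₂)` of paths with values in `S`, in the balls of radius
`R₀`, `R₀`, `R₁`, the first one with values in `P_n X^σ`. -/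
def realDomain (n : ℕ) (T R₀ R₁ : ℝ) (S : Set (Scale e lam σ)) :
    Set (TPath T (Low e lam σ n) × TPath T (Scale e lam σ) × TPath T (Scale e lam σ)) :=
  pathBall T R₀ (Subtype.val ⁻¹' S) ×ˢ pathBall T R₀ S ×ˢ pathBall T R₁ S

/-- The complex domain: `η`-neighbourhoods of the path `v₀`, of the paths of the second factor of
the real domain that lie in `K`, and of the third factor of the real domain. -/
def complexDomain (n : ℕ) (T R₀ R₁ η : ℝ) (S : Set (Scale e lam σ))
    (K : Set (TPath T (Scale e lam σ))) (v₀ : TPath T (Low e lam σ n)) :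
    Set (TPath T (Cx (Low e lam σ n)) × TPath T (Cx (Scale e lam σ)) × TPath T (Cx (Scale e lam σ))) :=
  ({Cx.ofRealPath v₀} + pathCylinder (Low e lam σ n) T η η) ×ˢ
    (Cx.ofRealPath '' (pathBall T R₀ S ∩ K) + pathCylinder (Scale e lam σ) T η η) ×ˢ
      (Cx.ofRealPath '' pathBall T R₁ S + pathCylinder (Scale e lam σ) T η η)

end Domains

end

end FreqSplit

open FreqSplit FreqSplit.Scale

/-!
The high-frequency part of an unobserved solution is reconstructed from its low-frequency part by a
fixed point argument around an observable linear equation.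

Let `u` solve `∂ₜu = Au + f(u + h₁) + h₂` with `Cu = 0`, and write `v = P_n u`, `w = Q_n u`,
`q = v + h₁`. When `n` is at a gap of the spectrum (`exists_gap`), `Q_n` commutes with the group
(`highProj_scaleGroup`), so that `w` solves the equation linearized at `q`,
`∂ₜw = (A + Q_n Df(q)) w + F` with the source `F = Q_n f(q + w) - Q_n Df(q) w + Q_n h₂`, and is
observed through `Cw = -Cv`. The linear equation is a Volterra equation; it is inverted without any
smallness assumption (`norm_volterra_pow_le`), and the observability inequality makes its Gramian
invertible (`isUnit_gramian`). Hence `w` is a bounded linear function of `F` and of `Cv`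
(`eq_recon`), with bounds that do not depend on `n`. As the quadratic remainder in `F` is a
contraction on a small ball of radius `R`, `w` is the unique fixed point in that ball of a map which
depends on `v`, `h₁`, `h₂` only (`SplitData.reconMap`, `realMap_highPath`,
`SplitData.exists_realRecon`).

The other terms have to be small. For the sources `Q_n f(q)` and `Q_n h₂` this holds for large `n`,
because `Q_n → 0` uniformly on compact sets (`eventually_norm_highProj_lt`). For general data the
observation `Cv` is not small; it is therefore truncated radially. The truncation is Lipschitz, and
for a true solution it is inactive since `Cv = -Cw` is small (`norm_obsLow_lowPath_le`). This gives
`𝓡` on all admissible data, together with its Lipschitz bound.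

For the complex extension the same formulas are used with complexified operators. The Hermitian
adjoint in the Gramian would not depend holomorphically on the data; it is replaced by the
complex-linear transpose (`transp`), which agrees with it at real points. Invertibility of the
Gramian is an open condition (`eventually_observable`), hence holds in a uniform neighbourhood of
the compact set of real inputs `q` produced by `𝒦` (`SplitData.exists_near_compact`). The map
contains the derivative of the extension of `f`, which is itself holomorphic: for a holomorphic map
with Lipschitz derivative between Banach spaces this follows from the one-variable theory along
complex lines (`differentiableAt_fderiv_of_lipschitz`), and superposition on paths preserves it
(`hasFDerivAt_pathMap`). A fixed point depends differentiably on the parameter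
(`differentiableAt_fixedPoint`), which yields the holomorphic extension
(`SplitData.exists_complexRecon`).
-/

namespace FreqSplit

open Set Filter Topology Metric

noncomputable section

/-! ### Holomorphic maps with Lipschitz derivative are twice differentiable -/

section SecondDerivative

variable {V W : Type*} [NormedAddCommGroup V] [NormedSpace ℂ V] [NormedAddCommGroup W]
  [NormedSpace ℂ W]

/-- First-order Taylor estimate on a convex set, for a map with Lipschitz derivative. Keeping the
constant `L` (rather than `L / 2`) avoids integrating along the segment. -/
theorem norm_taylor_one_le {F : V → W} {L : ℝ} {s : Set V} (hs : Convex ℝ s)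
    (hF : ∀ y ∈ s, DifferentiableAt ℂ F y)
    (hL : ∀ y ∈ s, ∀ y' ∈ s, ‖fderiv ℂ F y - fderiv ℂ F y'‖ ≤ L * ‖y - y'‖) (hL0 : 0 ≤ L)
    {x y : V} (hx : x ∈ s) (hy : y ∈ s) :
    ‖F y - F x - fderiv ℂ F x (y - x)‖ ≤ L * ‖y - x‖ * ‖y - x‖ := by
  have hseg : segment ℝ x y ⊆ s := hs.segment_subset hx hy
  refine (convex_segment x y).norm_image_sub_le_of_norm_hasFDerivWithin_le' (𝕜 := ℂ)
    (fun z hz => (hF z (hseg hz)).hasFDerivAt.hasFDerivWithinAt)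
    (fun z hz => ?_) (left_mem_segment ℝ x y) (right_mem_segment ℝ x y)
  refine (hL z (hseg hz) x hx).trans (mul_le_mul_of_nonneg_left ?_ hL0)
  obtain ⟨a, b, ha, hb, hab, rfl⟩ := hz
  have : a • x + b • y - x = b • (y - x) := by
    rw [← eq_sub_iff_add_eq] at hab; subst hab; module
  rw [this, norm_smul, Real.norm_of_nonneg hb]
  exact mul_le_of_le_one_left (norm_nonneg _) (by linarith)

theorem norm_inv_natCast_add_one_smul (m : ℕ) (k : V) :
    ‖((m : ℂ) + 1)⁻¹ • k‖ = 1 / ((m : ℝ) + 1) * ‖k‖ := by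
  rw [norm_smul, norm_inv, ← Nat.cast_succ, Complex.norm_natCast, one_div, Nat.cast_succ]

theorem eventually_one_div_add_one_mul_lt (a : ℝ) {ε : ℝ} (hε : 0 < ε) :
    ∀ᶠ m : ℕ in atTop, 1 / ((m : ℝ) + 1) * a < ε := by
  have := (tendsto_one_div_add_atTop_nhds_zero_nat (𝕜 := ℝ)).mul_const a
  rw [zero_mul] at this
  exact this.eventually (gt_mem_nhds hε)

variable {F : V → W} {z : V} {r L : ℝ}

/-- Rescaled difference quotients of a holomorphic map along a line converge uniformly to the
derivative. -/
theorem tendstoUniformlyOn_diffQuot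
    (hF : ∀ y ∈ ball z (2 * r), DifferentiableAt ℂ F y) (hr : 0 < r) (hL0 : 0 ≤ L)
    (hL : ∀ y ∈ ball z (2 * r), ∀ y' ∈ ball z (2 * r),
      ‖fderiv ℂ F y - fderiv ℂ F y'‖ ≤ L * ‖y - y'‖) (h k : V) :
    TendstoUniformlyOn
      (fun (m : ℕ) (ζ : ℂ) => (m + 1 : ℂ) •
        (F (z + ζ • h + (m + 1 : ℂ)⁻¹ • k) - F (z + ζ • h)))
      (fun ζ => fderiv ℂ F (z + ζ • h) k) atTop {ζ : ℂ | ‖ζ • h‖ < r} := by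
  rw [Metric.tendstoUniformlyOn_iff]
  intro ε hε
  have h1 : ∀ᶠ m : ℕ in atTop, 1 / ((m : ℝ) + 1) * ‖k‖ < r :=
    eventually_one_div_add_one_mul_lt _ hr
  have h2 : ∀ᶠ m : ℕ in atTop, 1 / ((m : ℝ) + 1) * (L * ‖k‖ * ‖k‖) < ε :=
    eventually_one_div_add_one_mul_lt _ hε
  filter_upwards [h1, h2] with m hm1 hm2 ζ hζ
  have hn : ‖((m : ℂ) + 1)‖ = (m : ℝ) + 1 := by
    have : ((m : ℂ) + 1) = ((m + 1 : ℕ) : ℂ) := by push_cast; rfl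
    rw [this, Complex.norm_natCast]; push_cast; rfl
  have hm0 : (0 : ℝ) < (m : ℝ) + 1 := by positivity
  have hmc : ((m : ℂ) + 1) ≠ 0 := by
    rw [← norm_pos_iff, hn]; exact hm0
  have hk := norm_inv_natCast_add_one_smul m k
  have hx : z + ζ • h ∈ ball z (2 * r) := by
    rw [mem_ball, dist_eq_norm, add_sub_cancel_left]
    exact lt_trans hζ (by linarith)
  have hy : z + ζ • h + ((m : ℂ) + 1)⁻¹ • k ∈ ball z (2 * r) := by
    rw [mem_ball, dist_eq_norm, add_assoc, add_sub_cancel_left]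
    refine (norm_add_le _ _).trans_lt ?_
    have : ‖ζ • h‖ < r := hζ
    linarith
  have := norm_taylor_one_le (convex_ball z (2 * r)) hF hL hL0 hx hy
  rw [add_sub_cancel_left] at this
  rw [dist_comm, dist_eq_norm]
  have e : ((m : ℂ) + 1) • (F (z + ζ • h + ((m : ℂ) + 1)⁻¹ • k) - F (z + ζ • h)) -
      fderiv ℂ F (z + ζ • h) k = ((m : ℂ) + 1) • (F (z + ζ • h + ((m : ℂ) + 1)⁻¹ • k) -
        F (z + ζ • h) - fderiv ℂ F (z + ζ • h) (((m : ℂ) + 1)⁻¹ • k)) := by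
    rw [map_smul, smul_sub _ (_ - _), smul_smul, mul_inv_cancel₀ hmc, one_smul]
  rw [e, norm_smul, hn]
  refine (mul_le_mul_of_nonneg_left this hm0.le).trans_lt ?_
  rw [hk]
  refine lt_of_eq_of_lt ?_ hm2
  field_simp

theorem isOpen_lineDomain (h : V) : IsOpen {ζ : ℂ | ‖ζ • h‖ < r} :=
  isOpen_lt (by fun_prop) continuous_const

theorem differentiableOn_diffQuot
    (hF : ∀ y ∈ ball z (2 * r), DifferentiableAt ℂ F y) (hr : 0 < r) (h k : V) :
    ∀ᶠ m : ℕ in atTop, DifferentiableOn ℂ (fun ζ : ℂ => (m + 1 : ℂ) •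
        (F (z + ζ • h + (m + 1 : ℂ)⁻¹ • k) - F (z + ζ • h))) {ζ : ℂ | ‖ζ • h‖ < r} := by
  have h1 : ∀ᶠ m : ℕ in atTop, 1 / ((m : ℝ) + 1) * ‖k‖ < r :=
    eventually_one_div_add_one_mul_lt _ hr
  filter_upwards [h1] with m hm1 ζ hζ
  have hk := norm_inv_natCast_add_one_smul m k
  have hζ' : ‖ζ • h‖ < r := hζ
  have hx : z + ζ • h ∈ ball z (2 * r) := by
    rw [mem_ball, dist_eq_norm, add_sub_cancel_left]
    exact lt_trans hζ (by linarith)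
  have hy : z + ζ • h + ((m : ℂ) + 1)⁻¹ • k ∈ ball z (2 * r) := by
    rw [mem_ball, dist_eq_norm, add_assoc, add_sub_cancel_left]
    refine (norm_add_le _ _).trans_lt ?_
    linarith
  have d1 : DifferentiableAt ℂ (fun ζ : ℂ => F (z + ζ • h)) ζ :=
    (hF _ hx).comp ζ (by fun_prop)
  have d2 : DifferentiableAt ℂ (fun ζ : ℂ => F (z + ζ • h + ((m : ℂ) + 1)⁻¹ • k)) ζ :=
    (hF _ hy).comp (g := F) (f := fun ζ : ℂ => z + ζ • h + ((m : ℂ) + 1)⁻¹ • k) ζ (by fun_prop)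
  exact ((d2.sub d1).const_smul _).differentiableWithinAt

variable [CompleteSpace W]

theorem differentiableOn_fderiv_line
    (hF : ∀ y ∈ ball z (2 * r), DifferentiableAt ℂ F y) (hr : 0 < r) (hL0 : 0 ≤ L)
    (hL : ∀ y ∈ ball z (2 * r), ∀ y' ∈ ball z (2 * r),
      ‖fderiv ℂ F y - fderiv ℂ F y'‖ ≤ L * ‖y - y'‖) (h k : V) :
    DifferentiableOn ℂ (fun ζ : ℂ => fderiv ℂ F (z + ζ • h) k) {ζ : ℂ | ‖ζ • h‖ < r} :=
  (tendstoUniformlyOn_diffQuot hF hr hL0 hL h k).tendstoLocallyUniformlyOn.differentiableOn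
    (differentiableOn_diffQuot hF hr h k) (isOpen_lineDomain h)

/-- The mixed second derivative, computed in one order, is the limit of difference quotients of the
first derivative in the other order. -/
theorem tendsto_mixedDeriv
    (hF : ∀ y ∈ ball z (2 * r), DifferentiableAt ℂ F y) (hr : 0 < r) (hL0 : 0 ≤ L)
    (hL : ∀ y ∈ ball z (2 * r), ∀ y' ∈ ball z (2 * r),
      ‖fderiv ℂ F y - fderiv ℂ F y'‖ ≤ L * ‖y - y'‖) (h k : V) :
    Tendsto (fun m : ℕ => (m + 1 : ℂ) •
        (fderiv ℂ F (z + (m + 1 : ℂ)⁻¹ • k) h - fderiv ℂ F z h)) atTop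
      (𝓝 (deriv (fun ζ : ℂ => fderiv ℂ F (z + ζ • h) k) 0)) := by
  have h0 : (0 : ℂ) ∈ {ζ : ℂ | ‖ζ • h‖ < r} := by simpa using hr
  have key := ((tendstoUniformlyOn_diffQuot hF hr hL0 hL h k).tendstoLocallyUniformlyOn.deriv
    (differentiableOn_diffQuot hF hr h k) (isOpen_lineDomain h)).tendsto_at h0
  refine key.congr' ?_
  have h1 : ∀ᶠ m : ℕ in atTop, 1 / ((m : ℝ) + 1) * ‖k‖ < r :=
    eventually_one_div_add_one_mul_lt _ hr
  filter_upwards [h1] with m hm1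
  have hk := norm_inv_natCast_add_one_smul m k
  have hx : z ∈ ball z (2 * r) := mem_ball_self (by linarith)
  have hy : z + ((m : ℂ) + 1)⁻¹ • k ∈ ball z (2 * r) := by
    rw [mem_ball, dist_eq_norm, add_sub_cancel_left]
    linarith
  have l0 : ∀ a : V, HasDerivAt (fun ζ : ℂ => z + ζ • h + a) h 0 := fun a => by
    have := (((hasDerivAt_id (0 : ℂ)).smul_const h).const_add z).add_const a
    simpa using this
  have d1 : HasDerivAt (fun ζ : ℂ => F (z + ζ • h)) (fderiv ℂ F z h) 0 := by
    have hx' : HasFDerivAt F (fderiv ℂ F z) (z + (0 : ℂ) • h + 0) := by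
      simpa using (hF _ hx).hasFDerivAt
    have := hx'.comp_hasDerivAt (0 : ℂ) (l0 0)
    simpa [Function.comp_def] using this
  have d2 : HasDerivAt (fun ζ : ℂ => F (z + ζ • h + ((m : ℂ) + 1)⁻¹ • k))
      (fderiv ℂ F (z + ((m : ℂ) + 1)⁻¹ • k) h) 0 := by
    have hy' : HasFDerivAt F (fderiv ℂ F (z + ((m : ℂ) + 1)⁻¹ • k))
        (z + (0 : ℂ) • h + ((m : ℂ) + 1)⁻¹ • k) := by
      simpa using (hF _ hy).hasFDerivAt
    exact hy'.comp_hasDerivAt (0 : ℂ) (l0 _)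
  exact ((d2.sub d1).const_smul _).deriv

/-- In complex Banach spaces the derivative of a holomorphic map is differentiable; the derivative
is assumed Lipschitz here, which makes the one-variable theory along complex lines uniform. -/
theorem differentiableAt_fderiv_of_lipschitz
    (hF : ∀ y ∈ ball z (2 * r), DifferentiableAt ℂ F y) (hr : 0 < r) (hL0 : 0 ≤ L)
    (hL : ∀ y ∈ ball z (2 * r), ∀ y' ∈ ball z (2 * r),
      ‖fderiv ℂ F y - fderiv ℂ F y'‖ ≤ L * ‖y - y'‖) :
    DifferentiableAt ℂ (fderiv ℂ F) z := by
  have hz : z ∈ ball z (2 * r) := mem_ball_self (by linarith)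
  have hd : ∀ h k : V, DifferentiableAt ℂ (fun ζ : ℂ => fderiv ℂ F (z + ζ • h) k) 0 := fun h k =>
    (differentiableOn_fderiv_line hF hr hL0 hL h k).differentiableAt
      ((isOpen_lineDomain h).mem_nhds (by simpa using hr))
  have ht := fun h k => tendsto_mixedDeriv hF hr hL0 hL h k
  let b : V →ₗ[ℂ] V →ₗ[ℂ] W := LinearMap.mk₂ ℂ
    (fun h k => deriv (fun ζ : ℂ => fderiv ℂ F (z + ζ • h) k) 0)
    (fun h h' k => by
      refine tendsto_nhds_unique (ht (h + h') k) (((ht h k).add (ht h' k)).congr fun m => ?_)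
      rw [map_add, map_add]; module)
    (fun c h k => by
      refine tendsto_nhds_unique (ht (c • h) k) (((ht h k).const_smul c).congr fun m => ?_)
      rw [map_smul, map_smul]; module)
    (fun h k k' => by
      have := ((hd h k).hasDerivAt.add (hd h k').hasDerivAt).deriv
      rw [← this]
      congr 1
      ext ζ
      simp)
    (fun c h k => by
      have := ((hd h k).hasDerivAt.const_smul c).deriv
      rw [← this]
      congr 1
      ext ζ
      simp)
  have hb : ∀ h k, ‖b h k‖ ≤ L * ‖h‖ * ‖k‖ := fun h k => by
    have : ‖deriv (fun ζ : ℂ => fderiv ℂ F (z + ζ • h) k) 0‖ ≤ L * ‖h‖ * ‖k‖ := by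
      refine (hd h k).hasDerivAt.le_of_lip' (by positivity) ?_
      filter_upwards [(isOpen_lineDomain (r := r) h).mem_nhds
        (show (0 : ℂ) ∈ _ by simpa using hr)] with ζ hζ
      have hx : z + ζ • h ∈ ball z (2 * r) := by
        rw [mem_ball, dist_eq_norm, add_sub_cancel_left]
        exact lt_trans hζ (by linarith)
      have h1 := hL _ hx _ hz
      rw [zero_smul, add_zero, ← sub_apply]
      refine (ContinuousLinearMap.le_opNorm _ _).trans ?_
      refine (mul_le_mul_of_nonneg_right h1 (norm_nonneg _)).trans (le_of_eq ?_)
      rw [add_sub_cancel_left, norm_smul, sub_zero]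
      ring
    exact this
  let B : V →L[ℂ] V →L[ℂ] W := b.mkContinuous₂ L hb
  have hB : ∀ h k, B h k = deriv (fun ζ : ℂ => fderiv ℂ F (z + ζ • h) k) 0 := fun h k => rfl
  -- the second-order Schwarz lemma along the complex line through `z` with direction `h`
  have hrem : ∀ h k, ‖h‖ < r →
      ‖fderiv ℂ F (z + h) k - fderiv ℂ F z k - B h k‖ ≤ 2 * L / r * ‖h‖ ^ 2 * ‖k‖ := by
    intro h k hh
    rcases eq_or_ne h 0 with rfl | hne
    · simp
    have hpos : 0 < ‖h‖ := norm_pos_iff.2 hne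
    set φ : ℂ → W := fun ζ => fderiv ℂ F (z + ζ • h) k - ζ • B h k with hφ
    have hball : ∀ ζ ∈ ball (0 : ℂ) (r / ‖h‖), ‖ζ • h‖ < r := fun ζ hζ => by
      rw [mem_ball_zero_iff, lt_div_iff₀ hpos] at hζ
      rwa [norm_smul]
    have h1 : DifferentiableOn ℂ φ (ball 0 (r / ‖h‖)) := by
      refine ((differentiableOn_fderiv_line hF hr hL0 hL h k).mono hball).sub ?_
      fun_prop
    have h2 : MapsTo φ (ball 0 (r / ‖h‖)) (closedBall (φ 0) (2 * L * r * ‖k‖)) := by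
      intro ζ hζ
      have hζ' := hball ζ hζ
      rw [mem_closedBall, dist_eq_norm]
      have hx : z + ζ • h ∈ ball z (2 * r) := by
        rw [mem_ball, dist_eq_norm, add_sub_cancel_left]
        exact lt_trans hζ' (by linarith)
      have e : φ ζ - φ 0 = (fderiv ℂ F (z + ζ • h) - fderiv ℂ F z) k - b (ζ • h) k := by
        simp only [hφ, map_smul, LinearMap.smul_apply, zero_smul, add_zero, sub_zero,
          sub_apply]
        have : B h k = b h k := rfl
        rw [this]; abel
      rw [e]
      refine (norm_sub_le _ _).trans ?_
      have a1 := ContinuousLinearMap.le_opNorm (fderiv ℂ F (z + ζ • h) - fderiv ℂ F z) k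
      have a2 := mul_le_mul_of_nonneg_right (hL _ hx _ hz) (norm_nonneg k)
      have a3 := hb (ζ • h) k
      rw [add_sub_cancel_left] at a2
      have a4 : L * ‖ζ • h‖ * ‖k‖ ≤ L * r * ‖k‖ := by gcongr
      linarith
    have h3 : (fun ζ => φ ζ - φ 0) =o[𝓝 (0 : ℂ)] (fun ζ => ‖ζ - 0‖ ^ 1) := by
      have hd' : HasDerivAt φ (B h k - B h k) 0 := by
        refine (hd h k).hasDerivAt.sub ?_
        simpa using (hasDerivAt_id (0 : ℂ)).smul_const (B h k)
      rw [sub_self] at hd'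
      have := (hasDerivAt_iff_isLittleO.1 hd')
      simpa using this.norm_right
    have h4 := Complex.dist_le_mul_div_pow_of_mapsTo_ball_of_isLittleO h1 h2 h3
      (z := 1) (by rw [mem_ball_zero_iff, norm_one, lt_div_iff₀ hpos]; linarith)
    rw [dist_eq_norm, dist_zero_right, norm_one] at h4
    have e : φ 1 - φ 0 = fderiv ℂ F (z + h) k - fderiv ℂ F z k - B h k := by
      simp only [hφ, one_smul, zero_smul, add_zero, sub_zero]; abel
    rw [e] at h4
    refine h4.trans (le_of_eq ?_)
    rw [one_div_div, show 1 + 1 = 2 from rfl, div_pow]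
    field_simp
  have hfd : HasFDerivAt (fderiv ℂ F) B z := by
    rw [hasFDerivAt_iff_isLittleO_nhds_zero]
    refine Asymptotics.IsBigO.trans_isLittleO (g := fun h => ‖h‖ ^ 2) ?_ ?_
    · refine Asymptotics.IsBigO.of_bound (2 * L / r) ?_
      filter_upwards [ball_mem_nhds (0 : V) hr] with h hh
      rw [mem_ball_zero_iff] at hh
      refine ContinuousLinearMap.opNorm_le_bound _ (by positivity) fun k => ?_
      simpa using hrem h k hh
    · simpa using (Asymptotics.isLittleO_norm_pow_id (E' := V) one_lt_two)
  exact hfd.differentiableAt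

end SecondDerivative

/-! ### Contractions depending on a parameter -/

section FixedPoint

/-- Banach fixed point theorem on a closed ball whose centre is moved by at most `(1 - k) r`. -/
theorem exists_fixedPoint_closedBall {W : Type*} [NormedAddCommGroup W] [CompleteSpace W]
    {Φ : W → W} {c : W} {r k : ℝ} (hr : 0 ≤ r) (hk0 : 0 ≤ k) (hk : k < 1)
    (hc : ∀ w ∈ closedBall c r, ∀ w' ∈ closedBall c r, ‖Φ w - Φ w'‖ ≤ k * ‖w - w'‖)
    (h0 : ‖Φ c - c‖ ≤ (1 - k) * r) : ∃ w ∈ closedBall c r, Φ w = w := by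
  have hcm : c ∈ closedBall c r := mem_closedBall_self hr
  have hm : MapsTo Φ (closedBall c r) (closedBall c r) := fun w hw => by
    rw [mem_closedBall, dist_eq_norm]
    have h1 := hc w hw c hcm
    rw [mem_closedBall, dist_eq_norm] at hw
    have h2 : Φ w - c = (Φ w - Φ c) + (Φ c - c) := by abel
    rw [h2]
    refine (norm_add_le _ _).trans ?_
    nlinarith
  have hcon : ContractingWith ⟨k, hk0⟩ (hm.restrict Φ _ _) := by
    refine ⟨by exact_mod_cast hk, LipschitzWith.of_dist_le_mul fun x y => ?_⟩
    rw [Subtype.dist_eq, Subtype.dist_eq, dist_eq_norm, dist_eq_norm]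
    exact hc x x.2 y y.2
  obtain ⟨y, hy, hf, -⟩ := ContractingWith.exists_fixedPoint' isClosed_closedBall.isComplete hm
    hcon hcm (edist_ne_top _ _)
  exact ⟨y, hy, hf⟩

/-- The fixed point of a contraction depends differentiably on the parameter. Only the pairs
`(p', ω p')` and `(p', ω p)` need to be contracted when the parameter is not `p`. -/
theorem differentiableAt_fixedPoint {P W : Type*} [NormedAddCommGroup P] [NormedSpace ℂ P]
    [NormedAddCommGroup W] [NormedSpace ℂ W] [CompleteSpace W] {Φ : P × W → W} {ω : P → W} {p : P}
    (hΦ : DifferentiableAt ℂ Φ (p, ω p)) (hfix : ∀ᶠ p' in 𝓝 p, Φ (p', ω p') = ω p')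
    (hcon : ∀ᶠ p' in 𝓝 p, ‖Φ (p', ω p') - Φ (p', ω p)‖ ≤ 1 / 2 * ‖ω p' - ω p‖)
    (hcon' : ∀ᶠ w in 𝓝 (ω p), ‖Φ (p, w) - Φ (p, ω p)‖ ≤ 1 / 2 * ‖w - ω p‖) :
    DifferentiableAt ℂ ω p := by
  obtain ⟨Φ', hΦ'⟩ := hΦ
  set D₁ : P →L[ℂ] W := Φ'.comp (ContinuousLinearMap.inl ℂ P W) with hD₁
  set D₂ : W →L[ℂ] W := Φ'.comp (ContinuousLinearMap.inr ℂ P W) with hD₂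
  have h1 : HasFDerivAt (fun p' => Φ (p', ω p)) D₁ p :=
    hΦ'.comp p (hasFDerivAt_prodMk_left p (ω p))
  have h2 : HasFDerivAt (fun w => Φ (p, w)) D₂ (ω p) :=
    HasFDerivAt.comp (f := fun w => (p, w)) (ω p) hΦ' (hasFDerivAt_prodMk_right p (ω p))
  have hD2 : ‖D₂‖ ≤ 1 / 2 := h2.le_of_lip' (by norm_num) hcon'
  have hfix0 : Φ (p, ω p) = ω p := hfix.self_of_nhds
  -- `ω` is Lipschitz at `p`
  have hbig : (fun p' => ω p' - ω p) =O[𝓝 p] fun p' => p' - p := by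
    obtain ⟨c, hc⟩ := h1.isBigO_sub.bound
    refine Asymptotics.IsBigO.of_bound (2 * c) ?_
    filter_upwards [hfix, hcon, hc] with p' a1 a2 a3
    have e : ω p' - ω p = (Φ (p', ω p') - Φ (p', ω p)) + (Φ (p', ω p) - Φ (p, ω p)) := by
      rw [a1, hfix0]; abel
    have := (norm_add_le (Φ (p', ω p') - Φ (p', ω p)) (Φ (p', ω p) - Φ (p, ω p)))
    rw [← e] at this
    linarith
  have hcont : Tendsto ω (𝓝 p) (𝓝 (ω p)) := by
    have : Tendsto (fun p' : P => p' - p) (𝓝 p) (𝓝 0) := by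
      exact tendsto_sub_nhds_zero_iff.2 tendsto_id
    simpa using (hbig.trans_tendsto this).add_const (ω p)
  have hunit : IsUnit (1 - D₂) := isUnit_one_sub_of_norm_lt_one (by linarith)
  obtain ⟨S, hS⟩ := hunit.exists_left_inv
  have hS' : ∀ w, S (w - D₂ w) = w := fun w => by
    have := congrArg (fun T : W →L[ℂ] W => T w) hS
    simpa using this
  refine (HasFDerivAt.of_isLittleO (f' := S.comp D₁) ?_).differentiableAt
  have hto : Tendsto (fun p' => (p', ω p')) (𝓝 p) (𝓝 (p, ω p)) := tendsto_id.prodMk_nhds hcont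
  have hlit := hΦ'.isLittleO.comp_tendsto hto
  have hbig2 : (fun p' => ((p', ω p') : P × W) - (p, ω p)) =O[𝓝 p] fun p' => p' - p :=
    (Asymptotics.isBigO_refl _ _).prod_left hbig
  have hlit2 := (S.isBigO_comp _ _).trans_isLittleO (hlit.trans_isBigO hbig2)
  refine hlit2.congr' ?_ EventuallyEq.rfl
  filter_upwards [hfix] with p' a1
  have e1 : Φ' ((p', ω p') - (p, ω p)) = D₁ (p' - p) + D₂ (ω p' - ω p) := by
    rw [hD₁, hD₂]
    simp only [ContinuousLinearMap.comp_apply, ← map_add]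
    congr 1
    simp
  simp only [Function.comp_def, ContinuousLinearMap.comp_apply]
  rw [a1, hfix0, e1, ← hS' (ω p' - ω p), ← map_sub]
  congr 1
  rw [hS']
  abel

end FixedPoint

/-! ### Bounded Lipschitz functions -/

section BddLip

variable {α V W : Type*} [NormedAddCommGroup α] [NormedAddCommGroup V] [NormedAddCommGroup W]

/-- `g` is bounded and Lipschitz on `s`. -/
def BddLip (s : Set α) (g : α → V) : Prop :=
  ∃ K : ℝ, 0 ≤ K ∧ (∀ a ∈ s, ‖g a‖ ≤ K) ∧ ∀ a ∈ s, ∀ b ∈ s, ‖g a - g b‖ ≤ K * ‖a - b‖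

namespace BddLip

variable {s : Set α}

theorem const (v : V) : BddLip s fun _ => v :=
  ⟨‖v‖, norm_nonneg _, fun _ _ => le_rfl, fun _ _ _ _ => by simpa using by positivity⟩

theorem id (hs : Bornology.IsBounded s) : BddLip s fun a => a := by
  obtain ⟨K, hK⟩ := hs.exists_norm_le
  exact ⟨max K 1, by positivity, fun a ha => (hK a ha).trans (le_max_left _ _), fun a _ b _ =>
    le_mul_of_one_le_left (norm_nonneg _) (le_max_right _ _)⟩

theorem add {f g : α → V} (hf : BddLip s f) (hg : BddLip s g) : BddLip s fun a => f a + g a := by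
  obtain ⟨K, k0, k1, k2⟩ := hf
  obtain ⟨M, m0, m1, m2⟩ := hg
  refine ⟨K + M, by positivity, fun a ha => ?_, fun a ha b hb => ?_⟩
  · exact (norm_add_le _ _).trans (add_le_add (k1 a ha) (m1 a ha))
  · rw [add_sub_add_comm, add_mul]
    exact (norm_add_le _ _).trans (add_le_add (k2 a ha b hb) (m2 a ha b hb))

theorem neg {f : α → V} (hf : BddLip s f) : BddLip s fun a => -f a := by
  obtain ⟨K, k0, k1, k2⟩ := hf
  refine ⟨K, k0, fun a ha => by simpa using k1 a ha, fun a ha b hb => ?_⟩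
  rw [← neg_sub', norm_neg]
  exact k2 a ha b hb

theorem sub {f g : α → V} (hf : BddLip s f) (hg : BddLip s g) : BddLip s fun a => f a - g a := by
  simpa only [sub_eq_add_neg] using hf.add hg.neg

theorem comp_lipschitz {f : α → V} (hf : BddLip s f) {φ : V → W} {c : ℝ} (hc : 0 ≤ c)
    (h0 : ∀ v, ‖φ v‖ ≤ c * ‖v‖) (h1 : ∀ v v', ‖φ v - φ v'‖ ≤ c * ‖v - v'‖) :
    BddLip s fun a => φ (f a) := by
  obtain ⟨K, k0, k1, k2⟩ := hf
  refine ⟨c * K, by positivity, fun a ha => (h0 _).trans (by gcongr; exact k1 a ha),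
    fun a ha b hb => (h1 _ _).trans ?_⟩
  rw [mul_assoc]
  gcongr
  exact k2 a ha b hb

theorem fst {f : α → V × W} (hf : BddLip s f) : BddLip s fun a => (f a).1 :=
  hf.comp_lipschitz (φ := Prod.fst) zero_le_one (fun v => by rw [one_mul]; exact norm_fst_le v)
    fun v v' => by rw [one_mul]; exact norm_fst_le (v - v')

theorem snd {f : α → V × W} (hf : BddLip s f) : BddLip s fun a => (f a).2 :=
  hf.comp_lipschitz (φ := Prod.snd) zero_le_one (fun v => by rw [one_mul]; exact norm_snd_le v)
    fun v v' => by rw [one_mul]; exact norm_snd_le (v - v')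

theorem bilin {U : Type*} [NormedAddCommGroup U] {f : α → V} {g : α → W} (hf : BddLip s f)
    (hg : BddLip s g) {β : V → W → U} (h : ∀ v w, ‖β v w‖ ≤ ‖v‖ * ‖w‖)
    (hl : ∀ v v' w, β v w - β v' w = β (v - v') w) (hr : ∀ v w w', β v w - β v w' = β v (w - w')) :
    BddLip s fun a => β (f a) (g a) := by
  obtain ⟨K, k0, k1, k2⟩ := hf
  obtain ⟨M, m0, m1, m2⟩ := hg
  refine ⟨K * M + K * M, by positivity, fun a ha => ?_, fun a ha b hb => ?_⟩
  · have : ‖f a‖ * ‖g a‖ ≤ K * M := mul_le_mul (k1 a ha) (m1 a ha) (norm_nonneg _) k0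
    have := h (f a) (g a)
    nlinarith
  · have e : β (f a) (g a) - β (f b) (g b) = β (f a - f b) (g a) + β (f b) (g a - g b) := by
      rw [← hl, ← hr]; abel
    rw [e, add_mul]
    refine (norm_add_le _ _).trans (add_le_add ?_ ?_)
    · refine (h _ _).trans ?_
      calc ‖f a - f b‖ * ‖g a‖ ≤ (K * ‖a - b‖) * M :=
            mul_le_mul (k2 a ha b hb) (m1 a ha) (norm_nonneg _) (by positivity)
        _ = _ := by ring
    · refine (h _ _).trans ?_
      calc ‖f b‖ * ‖g a - g b‖ ≤ K * (M * ‖a - b‖) :=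
            mul_le_mul (k1 b hb) (m2 a ha b hb) (norm_nonneg _) k0
        _ = _ := by ring

theorem comp_maps {β : Type*} [NormedAddCommGroup β] {t : Set β} {f : α → V} (hf : BddLip s f)
    {g : β → α} {c : ℝ} (hc : 0 ≤ c) (hm : MapsTo g t s)
    (hg : ∀ x ∈ t, ∀ y ∈ t, ‖g x - g y‖ ≤ c * ‖x - y‖) : BddLip t fun x => f (g x) := by
  obtain ⟨K, k0, k1, k2⟩ := hf
  refine ⟨K + K * c, by positivity, fun x hx => ?_, fun x hx y hy => ?_⟩
  · exact (k1 _ (hm hx)).trans (by nlinarith)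
  · refine (k2 _ (hm hx) _ (hm hy)).trans ?_
    calc K * ‖g x - g y‖ ≤ K * (c * ‖x - y‖) := by gcongr; exact hg x hx y hy
      _ ≤ _ := by nlinarith [mul_nonneg k0 (norm_nonneg (x - y))]

theorem mul {R : Type*} [NormedRing R] {f g : α → R} (hf : BddLip s f) (hg : BddLip s g) :
    BddLip s fun a => f a * g a :=
  hf.bilin hg norm_mul_le (fun _ _ _ => (sub_mul _ _ _).symm) fun _ _ _ => (mul_sub _ _ _).symm

/-- The inverse of a bounded Lipschitz function is bounded and Lipschitz as soon as it is
bounded. -/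
theorem inverse {R : Type*} [NormedRing R] {f : α → R} (hf : BddLip s f)
    (hu : ∀ a ∈ s, IsUnit (f a)) {c : ℝ} (hc : 0 ≤ c) (hb : ∀ a ∈ s, ‖Ring.inverse (f a)‖ ≤ c) :
    BddLip s fun a => Ring.inverse (f a) := by
  obtain ⟨K, k0, k1, k2⟩ := hf
  refine ⟨c + c * K * c, by positivity,
    fun a ha => (hb a ha).trans (by nlinarith [mul_nonneg (mul_nonneg hc k0) hc]),
    fun a ha b hb' => ?_⟩
  have e : Ring.inverse (f a) - Ring.inverse (f b) =
      Ring.inverse (f a) * (f b - f a) * Ring.inverse (f b) := by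
    rw [mul_sub, sub_mul, Ring.inverse_mul_cancel _ (hu a ha), one_mul, mul_assoc,
      Ring.mul_inverse_cancel _ (hu b hb'), mul_one]
  rw [e]
  calc _ ≤ ‖Ring.inverse (f a)‖ * ‖f b - f a‖ * ‖Ring.inverse (f b)‖ :=
        (norm_mul_le _ _).trans (by gcongr; exact norm_mul_le _ _)
    _ ≤ c * (K * ‖a - b‖) * c := by
        gcongr
        · exact hb a ha
        · rw [norm_sub_rev]; exact k2 a ha b hb'
        · exact hb b hb'
    _ ≤ _ := by nlinarith [mul_nonneg hc (norm_nonneg (a - b))]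

variable {𝕜 E F G : Type*} [NontriviallyNormedField 𝕜] [NormedAddCommGroup E] [NormedSpace 𝕜 E]
  [NormedAddCommGroup F] [NormedSpace 𝕜 F] [NormedAddCommGroup G] [NormedSpace 𝕜 G]

theorem clm_comp {f : α → F →L[𝕜] G} {g : α → E →L[𝕜] F} (hf : BddLip s f) (hg : BddLip s g) :
    BddLip s fun a => (f a).comp (g a) :=
  hf.bilin hg (fun a b => a.opNorm_comp_le b) (fun _ _ _ => (ContinuousLinearMap.sub_comp ..).symm)
    fun _ _ _ => (ContinuousLinearMap.comp_sub ..).symm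

theorem clm_apply {f : α → F →L[𝕜] G} {g : α → F} (hf : BddLip s f) (hg : BddLip s g) :
    BddLip s fun a => (f a) (g a) :=
  hf.bilin hg (fun a b => a.le_opNorm b) (fun _ _ _ => rfl) fun _ _ _ => (map_sub ..).symm

end BddLip

end BddLip

/-! ### Complexification of Banach spaces and of bounded operators -/

/-- `Vc` is a complexification of the real normed space `V`: every `z` in `Vc` is `re z + i im z`,
and the projections onto the real and imaginary parts are contractions. This covers `E_ℂ` and, with
its supremum norm, `C⁰([0, T], E_ℂ)`. -/
class CxPair (V Vc : Type*) [NormedAddCommGroup V] [NormedSpace ℝ V] [NormedAddCommGroup Vc]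
    [NormedSpace ℂ Vc] where
  re : Vc → V
  im : Vc → V
  ofR : V → Vc
  ext' : ∀ z z' : Vc, re z = re z' → im z = im z' → z = z'
  re_add : ∀ z z', re (z + z') = re z + re z'
  im_add : ∀ z z', im (z + z') = im z + im z'
  re_smul : ∀ (c : ℂ) z, re (c • z) = c.re • re z - c.im • im z
  im_smul : ∀ (c : ℂ) z, im (c • z) = c.re • im z + c.im • re z
  re_ofR : ∀ x, re (ofR x) = x
  im_ofR : ∀ x, im (ofR x) = 0
  norm_re : ∀ z, ‖re z‖ ≤ ‖z‖
  norm_im : ∀ z, ‖im z‖ ≤ ‖z‖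
  norm_ofR : ∀ x, ‖ofR x‖ = ‖x‖

namespace Cx

variable {E : Type*} [NormedAddCommGroup E]

instance [CompleteSpace E] : CompleteSpace (Cx E) :=
  inferInstanceAs (CompleteSpace (WithLp 2 (E × E)))

theorem norm_re_le (z : Cx E) : ‖z.re‖ ≤ ‖z‖ := by
  refine le_of_sq_le_sq ?_ (norm_nonneg _)
  rw [norm_sq]; nlinarith [sq_nonneg ‖z.im‖]

theorem norm_im_le (z : Cx E) : ‖z.im‖ ≤ ‖z‖ := by
  refine le_of_sq_le_sq ?_ (norm_nonneg _)
  rw [norm_sq]; nlinarith [sq_nonneg ‖z.re‖]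

theorem norm_le_add (z : Cx E) : ‖z‖ ≤ ‖z.re‖ + ‖z.im‖ := by
  refine le_of_sq_le_sq ?_ (by positivity)
  rw [norm_sq]; nlinarith [mul_nonneg (norm_nonneg z.re) (norm_nonneg z.im)]

theorem norm_ofReal (x : E) : ‖ofReal x‖ = ‖x‖ := by
  have h : ‖ofReal x‖ ^ 2 = ‖x‖ ^ 2 := by rw [norm_sq]; simp [ofReal]
  exact (sq_eq_sq₀ (norm_nonneg _) (norm_nonneg _)).1 h

theorem continuous_re : Continuous (re : Cx E → E) :=
  (AddMonoidHomClass.lipschitz_of_bound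
    (AddMonoidHom.mk' (re : Cx E → E) re_add) 1 (by simpa using norm_re_le)).continuous

theorem continuous_im : Continuous (im : Cx E → E) :=
  (AddMonoidHomClass.lipschitz_of_bound
    (AddMonoidHom.mk' (im : Cx E → E) im_add) 1 (by simpa using norm_im_le)).continuous

@[simp] theorem re_ofReal (x : E) : (ofReal x).re = x := rfl

@[simp] theorem im_ofReal (x : E) : (ofReal x).im = 0 := rfl

variable [InnerProductSpace ℝ E]

instance : CxPair E (Cx E) where
  re := re
  im := im
  ofR := ofReal
  ext' _ _ := Cx.ext
  re_add := re_add
  im_add := im_add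
  re_smul := re_smul
  im_smul := im_smul
  re_ofR := re_ofReal
  im_ofR := im_ofReal
  norm_re := norm_re_le
  norm_im := norm_im_le
  norm_ofR := norm_ofReal

instance {α : Type*} [TopologicalSpace α] [CompactSpace α] : CxPair C(α, E) C(α, Cx E) where
  re z := ⟨fun t => (z t).re, continuous_re.comp z.continuous⟩
  im z := ⟨fun t => (z t).im, continuous_im.comp z.continuous⟩
  ofR y := ⟨fun t => ofReal (y t), isometry_ofReal.continuous.comp y.continuous⟩
  ext' z z' h h' := by
    ext1 t
    exact Cx.ext (DFunLike.congr_fun h t) (DFunLike.congr_fun h' t)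
  re_add _ _ := rfl
  im_add _ _ := rfl
  re_smul _ _ := rfl
  im_smul _ _ := rfl
  re_ofR _ := rfl
  im_ofR _ := rfl
  norm_re z := (ContinuousMap.norm_le _ (norm_nonneg _)).2 fun t =>
    (norm_re_le _).trans (z.norm_coe_le_norm t)
  norm_im z := (ContinuousMap.norm_le _ (norm_nonneg _)).2 fun t =>
    (norm_im_le _).trans (z.norm_coe_le_norm t)
  norm_ofR y := by
    refine le_antisymm ((ContinuousMap.norm_le _ (norm_nonneg _)).2 fun t => ?_)
      ((ContinuousMap.norm_le _ (norm_nonneg _)).2 fun t => ?_)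
    · exact (norm_ofReal _).trans_le (y.norm_coe_le_norm t)
    · rw [← norm_ofReal]
      exact ContinuousMap.norm_coe_le_norm
        (⟨fun t => ofReal (y t), isometry_ofReal.continuous.comp y.continuous⟩ : C(α, Cx E)) t

end Cx

namespace CxPair

variable {V Vc W Wc U Uc : Type*}
  [NormedAddCommGroup V] [NormedSpace ℝ V] [NormedAddCommGroup Vc] [NormedSpace ℂ Vc] [CxPair V Vc]
  [NormedAddCommGroup W] [NormedSpace ℝ W] [NormedAddCommGroup Wc] [NormedSpace ℂ Wc] [CxPair W Wc]
  [NormedAddCommGroup U] [NormedSpace ℝ U] [NormedAddCommGroup Uc] [NormedSpace ℂ Uc] [CxPair U Uc]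

theorem ofR_add (x y : V) : (ofR (x + y) : Vc) = ofR x + ofR y :=
  ext' (V := V) _ _ (by simp only [re_add, re_ofR]) (by simp only [im_add, im_ofR, add_zero])

theorem ofR_smul (r : ℝ) (x : V) : (ofR (r • x) : Vc) = (r : ℂ) • ofR x :=
  ext' (V := V) _ _ (by simp only [re_smul, re_ofR, im_ofR]; simp)
    (by simp only [im_smul, re_ofR, im_ofR]; simp)

theorem ofR_zero : (ofR (0 : V) : Vc) = 0 := by
  simpa using ofR_smul (Vc := Vc) 0 (0 : V)

theorem ofR_neg (x : V) : (ofR (-x) : Vc) = -ofR x := by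
  simpa using ofR_smul (Vc := Vc) (-1) x

theorem ofR_sub (x y : V) : (ofR (x - y) : Vc) = ofR x - ofR y := by
  rw [sub_eq_add_neg, ofR_add, ofR_neg, ← sub_eq_add_neg]

theorem norm_ofR_sub (x y : V) : ‖(ofR x : Vc) - ofR y‖ = ‖x - y‖ := by
  rw [← ofR_sub, norm_ofR]

theorem eq_re_add_im (z : Vc) : z = ofR (re z : V) + Complex.I • ofR (im z : V) :=
  ext' (V := V) _ _ (by simp only [re_add, re_smul, re_ofR, im_ofR]; simp)
    (by simp only [im_add, im_smul, re_ofR, im_ofR]; simp)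

/-- Complex-linear operators are determined by their values on real vectors. -/
theorem clm_ext {U' : Type*} [NormedAddCommGroup U'] [NormedSpace ℂ U'] {S S' : Vc →L[ℂ] U'}
    (h : ∀ x : V, S (ofR x) = S' (ofR x)) : S = S' := by
  ext z
  rw [eq_re_add_im (V := V) z]
  simp only [map_add, map_smul, h]

/-- The complex-linear extension of a real operator. -/
def cxify (T : V →L[ℝ] W) : Vc →L[ℂ] Wc :=
  LinearMap.mkContinuous
    { toFun := fun z => ofR (T (re z)) + Complex.I • ofR (T (im z))
      map_add' := fun z z' => by
        simp only [re_add, im_add, map_add, ofR_add, smul_add]; abel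
      map_smul' := fun c z => by
        simp only [re_smul, im_smul, map_add, map_sub, map_smul, ofR_add, ofR_sub, ofR_smul,
          RingHom.id_apply, smul_add, smul_smul]
        have hc : c = (c.re : ℂ) + c.im * Complex.I := (Complex.re_add_im c).symm
        generalize c.re = a at *
        generalize c.im = b at *
        subst hc
        have h1 : ((a : ℂ) + b * Complex.I) * Complex.I = a * Complex.I - b := by
          linear_combination (b : ℂ) * Complex.I_mul_I
        rw [h1]
        module }
    (2 * ‖T‖) fun z => by
      change ‖(ofR (T (re z)) : Wc) + Complex.I • ofR (T (im z))‖ ≤ _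
      refine (norm_add_le _ _).trans ?_
      rw [norm_smul, Complex.norm_I, one_mul, norm_ofR, norm_ofR]
      have h1 := (T.le_opNorm (re z)).trans
        (mul_le_mul_of_nonneg_left (norm_re (V := V) z) (norm_nonneg T))
      have h2 := (T.le_opNorm (im z)).trans
        (mul_le_mul_of_nonneg_left (norm_im (V := V) z) (norm_nonneg T))
      linarith

theorem cxify_apply (T : V →L[ℝ] W) (z : Vc) :
    (cxify T z : Wc) = ofR (T (re z)) + Complex.I • ofR (T (im z)) := rfl

theorem norm_cxify_le (T : V →L[ℝ] W) : ‖(cxify T : Vc →L[ℂ] Wc)‖ ≤ 2 * ‖T‖ :=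
  LinearMap.mkContinuous_norm_le _ (by positivity) _

@[simp] theorem cxify_ofR (T : V →L[ℝ] W) (x : V) : (cxify T (ofR x : Vc) : Wc) = ofR (T x) := by
  rw [cxify_apply, re_ofR, im_ofR, map_zero, ofR_zero, smul_zero, add_zero]

theorem cxify_comp (S : W →L[ℝ] U) (T : V →L[ℝ] W) :
    (cxify (S.comp T) : Vc →L[ℂ] Uc) = (cxify S : Wc →L[ℂ] Uc).comp (cxify T) :=
  clm_ext (V := V) fun x => by simp

theorem cxify_id : (cxify (ContinuousLinearMap.id ℝ V) : Vc →L[ℂ] Vc) = .id ℂ Vc :=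
  clm_ext (V := V) fun x => by simp

theorem cxify_add (S T : V →L[ℝ] W) :
    (cxify (S + T) : Vc →L[ℂ] Wc) = cxify S + cxify T :=
  clm_ext (V := V) fun x => by simp [ofR_add]

theorem cxify_neg (T : V →L[ℝ] W) : (cxify (-T) : Vc →L[ℂ] Wc) = -cxify T :=
  clm_ext (V := V) fun x => by simp [ofR_neg]

theorem cxify_sub (S T : V →L[ℝ] W) :
    (cxify (S - T) : Vc →L[ℂ] Wc) = cxify S - cxify T :=
  clm_ext (V := V) fun x => by simp [ofR_sub]

theorem cxify_one : (cxify (1 : V →L[ℝ] V) : Vc →L[ℂ] Vc) = 1 := cxify_id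

theorem cxify_mul (S T : V →L[ℝ] V) :
    (cxify (S * T) : Vc →L[ℂ] Vc) = cxify S * cxify T := cxify_comp S T

theorem isUnit_cxify {T : V →L[ℝ] V} (h : IsUnit T) : IsUnit (cxify T : Vc →L[ℂ] Vc) :=
  ⟨⟨cxify T, cxify (Ring.inverse T), by
      rw [← cxify_mul, Ring.mul_inverse_cancel _ h, cxify_one], by
      rw [← cxify_mul, Ring.inverse_mul_cancel _ h, cxify_one]⟩, rfl⟩

theorem inverse_cxify {T : V →L[ℝ] V} (h : IsUnit T) :
    Ring.inverse (cxify T : Vc →L[ℂ] Vc) = cxify (Ring.inverse T) := by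
  have h1 : (cxify T : Vc →L[ℂ] Vc) * cxify (Ring.inverse T) = 1 := by
    rw [← cxify_mul, Ring.mul_inverse_cancel _ h, cxify_one]
  rw [← mul_one (Ring.inverse _), ← h1, ← mul_assoc, Ring.inverse_mul_cancel _ (isUnit_cxify h),
    one_mul]

/-- The real part `T₁` of the complex-linear operator `T₁ + iT₂`. -/
def rePart (S : Vc →L[ℂ] Wc) : V →L[ℝ] W :=
  LinearMap.mkContinuous
    { toFun := fun x => re (S (ofR x))
      map_add' := fun x y => by rw [ofR_add, map_add, re_add]
      map_smul' := fun r x => by rw [ofR_smul, map_smul, re_smul]; simp }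
    ‖S‖ fun x => (norm_re _).trans ((S.le_opNorm _).trans_eq (by rw [norm_ofR]))

/-- The imaginary part `T₂` of the complex-linear operator `T₁ + iT₂`. -/
def imPart (S : Vc →L[ℂ] Wc) : V →L[ℝ] W :=
  LinearMap.mkContinuous
    { toFun := fun x => im (S (ofR x))
      map_add' := fun x y => by rw [ofR_add, map_add, im_add]
      map_smul' := fun r x => by rw [ofR_smul, map_smul, im_smul]; simp }
    ‖S‖ fun x => (norm_im _).trans ((S.le_opNorm _).trans_eq (by rw [norm_ofR]))

theorem rePart_apply (S : Vc →L[ℂ] Wc) (x : V) : (rePart S x : W) = re (S (ofR x)) := rfl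

theorem imPart_apply (S : Vc →L[ℂ] Wc) (x : V) : (imPart S x : W) = im (S (ofR x)) := rfl

theorem norm_rePart_le (S : Vc →L[ℂ] Wc) : ‖(rePart S : V →L[ℝ] W)‖ ≤ ‖S‖ :=
  LinearMap.mkContinuous_norm_le _ (norm_nonneg _) _

theorem norm_imPart_le (S : Vc →L[ℂ] Wc) : ‖(imPart S : V →L[ℝ] W)‖ ≤ ‖S‖ :=
  LinearMap.mkContinuous_norm_le _ (norm_nonneg _) _

section Transpose

variable {E Ec F Fc : Type*}
  [NormedAddCommGroup E] [InnerProductSpace ℝ E] [CompleteSpace E]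
  [NormedAddCommGroup Ec] [NormedSpace ℂ Ec] [CxPair E Ec]
  [NormedAddCommGroup F] [InnerProductSpace ℝ F] [CompleteSpace F]
  [NormedAddCommGroup Fc] [NormedSpace ℂ Fc] [CxPair F Fc]

open ContinuousLinearMap in
variable (E Ec F Fc) in
/-- The transpose `T₁* + iT₂*` of `T₁ + iT₂`. Unlike the Hermitian adjoint it is complex linear, so
that the transpose of a holomorphic family of operators is holomorphic. -/
def transp : (Ec →L[ℂ] Fc) →L[ℂ] (Fc →L[ℂ] Ec) :=
  LinearMap.mkContinuous
    { toFun := fun S => cxify (adjoint (rePart S : E →L[ℝ] F)) +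
        Complex.I • cxify (adjoint (imPart S : E →L[ℝ] F))
      map_add' := fun S S' => by
        have h1 : (rePart (S + S') : E →L[ℝ] F) = rePart S + rePart S' := by
          ext x; simp [rePart_apply, re_add]
        have h2 : (imPart (S + S') : E →L[ℝ] F) = imPart S + imPart S' := by
          ext x; simp [imPart_apply, im_add]
        rw [h1, h2, map_add, map_add, cxify_add, cxify_add, smul_add]
        abel
      map_smul' := fun c S => by
        have h1 : (rePart (c • S) : E →L[ℝ] F) = c.re • rePart S - c.im • imPart S := by
          ext x; simp [rePart_apply, imPart_apply, re_smul]
        have h2 : (imPart (c • S) : E →L[ℝ] F) = c.re • imPart S + c.im • rePart S := by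
          ext x; simp [rePart_apply, imPart_apply, im_smul]
        rw [h1, h2]
        refine clm_ext (V := F) fun x => ?_
        simp only [map_add, map_sub, map_smulₛₗ, add_apply, smul_apply, cxify_ofR, sub_apply,
          ofR_add, ofR_sub, ofR_smul, RingHom.id_apply, smul_add, smul_smul,
          starRingEnd_apply, star_trivial]
        have hc : c = (c.re : ℂ) + c.im * Complex.I := (Complex.re_add_im c).symm
        generalize c.re = a at *
        generalize c.im = b at *
        subst hc
        have h1 : ((a : ℂ) + b * Complex.I) * Complex.I = a * Complex.I - b := by
          linear_combination (b : ℂ) * Complex.I_mul_I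
        rw [h1]
        module }
    4 fun S => by
      refine (norm_add_le _ _).trans ?_
      rw [norm_smul, Complex.norm_I, one_mul]
      have h1 := norm_cxify_le (Vc := Fc) (Wc := Ec) (adjoint (rePart S : E →L[ℝ] F))
      have h2 := norm_cxify_le (Vc := Fc) (Wc := Ec) (adjoint (imPart S : E →L[ℝ] F))
      rw [LinearIsometryEquiv.norm_map] at h1 h2
      have h3 := norm_rePart_le (V := E) (W := F) S
      have h4 := norm_imPart_le (V := E) (W := F) S
      linarith

theorem transp_cxify (T : E →L[ℝ] F) :
    transp E Ec F Fc (cxify T) = (cxify (ContinuousLinearMap.adjoint T) : Fc →L[ℂ] Ec) := by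
  have h1 : (rePart (cxify T : Ec →L[ℂ] Fc) : E →L[ℝ] F) = T := by
    ext x; simp [rePart_apply, re_ofR]
  have h2 : (imPart (cxify T : Ec →L[ℂ] Fc) : E →L[ℝ] F) = 0 := by
    ext x; simp [imPart_apply, im_ofR]
  change (cxify (ContinuousLinearMap.adjoint (rePart (cxify T : Ec →L[ℂ] Fc) : E →L[ℝ] F)) +
    Complex.I • cxify (ContinuousLinearMap.adjoint (imPart (cxify T : Ec →L[ℂ] Fc) : E →L[ℝ] F)) :
      Fc →L[ℂ] Ec) = _
  rw [h1, h2, map_zero]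
  refine clm_ext (V := F) fun x => ?_
  simp [ofR_zero]

end Transpose

end CxPair

/-! ### Superposition operators on spaces of continuous paths -/

section PathMul

variable {α 𝕜 E F : Type*} [TopologicalSpace α] [CompactSpace α] [NontriviallyNormedField 𝕜]
  [NormedAddCommGroup E] [NormedSpace 𝕜 E] [NormedAddCommGroup F] [NormedSpace 𝕜 F]

/-- Pointwise multiplication `w ↦ (t ↦ m(t) w(t))` by a continuous path of operators. -/
def pathMul (m : C(α, E →L[𝕜] F)) : C(α, E) →L[𝕜] C(α, F) :=
  LinearMap.mkContinuous
    { toFun := fun w => ⟨fun t => m t (w t), m.continuous.clm_apply w.continuous⟩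
      map_add' := fun w w' => by ext t; simp
      map_smul' := fun c w => by ext t; simp }
    ‖m‖ fun w => by
      refine (ContinuousMap.norm_le _ (by positivity)).2 fun t => ?_
      exact ((m t).le_opNorm _).trans
        (mul_le_mul (m.norm_coe_le_norm t) (w.norm_coe_le_norm t) (norm_nonneg _) (norm_nonneg m))

@[simp] theorem pathMul_apply (m : C(α, E →L[𝕜] F)) (w : C(α, E)) (t : α) :
    pathMul m w t = m t (w t) := rfl

theorem norm_pathMul_le (m : C(α, E →L[𝕜] F)) : ‖pathMul m‖ ≤ ‖m‖ :=
  LinearMap.mkContinuous_norm_le _ (norm_nonneg m) _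

theorem pathMul_sub (m m' : C(α, E →L[𝕜] F)) : pathMul m - pathMul m' = pathMul (m - m') := by
  ext w t; simp

/-- A bounded operator acting pointwise on paths. -/
abbrev pathLift (α : Type*) [TopologicalSpace α] [CompactSpace α] (S : E →L[𝕜] F) :
    C(α, E) →L[𝕜] C(α, F) :=
  ContinuousLinearMap.compLeftContinuous 𝕜 α S

theorem norm_pathLift_apply_le (S : E →L[𝕜] F) (w : C(α, E)) : ‖pathLift α S w‖ ≤ ‖S‖ * ‖w‖ :=
  (ContinuousMap.norm_le _ (by positivity)).2 fun t =>
    (S.le_opNorm _).trans (by gcongr; exact w.norm_coe_le_norm t)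

theorem norm_pathLift_le (S : E →L[𝕜] F) : ‖pathLift α S‖ ≤ ‖S‖ :=
  ContinuousLinearMap.opNorm_le_bound _ (norm_nonneg _) (norm_pathLift_apply_le S)

end PathMul

section PathMap

variable {α V W : Type*} [TopologicalSpace α] [TopologicalSpace V] [TopologicalSpace W]

theorem continuous_comp_path {g : V → W} {s : Set V} (hg : ContinuousOn g s) {q : C(α, V)}
    (hq : ∀ t, q t ∈ s) : Continuous fun t => g (q t) :=
  hg.comp_continuous q.continuous hq

variable [Zero W]

open Classical in
/-- The path `t ↦ g(q(t))`, when it is continuous (and `0` otherwise). -/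
def pathMap (g : V → W) (q : C(α, V)) : C(α, W) :=
  if h : Continuous fun t => g (q t) then ⟨fun t => g (q t), h⟩ else 0

theorem pathMap_apply {g : V → W} {q : C(α, V)} (h : Continuous fun t => g (q t)) (t : α) :
    pathMap g q t = g (q t) := by
  rw [pathMap, dif_pos h]; rfl

end PathMap

section PathMapNormed

variable {α V W : Type*} [TopologicalSpace α] [CompactSpace α] [NormedAddCommGroup V]
  [NormedAddCommGroup W]

theorem norm_pathMap_le {g : V → W} {s : Set V} (hg : ContinuousOn g s) {L : ℝ} (hL : 0 ≤ L)
    (h : ∀ x ∈ s, ‖g x‖ ≤ L) {q : C(α, V)} (hq : ∀ t, q t ∈ s) : ‖pathMap g q‖ ≤ L :=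
  (ContinuousMap.norm_le _ hL).2 fun t => by
    rw [pathMap_apply (continuous_comp_path hg hq)]; exact h _ (hq t)

theorem norm_pathMap_sub_le {g : V → W} {s : Set V} (hg : ContinuousOn g s) {L : ℝ} (hL : 0 ≤ L)
    (h : ∀ x ∈ s, ∀ y ∈ s, ‖g x - g y‖ ≤ L * ‖x - y‖) {q q' : C(α, V)} (hq : ∀ t, q t ∈ s)
    (hq' : ∀ t, q' t ∈ s) : ‖pathMap g q - pathMap g q'‖ ≤ L * ‖q - q'‖ :=
  (ContinuousMap.norm_le _ (by positivity)).2 fun t => by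
    rw [ContinuousMap.sub_apply, pathMap_apply (continuous_comp_path hg hq),
      pathMap_apply (continuous_comp_path hg hq')]
    exact (h _ (hq t) _ (hq' t)).trans (by gcongr; exact (q - q').norm_coe_le_norm t)

end PathMapNormed

section Holomorphic

variable {α V W : Type*} [TopologicalSpace α] [CompactSpace α] [NormedAddCommGroup V]
  [NormedAddCommGroup W] {F : V → W} {s : Set V} {L : ℝ}

theorem isOpen_pathsIn (hs : IsOpen s) : IsOpen {q : C(α, V) | ∀ t, q t ∈ s} := by
  have := ContinuousMap.isOpen_setOfPred_mapsTo (X := α) (Y := V) isCompact_univ hs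
  simpa [MapsTo] using this

theorem continuousOn_of_lipschitz {g : V → W} (hL : ∀ y ∈ s, ∀ y' ∈ s,
    ‖g y - g y'‖ ≤ L * ‖y - y'‖) : ContinuousOn g s := by
  refine (LipschitzOnWith.of_dist_le_mul (K := L.toNNReal) fun x hx y hy => ?_).continuousOn
  rw [dist_eq_norm, dist_eq_norm]
  refine (hL x hx y hy).trans ?_
  gcongr
  exact Real.le_coe_toNNReal L

variable [NormedSpace ℂ V] [NormedSpace ℂ W]

/-- The superposition operator of a holomorphic map with Lipschitz derivative is holomorphic on
paths. -/
theorem hasFDerivAt_pathMap (hs : IsOpen s) (hF : ∀ y ∈ s, DifferentiableAt ℂ F y)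
    (hL0 : 0 ≤ L) (hL : ∀ y ∈ s, ∀ y' ∈ s, ‖fderiv ℂ F y - fderiv ℂ F y'‖ ≤ L * ‖y - y'‖)
    (hconv : Convex ℝ s) {q : C(α, V)} (hq : ∀ t, q t ∈ s) :
    HasFDerivAt (pathMap F : C(α, V) → C(α, W)) (pathMul (pathMap (fderiv ℂ F) q)) q := by
  have hcF : ContinuousOn F s := fun y hy => (hF y hy).continuousAt.continuousWithinAt
  have hcD : ContinuousOn (fderiv ℂ F) s := continuousOn_of_lipschitz hL
  rw [hasFDerivAt_iff_isLittleO]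
  refine Asymptotics.IsBigO.trans_isLittleO (g := fun q' => ‖q' - q‖ ^ 2) ?_ ?_
  · refine Asymptotics.IsBigO.of_bound L ?_
    filter_upwards [(isOpen_pathsIn hs).mem_nhds hq] with q' hq'
    refine (ContinuousMap.norm_le _ (by positivity)).2 fun t => ?_
    simp only [ContinuousMap.sub_apply, pathMul_apply]
    rw [pathMap_apply (continuous_comp_path hcF hq'), pathMap_apply (continuous_comp_path hcF hq),
      pathMap_apply (continuous_comp_path hcD hq)]
    refine (norm_taylor_one_le hconv hF hL hL0 (hq t) (hq' t)).trans ?_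
    have := (q' - q).norm_coe_le_norm t
    rw [ContinuousMap.sub_apply] at this
    rw [norm_pow, norm_norm, pow_two, mul_assoc]
    gcongr
  · exact (Asymptotics.isLittleO_norm_pow_id (E' := C(α, V)) one_lt_two).comp_tendsto
      (tendsto_sub_nhds_zero_iff.2 (tendsto_id (x := 𝓝 q)))

/-- The derivative of a superposition operator is again holomorphic: it is the derivative of a
holomorphic map with Lipschitz derivative between spaces of paths. -/
theorem differentiableAt_pathMul_fderiv [CompleteSpace W] (hs : IsOpen s)
    (hF : ∀ y ∈ s, DifferentiableAt ℂ F y)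
    (hL0 : 0 ≤ L) (hL : ∀ y ∈ s, ∀ y' ∈ s, ‖fderiv ℂ F y - fderiv ℂ F y'‖ ≤ L * ‖y - y'‖)
    (hconv : Convex ℝ s) {q : C(α, V)} (hq : ∀ t, q t ∈ s) :
    DifferentiableAt ℂ
      (fun q' : C(α, V) => (pathMul (pathMap (fderiv ℂ F) q') : C(α, V) →L[ℂ] C(α, W))) q := by
  have hcD : ContinuousOn (fderiv ℂ F) s := continuousOn_of_lipschitz hL
  have hd : ∀ q' : C(α, V), (∀ t, q' t ∈ s) →
      HasFDerivAt (pathMap F : C(α, V) → C(α, W)) (pathMul (pathMap (fderiv ℂ F) q')) q' :=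
    fun q' hq' => hasFDerivAt_pathMap hs hF hL0 hL hconv hq'
  obtain ⟨r, hr, hb⟩ := Metric.isOpen_iff.1 (isOpen_pathsIn (α := α) hs) q hq
  have key : DifferentiableAt ℂ (fderiv ℂ (pathMap F : C(α, V) → C(α, W))) q := by
    have h2 : ball q (2 * (r / 2)) ⊆ {q' : C(α, V) | ∀ t, q' t ∈ s} := by
      rwa [mul_div_cancel₀ r two_ne_zero]
    refine differentiableAt_fderiv_of_lipschitz (r := r / 2) (L := L)
      (fun y hy => (hd y (h2 hy)).differentiableAt) (by positivity) hL0 fun y hy y' hy' => ?_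
    rw [(hd y (h2 hy)).fderiv, (hd y' (h2 hy')).fderiv, pathMul_sub]
    exact (norm_pathMul_le _).trans (norm_pathMap_sub_le hcD hL0 hL (h2 hy) (h2 hy'))
  refine key.congr_of_eventuallyEq ?_
  filter_upwards [(isOpen_pathsIn hs).mem_nhds hq] with q' hq'
  exact (hd q' hq').fderiv.symm

end Holomorphic

/-! ### Reconstruction for the linearized equation -/

section Reconstruction

variable {𝕜 Z H Wh : Type*} [NontriviallyNormedField 𝕜] [NormedAddCommGroup Z] [NormedSpace 𝕜 Z]
  [NormedAddCommGroup H] [NormedSpace 𝕜 H] [NormedAddCommGroup Wh] [NormedSpace 𝕜 Wh]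

/-- The resolvent `(1 - D M)⁻¹` of the Volterra equation `w = D (M w) + g`. -/
def volterraInv (D M : Z →L[𝕜] Z) : Z →L[𝕜] Z := Ring.inverse (1 - D * M)

/-- The observation of the solution of `w = E x + D (M w)`, as a function of the initial
datum `x`. -/
def obsOp (D : Z →L[𝕜] Z) (E : H →L[𝕜] Z) (B : Z →L[𝕜] Wh) (M : Z →L[𝕜] Z) : H →L[𝕜] Wh :=
  B.comp ((volterraInv D M).comp E)

/-- The observability Gramian; `tr` stands for the transposition of operators. -/
def gramian (tr : (H →L[𝕜] Wh) →L[𝕜] (Wh →L[𝕜] H)) (D : Z →L[𝕜] Z) (E : H →L[𝕜] Z)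
    (B : Z →L[𝕜] Wh) (M : Z →L[𝕜] Z) : H →L[𝕜] H :=
  (tr (obsOp D E B M)).comp (obsOp D E B M)

/-- The part of the reconstruction operator that acts on the observation. -/
def obsRecon (tr : (H →L[𝕜] Wh) →L[𝕜] (Wh →L[𝕜] H)) (D : Z →L[𝕜] Z) (E : H →L[𝕜] Z)
    (B : Z →L[𝕜] Wh) (M : Z →L[𝕜] Z) : Wh →L[𝕜] Z :=
  -(((volterraInv D M).comp E).comp
    ((Ring.inverse (gramian tr D E B M)).comp (tr (obsOp D E B M))))

/-- The part of the reconstruction operator that acts on the source term. -/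
def srcRecon (tr : (H →L[𝕜] Wh) →L[𝕜] (Wh →L[𝕜] H)) (D : Z →L[𝕜] Z) (E : H →L[𝕜] Z)
    (B : Z →L[𝕜] Wh) (M : Z →L[𝕜] Z) : Z →L[𝕜] Z :=
  (volterraInv D M).comp D + (obsRecon tr D E B M).comp (B.comp ((volterraInv D M).comp D))

/-- The linear equation with potential `M` is well-posed and observable. -/
def Observable (tr : (H →L[𝕜] Wh) →L[𝕜] (Wh →L[𝕜] H)) (D : Z →L[𝕜] Z) (E : H →L[𝕜] Z)
    (B : Z →L[𝕜] Wh) (M : Z →L[𝕜] Z) : Prop :=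
  IsUnit (1 - D * M) ∧ IsUnit (gramian tr D E B M)

variable {tr : (H →L[𝕜] Wh) →L[𝕜] (Wh →L[𝕜] H)} {D : Z →L[𝕜] Z} {E : H →L[𝕜] Z}
  {B : Z →L[𝕜] Wh} {M : Z →L[𝕜] Z}

theorem volterraInv_apply_sub (h : IsUnit (1 - D * M)) (w : Z) :
    volterraInv D M (w - D (M w)) = w := by
  have := congrArg (fun S : Z →L[𝕜] Z => S w) (Ring.inverse_mul_cancel _ h)
  simpa [volterraInv] using this

theorem sub_volterraInv_apply (h : IsUnit (1 - D * M)) (w : Z) :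
    volterraInv D M w - D (M (volterraInv D M w)) = w := by
  have := congrArg (fun S : Z →L[𝕜] Z => S w) (Ring.mul_inverse_cancel _ h)
  simpa [volterraInv] using this

/-- A solution of the linear equation with source `F` and observation `-b` is reconstructed from
`F` and `b`. -/
theorem eq_recon (h : Observable tr D E B M) {w F : Z} {x : H} {b : Wh}
    (hw : w = E x + D (M w + F)) (hb : B w = -b) :
    w = srcRecon tr D E B M F + obsRecon tr D E B M b := by
  have h1 : w - D (M w) = E x + D F := by
    rw [map_add] at hw
    rw [sub_eq_iff_eq_add]; conv_lhs => rw [hw]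
    abel
  have h2 : w = volterraInv D M (E x) + volterraInv D M (D F) := by
    rw [← map_add, ← h1, volterraInv_apply_sub h.1]
  have h3 : obsOp D E B M x = -(b + B (volterraInv D M (D F))) := by
    have : B w = obsOp D E B M x + B (volterraInv D M (D F)) := by
      conv_lhs => rw [h2]
      rw [map_add]; rfl
    rw [hb] at this
    rw [neg_add, this]; abel
  have h4 : Ring.inverse (gramian tr D E B M) (tr (obsOp D E B M) (obsOp D E B M x)) = x := by
    have := congrArg (fun S : H →L[𝕜] H => S x) (Ring.inverse_mul_cancel _ h.2)
    simpa [gramian] using this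
  conv_lhs => rw [h2, ← h4, h3]
  simp only [srcRecon, obsRecon, ContinuousLinearMap.comp_apply, add_apply, neg_apply,
    map_add, map_neg]
  abel

theorem norm_obsOp_le :
    ‖obsOp D E B M‖ ≤ ‖B‖ * (‖volterraInv D M‖ * ‖E‖) :=
  (ContinuousLinearMap.opNorm_comp_le _ _).trans
    (by gcongr; exact ContinuousLinearMap.opNorm_comp_le _ _)

variable [CompleteSpace Z]

theorem differentiableAt_volterraInv (h : IsUnit (1 - D * M)) :
    DifferentiableAt 𝕜 (fun M' => volterraInv D M') M :=
  (differentiableAt_inverse h).comp M (f := fun M' => 1 - D * M') (by fun_prop)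

theorem differentiableAt_obsOp (h : IsUnit (1 - D * M)) :
    DifferentiableAt 𝕜 (fun M' => obsOp D E B M') M :=
  (differentiableAt_const B).clm_comp
    ((differentiableAt_volterraInv h).clm_comp (differentiableAt_const E))

theorem differentiableAt_gramian (h : IsUnit (1 - D * M)) :
    DifferentiableAt 𝕜 (fun M' => gramian tr D E B M') M :=
  (tr.differentiableAt.comp M (differentiableAt_obsOp h)).clm_comp (differentiableAt_obsOp h)

variable [CompleteSpace H]

theorem differentiableAt_obsRecon (h : Observable tr D E B M) :
    DifferentiableAt 𝕜 (fun M' => obsRecon tr D E B M') M :=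
  (((differentiableAt_volterraInv h.1).clm_comp (differentiableAt_const E)).clm_comp
    (((differentiableAt_inverse h.2).comp M
      (f := fun M' => gramian tr D E B M') (differentiableAt_gramian h.1)).clm_comp
      (tr.differentiableAt.comp M (differentiableAt_obsOp h.1)))).neg

theorem differentiableAt_srcRecon (h : Observable tr D E B M) :
    DifferentiableAt 𝕜 (fun M' => srcRecon tr D E B M') M :=
  ((differentiableAt_volterraInv h.1).clm_comp (differentiableAt_const D)).add
    ((differentiableAt_obsRecon h).clm_comp ((differentiableAt_const B).clm_comp
      ((differentiableAt_volterraInv h.1).clm_comp (differentiableAt_const D))))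

/-- Observability is an open condition: units form an open set and the Gramian is continuous. -/
theorem eventually_observable (h : Observable tr D E B M) :
    ∀ᶠ M' in 𝓝 M, Observable tr D E B M' := by
  have h1 : ContinuousAt (fun M' : Z →L[𝕜] Z => 1 - D * M') M := by fun_prop
  have h2 : ContinuousAt (fun M' => gramian tr D E B M') M :=
    (differentiableAt_gramian h.1).continuousAt
  exact (h1.eventually (Units.isOpen.mem_nhds h.1)).and
    (h2.eventually (Units.isOpen.mem_nhds h.2))

end Reconstruction

section RealReconstruction

variable {Z H Wh : Type*} [NormedAddCommGroup Z] [NormedSpace ℝ Z]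
  [NormedAddCommGroup H] [InnerProductSpace ℝ H] [CompleteSpace H]
  [NormedAddCommGroup Wh] [InnerProductSpace ℝ Wh] [CompleteSpace Wh]

variable (H Wh) in
/-- The transposition of operators between real Hilbert spaces. -/
def realTransp : (H →L[ℝ] Wh) →L[ℝ] (Wh →L[ℝ] H) :=
  LinearMap.mkContinuous
    { toFun := fun S => ContinuousLinearMap.adjoint S
      map_add' := fun S S' => map_add _ _ _
      map_smul' := fun c S => by rw [map_smulₛₗ]; rfl }
    1 fun S => by
      change ‖ContinuousLinearMap.adjoint S‖ ≤ _
      rw [LinearIsometryEquiv.norm_map, one_mul]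

theorem realTransp_apply (S : H →L[ℝ] Wh) : realTransp H Wh S = ContinuousLinearMap.adjoint S := rfl

variable {D : Z →L[ℝ] Z} {E : H →L[ℝ] Z} {B : Z →L[ℝ] Wh} {M : Z →L[ℝ] Z}

/-- An observability inequality makes the Gramian coercive, hence invertible, with an inverse
bounded in terms of the observability constant only. -/
theorem isUnit_gramian {c : ℝ} (hc : 0 < c) (h : ∀ x, ‖x‖ ≤ c * ‖obsOp D E B M x‖) :
    IsUnit (gramian (realTransp H Wh) D E B M) ∧
      ‖Ring.inverse (gramian (realTransp H Wh) D E B M)‖ ≤ c ^ 2 := by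
  set G := gramian (realTransp H Wh) D E B M with hG
  have key : ∀ x, ‖x‖ ^ 2 ≤ c ^ 2 * inner ℝ (G x) x := fun x => by
    have h1 : inner ℝ (G x) x = ‖obsOp D E B M x‖ ^ 2 := by
      rw [← real_inner_self_eq_norm_sq]
      exact ContinuousLinearMap.adjoint_inner_left (obsOp D E B M) _ _
    rw [h1, ← mul_pow]
    exact pow_le_pow_left₀ (norm_nonneg _) (h x) 2
  have hu : IsUnit G := by
    refine ContinuousLinearMap.isUnit_of_forall_le_norm_inner_map G
      (c := Real.toNNReal (c ^ 2)⁻¹) (by rw [Real.toNNReal_pos]; positivity) fun x => ?_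
    rw [Real.coe_toNNReal _ (by positivity), ← div_eq_mul_inv, div_le_iff₀ (by positivity),
      mul_comm]
    exact (key x).trans (mul_le_mul_of_nonneg_left (le_abs_self _) (by positivity))
  refine ⟨hu, ContinuousLinearMap.opNorm_le_bound _ (by positivity) fun y => ?_⟩
  have e : G (Ring.inverse G y) = y := by
    have := congrArg (fun S : H →L[ℝ] H => S y) (Ring.mul_inverse_cancel _ hu)
    simpa using this
  have h1 := key (Ring.inverse G y)
  rw [e] at h1
  have h2 := real_inner_le_norm y (Ring.inverse G y)
  rcases eq_or_lt_of_le (norm_nonneg (Ring.inverse G y)) with h0 | h0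
  · rw [← h0]; positivity
  · have : ‖Ring.inverse G y‖ * ‖Ring.inverse G y‖ ≤ c ^ 2 * ‖y‖ * ‖Ring.inverse G y‖ := by
      nlinarith [sq_nonneg c]
    exact le_of_mul_le_mul_right this h0

/-- Bound for `obsRecon` in terms of bounds for the Volterra resolvent, the free evolution, the
observation and the observability constant. -/
def obsReconBound (j e b c : ℝ) : ℝ := j * e * (c ^ 2 * (b * (j * e)))

/-- Bound for `srcRecon`, with `d` a bound for the Duhamel operator. -/
def srcReconBound (j e b c d : ℝ) : ℝ := j * d + obsReconBound j e b c * (b * (j * d))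

theorem norm_obsRecon_le {j e b c : ℝ} (hj : ‖volterraInv D M‖ ≤ j) (he : ‖E‖ ≤ e) (hb : ‖B‖ ≤ b)
    (hG : ‖Ring.inverse (gramian (realTransp H Wh) D E B M)‖ ≤ c ^ 2) :
    ‖obsRecon (realTransp H Wh) D E B M‖ ≤ obsReconBound j e b c := by
  have hj0 := (norm_nonneg _).trans hj
  have he0 := (norm_nonneg _).trans he
  have hb0 := (norm_nonneg _).trans hb
  have h1 : ‖(realTransp H Wh) (obsOp D E B M)‖ ≤ b * (j * e) := by
    rw [realTransp_apply, LinearIsometryEquiv.norm_map]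
    exact norm_obsOp_le.trans (by gcongr)
  rw [obsRecon, norm_neg, obsReconBound]
  refine (ContinuousLinearMap.opNorm_comp_le _ _).trans (mul_le_mul ?_ ?_ (norm_nonneg _)
    (by positivity))
  · exact (ContinuousLinearMap.opNorm_comp_le _ _).trans (by gcongr)
  · exact (ContinuousLinearMap.opNorm_comp_le _ _).trans (by gcongr)

theorem norm_srcRecon_le {j e b c d : ℝ} (hj : ‖volterraInv D M‖ ≤ j) (he : ‖E‖ ≤ e)
    (hb : ‖B‖ ≤ b) (hG : ‖Ring.inverse (gramian (realTransp H Wh) D E B M)‖ ≤ c ^ 2)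
    (hd : ‖D‖ ≤ d) : ‖srcRecon (realTransp H Wh) D E B M‖ ≤ srcReconBound j e b c d := by
  have hj0 := (norm_nonneg _).trans hj
  have he0 := (norm_nonneg _).trans he
  have hb0 := (norm_nonneg _).trans hb
  have h1 : ‖(volterraInv D M).comp D‖ ≤ j * d :=
    (ContinuousLinearMap.opNorm_comp_le _ _).trans (by gcongr)
  have h2 : 0 ≤ obsReconBound j e b c := by rw [obsReconBound]; positivity
  rw [srcReconBound]
  refine (norm_add_le _ _).trans (add_le_add h1 ((ContinuousLinearMap.opNorm_comp_le _ _).trans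
    (mul_le_mul (norm_obsRecon_le hj he hb hG) ?_ (norm_nonneg _) h2)))
  exact (ContinuousLinearMap.opNorm_comp_le _ _).trans (by gcongr)

/-- On a set of uniformly observable potentials the reconstruction operators depend on the
potential in a Lipschitz way. -/
theorem bddLip_recon {s : Set (Z →L[ℝ] Z)} (hs : Bornology.IsBounded s)
    (hu : ∀ M ∈ s, Observable (realTransp H Wh) D E B M) {j c : ℝ} (hj0 : 0 ≤ j)
    (hj : ∀ M ∈ s, ‖volterraInv D M‖ ≤ j)
    (hG : ∀ M ∈ s, ‖Ring.inverse (gramian (realTransp H Wh) D E B M)‖ ≤ c ^ 2) :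
    BddLip s (fun M => obsRecon (realTransp H Wh) D E B M) ∧
      BddLip s (fun M => srcRecon (realTransp H Wh) D E B M) := by
  have hJ : BddLip s (fun M => volterraInv D M) :=
    ((BddLip.const 1).sub ((BddLip.const D).mul (BddLip.id hs))).inverse
      (fun M hM => (hu M hM).1) hj0 hj
  have hO : BddLip s (fun M => obsOp D E B M) :=
    (BddLip.const B).clm_comp (hJ.clm_comp (BddLip.const E))
  have hT : BddLip s (fun M => realTransp H Wh (obsOp D E B M)) :=
    hO.comp_lipschitz (φ := realTransp H Wh) zero_le_one
      (fun v => by rw [realTransp_apply, LinearIsometryEquiv.norm_map, one_mul])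
      (fun v v' => by rw [← map_sub, realTransp_apply, LinearIsometryEquiv.norm_map, one_mul])
  have hI : BddLip s (fun M => Ring.inverse (gramian (realTransp H Wh) D E B M)) :=
    (hT.clm_comp hO).inverse (fun M hM => (hu M hM).2) (sq_nonneg c) hG
  have hK : BddLip s (fun M => obsRecon (realTransp H Wh) D E B M) :=
    ((hJ.clm_comp (BddLip.const E)).clm_comp (hI.clm_comp hT)).neg
  exact ⟨hK, (hJ.clm_comp (BddLip.const D)).add
    (hK.clm_comp ((BddLip.const B).clm_comp (hJ.clm_comp (BddLip.const D))))⟩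

end RealReconstruction

section ComplexReconstruction

open CxPair

variable {Z Zc H Hc Wh Wc : Type*} [NormedAddCommGroup Z] [NormedSpace ℝ Z]
  [NormedAddCommGroup Zc] [NormedSpace ℂ Zc] [CxPair Z Zc]
  [NormedAddCommGroup H] [InnerProductSpace ℝ H]
  [NormedAddCommGroup Hc] [NormedSpace ℂ Hc] [CxPair H Hc]
  [NormedAddCommGroup Wh] [InnerProductSpace ℝ Wh]
  [NormedAddCommGroup Wc] [NormedSpace ℂ Wc] [CxPair Wh Wc]
  {D : Z →L[ℝ] Z} {E : H →L[ℝ] Z} {B : Z →L[ℝ] Wh} {M : Z →L[ℝ] Z}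

theorem isUnit_cxify_one_sub (h : IsUnit (1 - D * M)) :
    IsUnit (1 - (cxify D : Zc →L[ℂ] Zc) * cxify M) := by
  rw [← cxify_mul, ← cxify_one (V := Z), ← cxify_sub]
  exact isUnit_cxify h

theorem volterraInv_cxify (h : IsUnit (1 - D * M)) :
    volterraInv (cxify D : Zc →L[ℂ] Zc) (cxify M) = cxify (volterraInv D M) := by
  rw [volterraInv, ← cxify_mul, ← cxify_one (V := Z), ← cxify_sub, inverse_cxify h, volterraInv]

theorem obsOp_cxify (h : IsUnit (1 - D * M)) :
    obsOp (cxify D : Zc →L[ℂ] Zc) (cxify E : Hc →L[ℂ] Zc) (cxify B : Zc →L[ℂ] Wc) (cxify M) =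
      cxify (obsOp D E B M) := by
  rw [obsOp, volterraInv_cxify h, ← cxify_comp, ← cxify_comp, obsOp]

variable [CompleteSpace H] [CompleteSpace Wh]

theorem gramian_cxify (h : IsUnit (1 - D * M)) :
    gramian (transp H Hc Wh Wc) (cxify D : Zc →L[ℂ] Zc) (cxify E) (cxify B) (cxify M) =
      cxify (gramian (realTransp H Wh) D E B M) := by
  rw [gramian, obsOp_cxify h, transp_cxify, ← cxify_comp, gramian, realTransp_apply]

theorem observable_cxify (h : Observable (realTransp H Wh) D E B M) :
    Observable (transp H Hc Wh Wc) (cxify D : Zc →L[ℂ] Zc) (cxify E) (cxify B) (cxify M) :=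
  ⟨isUnit_cxify_one_sub h.1, by rw [gramian_cxify h.1]; exact isUnit_cxify h.2⟩

theorem obsRecon_cxify (h : Observable (realTransp H Wh) D E B M) :
    obsRecon (transp H Hc Wh Wc) (cxify D : Zc →L[ℂ] Zc) (cxify E) (cxify B) (cxify M) =
      cxify (obsRecon (realTransp H Wh) D E B M) := by
  rw [obsRecon, gramian_cxify h.1, inverse_cxify h.2, obsOp_cxify h.1, transp_cxify,
    volterraInv_cxify h.1, ← cxify_comp, ← cxify_comp, ← cxify_comp, ← cxify_neg, obsRecon,
    realTransp_apply]

theorem srcRecon_cxify (h : Observable (realTransp H Wh) D E B M) :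
    srcRecon (transp H Hc Wh Wc) (cxify D : Zc →L[ℂ] Zc) (cxify E) (cxify B) (cxify M) =
      cxify (srcRecon (realTransp H Wh) D E B M) := by
  rw [srcRecon, obsRecon_cxify h, volterraInv_cxify h.1, ← cxify_comp, ← cxify_comp, ← cxify_comp,
    ← cxify_add, srcRecon]

end ComplexReconstruction

/-! ### Volterra operators -/

section Volterra

variable {T : ℝ} {H : Type*} [NormedAddCommGroup H] [NormedSpace ℝ H]

theorem isUnit_one_sub_of_norm_pow_le {R : Type*} [NormedRing R] [CompleteSpace R] {x : R} {a : ℝ}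
    (h : ∀ k : ℕ, ‖x ^ k‖ ≤ a ^ k / k.factorial) :
    IsUnit (1 - x) ∧ ‖Ring.inverse (1 - x)‖ ≤ Real.exp a := by
  have hexp : HasSum (fun k : ℕ => a ^ k / k.factorial) (Real.exp a) := by
    rw [Real.exp_eq_exp_ℝ]
    exact NormedSpace.expSeries_div_hasSum_exp _
  have hs : Summable fun k : ℕ => x ^ k := Summable.of_norm_bounded hexp.summable h
  have hu : IsUnit (1 - x) :=
    isUnit_iff_exists.2 ⟨_, hs.one_sub_mul_tsum_pow, hs.tsum_pow_mul_one_sub⟩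
  refine ⟨hu, ?_⟩
  have e : Ring.inverse (1 - x) = ∑' k : ℕ, x ^ k := by
    calc Ring.inverse (1 - x) = Ring.inverse (1 - x) * ((1 - x) * ∑' k : ℕ, x ^ k) := by
          rw [hs.one_sub_mul_tsum_pow, mul_one]
      _ = _ := by rw [← mul_assoc, Ring.inverse_mul_cancel _ hu, one_mul]
  rw [e]
  exact tsum_of_norm_bounded hexp h

theorem isUnit_volterra_of_norm_pow_le {Z : Type*} [NormedAddCommGroup Z] [NormedSpace ℝ Z]
    [CompleteSpace Z] {D M : Z →L[ℝ] Z} {a : ℝ} (h : ∀ k : ℕ, ‖(D * M) ^ k‖ ≤ a ^ k / k.factorial) :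
    IsUnit (1 - D * M) ∧ ‖volterraInv D M‖ ≤ Real.exp a :=
  isUnit_one_sub_of_norm_pow_le (R := Z →L[ℝ] Z) h

/-- Iterates of a Volterra operator gain a factorial, so that no smallness of the potential or of
the time interval is needed to invert `1 - D M`. -/
theorem norm_volterra_pow_le (hT : 0 ≤ T) {D M : TPath T H →L[ℝ] TPath T H} {c m : ℝ} (hc : 0 ≤ c)
    (hm : 0 ≤ m)
    (hD : ∀ g t, ‖D g t‖ ≤ c * ∫ τ in (0 : ℝ)..t, ‖g (Set.projIcc 0 T hT τ)‖)
    (hM : ∀ w t, ‖M w t‖ ≤ m * ‖w t‖) (k : ℕ) :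
    ∀ w t, ‖((D * M) ^ k) w t‖ ≤ (c * m * t) ^ k / k.factorial * ‖w‖ := by
    induction k with
    | zero => intro w t; simpa using w.norm_coe_le_norm t
    | succ k ih =>
      intro w t
      have ht : (0 : ℝ) ≤ t := t.2.1
      have e : ((D * M) ^ (k + 1)) w = D (M (((D * M) ^ k) w)) := by
        rw [pow_succ']; rfl
      rw [e]
      refine (hD _ _).trans ?_
      have h1 : ∫ τ in (0 : ℝ)..t, ‖(M (((D * M) ^ k) w)) (Set.projIcc 0 T hT τ)‖ ≤
          ∫ τ in (0 : ℝ)..t, m * ((c * m) ^ k / k.factorial * ‖w‖) * τ ^ k := by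
        refine intervalIntegral.integral_mono_on ht ?_ ?_ fun τ hτ => ?_
        · refine Continuous.intervalIntegrable ?_ _ _
          exact ((M (((D * M) ^ k) w)).continuous.comp continuous_projIcc).norm
        · exact Continuous.intervalIntegrable (by fun_prop) _ _
        · have hτ' : τ ∈ Set.Icc 0 T := ⟨hτ.1, hτ.2.trans t.2.2⟩
          rw [Set.projIcc_of_mem hT hτ']
          refine (hM _ _).trans ?_
          refine (mul_le_mul_of_nonneg_left (ih w ⟨τ, hτ'⟩) hm).trans (le_of_eq ?_)
          simp only [mul_pow]
          ring
      refine (mul_le_mul_of_nonneg_left h1 hc).trans (le_of_eq ?_)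
      rw [intervalIntegral.integral_const_mul, integral_pow, Nat.factorial_succ]
      push_cast
      field_simp
      simp only [mul_pow, ne_eq, Nat.add_eq_zero_iff, one_ne_zero, and_false, not_false_eq_true,
        zero_pow, sub_zero]
      ring

variable [CompleteSpace H]

/-- If `D` is dominated by `c ∫₀ᵗ` and `M` acts pointwise, `1 - D M` is invertible on `C⁰([0, T])`:
the powers of `D M` are dominated by iterated integrals. -/
theorem isUnit_volterra (hT : 0 ≤ T) {D M : TPath T H →L[ℝ] TPath T H} {c m : ℝ} (hc : 0 ≤ c)
    (hm : 0 ≤ m)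
    (hD : ∀ g t, ‖D g t‖ ≤ c * ∫ τ in (0 : ℝ)..t, ‖g (Set.projIcc 0 T hT τ)‖)
    (hM : ∀ w t, ‖M w t‖ ≤ m * ‖w t‖) :
    IsUnit (1 - D * M) ∧ ‖volterraInv D M‖ ≤ Real.exp (c * m * T) := by
  have hnorm : ∀ k : ℕ, ‖(D * M) ^ k‖ ≤ (c * m * T) ^ k / k.factorial := fun k =>
    ContinuousLinearMap.opNorm_le_bound _ (by positivity) fun w =>
      (ContinuousMap.norm_le _ (by positivity)).2 fun t =>
        (norm_volterra_pow_le hT hc hm hD hM k w t).trans (by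
        have := t.2.1
        have := t.2.2
        gcongr)
  exact isUnit_volterra_of_norm_pow_le hnorm

end Volterra

/-! ### The nonlinear reconstruction map -/

section RadialCut

variable {V : Type*} [NormedAddCommGroup V] [NormedSpace ℝ V] {ε : ℝ}

/-- The radial retraction onto the ball of radius `ε`. -/
def radialCut (ε : ℝ) (y : V) : V := (ε / max ε ‖y‖) • y

theorem radialCut_of_norm_le (hε : 0 < ε) {y : V} (hy : ‖y‖ ≤ ε) : radialCut ε y = y := by
  rw [radialCut, max_eq_left hy, div_self hε.ne', one_smul]

theorem norm_radialCut_le (hε : 0 < ε) (y : V) : ‖radialCut ε y‖ ≤ ε := by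
  have hm : 0 < max ε ‖y‖ := lt_max_of_lt_left hε
  rw [radialCut, norm_smul, Real.norm_of_nonneg (by positivity), div_mul_eq_mul_div,
    div_le_iff₀ hm]
  gcongr
  exact le_max_right _ _

theorem norm_radialCut_le_self (hε : 0 < ε) (y : V) : ‖radialCut ε y‖ ≤ ‖y‖ := by
  have hm : 0 < max ε ‖y‖ := lt_max_of_lt_left hε
  rw [radialCut, norm_smul, Real.norm_of_nonneg (by positivity)]
  exact mul_le_of_le_one_left (norm_nonneg _) ((div_le_one hm).2 (le_max_left _ _))

theorem norm_radialCut_sub_le (hε : 0 < ε) (y z : V) :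
    ‖radialCut ε y - radialCut ε z‖ ≤ 2 * ‖y - z‖ := by
  have hy : 0 < max ε ‖y‖ := lt_max_of_lt_left hε
  have hz : 0 < max ε ‖z‖ := lt_max_of_lt_left hε
  have e : radialCut ε y - radialCut ε z = (ε / max ε ‖y‖) • (y - z) +
      ((ε / max ε ‖y‖) * ((max ε ‖z‖ - max ε ‖y‖) / max ε ‖z‖)) • z := by
    have : ε / max ε ‖y‖ * ((max ε ‖z‖ - max ε ‖y‖) / max ε ‖z‖) =
        ε / max ε ‖y‖ - ε / max ε ‖z‖ := by field_simp
    rw [this, radialCut, radialCut]; module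
  have h1 : ε / max ε ‖y‖ ≤ 1 := (div_le_one hy).2 (le_max_left _ _)
  have h0 : 0 ≤ ε / max ε ‖y‖ := by positivity
  rw [e, two_mul]
  refine (norm_add_le _ _).trans (add_le_add ?_ ?_)
  · rw [norm_smul, Real.norm_of_nonneg h0]
    exact mul_le_of_le_one_left (norm_nonneg _) h1
  · rw [norm_smul, norm_mul, Real.norm_of_nonneg h0, norm_div, Real.norm_of_nonneg hz.le,
      mul_assoc]
    refine (mul_le_of_le_one_left (by positivity) h1).trans ?_
    rw [div_mul_eq_mul_div, div_le_iff₀ hz]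
    have h2 : ‖max ε ‖z‖ - max ε ‖y‖‖ ≤ ‖y - z‖ := by
      rw [norm_sub_rev y z]
      rw [max_comm ε, max_comm ε]
      exact (abs_max_sub_max_le_abs _ _ _).trans (abs_norm_sub_norm_le z y)
    exact mul_le_mul h2 (le_max_right _ _) (norm_nonneg _) (norm_nonneg _)

end RadialCut

section PathTaylor

variable {α 𝕜 V W : Type*} [TopologicalSpace α] [CompactSpace α] [RCLike 𝕜]
  [NormedAddCommGroup V] [NormedSpace ℝ V] [NormedSpace 𝕜 V] [NormedAddCommGroup W]
  [NormedSpace 𝕜 W]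

/-- Mean value inequality for superposition operators. -/
theorem norm_pathMap_sub_sub_le {F : V → W} {m : C(α, V →L[𝕜] W)} {κ : ℝ} (hκ : 0 ≤ κ)
    {a b : C(α, V)} (ha : Continuous fun t => F (a t)) (hb : Continuous fun t => F (b t))
    {s : α → Set V} (hs : ∀ t, Convex ℝ (s t)) (has : ∀ t, a t ∈ s t) (hbs : ∀ t, b t ∈ s t)
    (hd : ∀ t, ∀ y ∈ s t, DifferentiableAt 𝕜 F y)
    (hbd : ∀ t, ∀ y ∈ s t, ‖fderiv 𝕜 F y - m t‖ ≤ κ) :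
    ‖pathMap F a - pathMap F b - pathMul m (a - b)‖ ≤ κ * ‖a - b‖ := by
  refine (ContinuousMap.norm_le _ (by positivity)).2 fun t => ?_
  simp only [ContinuousMap.sub_apply, pathMul_apply]
  rw [pathMap_apply ha, pathMap_apply hb]
  refine ((hs t).norm_image_sub_le_of_norm_hasFDerivWithin_le' (𝕜 := 𝕜)
    (fun y hy => (hd t y hy).hasFDerivAt.hasFDerivWithinAt) (hbd t) (hbs t) (has t)).trans ?_
  gcongr
  exact (a - b).norm_coe_le_norm t

end PathTaylor

section ReconMap

variable {𝕜 Z H Wh PY PL : Type*} [NontriviallyNormedField 𝕜] [NormedAddCommGroup Z]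
  [NormedSpace 𝕜 Z] [NormedAddCommGroup H] [NormedSpace 𝕜 H] [NormedAddCommGroup Wh]
  [NormedSpace 𝕜 Wh] [NormedAddCommGroup PY] [NormedSpace 𝕜 PY] [NormedAddCommGroup PL]
  [NormedSpace 𝕜 PL]

/-- The map whose fixed point is the reconstructed high-frequency part. Around the input
`q = v + h₁` the nonlinearity `N (q + w)` is replaced by its linearization `pot q`, and the rest is
treated as a source term; `obs v` is the observation of the low-frequency part `v`. -/
def reconMap (tr : (H →L[𝕜] Wh) →L[𝕜] (Wh →L[𝕜] H)) (D : Z →L[𝕜] Z) (E : H →L[𝕜] Z)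
    (B : Z →L[𝕜] Wh) (pot : PY → Z →L[𝕜] Z) (N : PY → Z) (hi : Z →L[𝕜] PY) (lo : PL →L[𝕜] PY)
    (pr : PY →L[𝕜] Z) (obs : PL → Wh) (p : PL × PY × PY) (w : Z) : Z :=
  srcRecon tr D E B (pot (lo p.1 + p.2.1))
    (N (lo p.1 + p.2.1 + hi w) - pot (lo p.1 + p.2.1) w + pr p.2.2) +
  obsRecon tr D E B (pot (lo p.1 + p.2.1)) (obs p.1)

end ReconMap

/-- The data of the reconstruction problem: the low-frequency space `Lo` and the high-frequency
space `H` with their maps to and from `Y`, the observation and the nonlinearity on `Y`, the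
embedding of the observed paths into a Hilbert space `Wh`, and the Duhamel operator and the free
evolution of the high frequencies. -/
structure SplitData (T : ℝ) (Y H Lo Wh : Type*) [NormedAddCommGroup Y] [InnerProductSpace ℝ Y]
    [NormedAddCommGroup H] [InnerProductSpace ℝ H] [NormedAddCommGroup Lo] [InnerProductSpace ℝ Lo]
    [NormedAddCommGroup Wh] [InnerProductSpace ℝ Wh] where
  /-- inclusion of the low frequencies -/
  low : Lo →L[ℝ] Y
  /-- inclusion of the high frequencies -/
  high : H →L[ℝ] Y
  /-- projection onto the high frequencies -/
  proj : Y →L[ℝ] H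
  /-- the observation operator -/
  obs : Y →L[ℝ] Y
  /-- embedding of paths into a Hilbert space -/
  emb : TPath T Y →L[ℝ] Wh
  /-- the Duhamel operator -/
  duh : TPath T H →L[ℝ] TPath T H
  /-- the free evolution -/
  free : H →L[ℝ] TPath T H
  /-- the nonlinearity -/
  nonlin : Y → Y

namespace SplitData

variable {T : ℝ} {Y H Lo Wh : Type*} [NormedAddCommGroup Y] [InnerProductSpace ℝ Y]
  [NormedAddCommGroup H] [InnerProductSpace ℝ H] [NormedAddCommGroup Lo] [InnerProductSpace ℝ Lo]
  [NormedAddCommGroup Wh] [InnerProductSpace ℝ Wh]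

variable (S : SplitData T Y H Lo Wh)

/-- The high-frequency part of the nonlinearity. -/
def highNonlin (x : Y) : H := S.proj (S.nonlin x)

/-- The potential of the equation linearized at the path `q`. -/
def pot (q : TPath T Y) : TPath T H →L[ℝ] TPath T H :=
  (pathMul (pathMap (fderiv ℝ S.highNonlin) q)).comp (pathLift _ S.high)

/-- Observation of high-frequency paths. -/
def obsHigh : TPath T H →L[ℝ] Wh :=
  S.emb.comp ((pathLift _ S.obs).comp (pathLift _ S.high))

/-- Observation of low-frequency paths. -/
def obsLow : TPath T Lo →L[ℝ] TPath T Y := (pathLift _ S.obs).comp (pathLift _ S.low)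

/-- The path `q = v + h₁` at which the equation is linearized. -/
def input (p : TPath T Lo × TPath T Y × TPath T Y) : TPath T Y := pathLift _ S.low p.1 + p.2.1

/-- Regularity of the high-frequency part of the nonlinearity on the ball of radius `4 R₀`. -/
structure Regular (R₀ m Lf : ℝ) : Prop where
  contDiff : ContDiff ℝ 2 S.highNonlin
  norm_low : ‖S.low‖ ≤ 1
  norm_high : ‖S.high‖ ≤ 1
  norm_proj : ‖S.proj‖ ≤ 1
  m_nonneg : 0 ≤ m
  Lf_nonneg : 0 ≤ Lf
  norm_fderiv : ∀ x, ‖x‖ ≤ 4 * R₀ → ‖fderiv ℝ S.highNonlin x‖ ≤ m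
  lipschitz_fderiv : ∀ x, ‖x‖ ≤ 4 * R₀ → ∀ y, ‖y‖ ≤ 4 * R₀ →
    ‖fderiv ℝ S.highNonlin x - fderiv ℝ S.highNonlin y‖ ≤ Lf * ‖x - y‖

variable {S} {R₀ m Lf j c cS cK R ε : ℝ}

namespace Regular

theorem continuous_fderiv (hS : S.Regular R₀ m Lf) : Continuous (fderiv ℝ S.highNonlin) :=
  hS.contDiff.continuous_fderiv (by norm_num)

theorem continuous (hS : S.Regular R₀ m Lf) : Continuous S.highNonlin := hS.contDiff.continuous

theorem differentiable (hS : S.Regular R₀ m Lf) : Differentiable ℝ S.highNonlin :=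
  hS.contDiff.differentiable (by norm_num)

theorem norm_high_apply_le (hS : S.Regular R₀ m Lf) (w : TPath T H) :
    ‖pathLift _ S.high w‖ ≤ ‖w‖ :=
  (norm_pathLift_apply_le _ _).trans
    (mul_le_of_le_one_left (norm_nonneg _) hS.norm_high)

theorem norm_pot_apply_le (hS : S.Regular R₀ m Lf) {q : TPath T Y} (hq : ∀ t, ‖q t‖ ≤ 4 * R₀)
    (w : TPath T H) (t) : ‖S.pot q w t‖ ≤ m * ‖w t‖ := by
  have e : S.pot q w t = fderiv ℝ S.highNonlin (q t) (S.high (w t)) := by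
    rw [← pathMap_apply (g := fderiv ℝ S.highNonlin) (q := q)
      (hS.continuous_fderiv.comp q.continuous)]
    rfl
  rw [e]
  refine (ContinuousLinearMap.le_opNorm _ _).trans ?_
  have := S.high.le_opNorm (w t)
  have h1 : ‖S.high (w t)‖ ≤ ‖w t‖ :=
    this.trans (mul_le_of_le_one_left (norm_nonneg _) hS.norm_high)
  exact mul_le_mul (hS.norm_fderiv _ (hq t)) h1 (norm_nonneg _) hS.m_nonneg

theorem norm_pot_le (hS : S.Regular R₀ m Lf) {q : TPath T Y} (hq : ∀ t, ‖q t‖ ≤ 4 * R₀) :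
    ‖S.pot q‖ ≤ m :=
  ContinuousLinearMap.opNorm_le_bound _ hS.m_nonneg fun w =>
    (ContinuousMap.norm_le _ (mul_nonneg hS.m_nonneg (norm_nonneg _))).2 fun t =>
      (hS.norm_pot_apply_le hq w t).trans
        (mul_le_mul_of_nonneg_left (w.norm_coe_le_norm t) hS.m_nonneg)

theorem norm_pot_sub_le (hS : S.Regular R₀ m Lf) {q q' : TPath T Y} (hq : ∀ t, ‖q t‖ ≤ 4 * R₀)
    (hq' : ∀ t, ‖q' t‖ ≤ 4 * R₀) : ‖S.pot q - S.pot q'‖ ≤ Lf * ‖q - q'‖ := by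
  rw [pot, pot, ← ContinuousLinearMap.sub_comp, pathMul_sub]
  refine (ContinuousLinearMap.opNorm_comp_le _ _).trans ?_
  have h1 : ‖(pathLift (Icc 0 T) S.high)‖ ≤ 1 := (norm_pathLift_le _).trans hS.norm_high
  have h2 : ‖pathMap (fderiv ℝ S.highNonlin) q - pathMap (fderiv ℝ S.highNonlin) q'‖ ≤
      Lf * ‖q - q'‖ :=
    norm_pathMap_sub_le (s := {x | ‖x‖ ≤ 4 * R₀}) hS.continuous_fderiv.continuousOn hS.Lf_nonneg
      hS.lipschitz_fderiv hq hq'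
  exact (mul_le_of_le_one_right (norm_nonneg _) h1).trans ((norm_pathMul_le _).trans h2)

theorem norm_sub_le (hS : S.Regular R₀ m Lf) {x y : Y} (hx : ‖x‖ ≤ 4 * R₀) (hy : ‖y‖ ≤ 4 * R₀) :
    ‖S.highNonlin x - S.highNonlin y‖ ≤ m * ‖x - y‖ :=
  (convex_closedBall (0 : Y) (4 * R₀)).norm_image_sub_le_of_norm_fderiv_le (𝕜 := ℝ)
    (fun z _ => hS.differentiable z) (fun z hz => hS.norm_fderiv z (by simpa using hz))
    (by simpa using hy) (by simpa using hx)

theorem norm_remainder_sub_le (hS : S.Regular R₀ m Lf) (hR : 0 ≤ R) (hRR : R ≤ R₀)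
    {q : TPath T Y} (hq : ∀ t, ‖q t‖ ≤ 2 * R₀) {w w' : TPath T H} (hw : ‖w‖ ≤ R) (hw' : ‖w'‖ ≤ R) :
    ‖(pathMap S.highNonlin (q + pathLift _ S.high w) - S.pot q w) -
      (pathMap S.highNonlin (q + pathLift _ S.high w') - S.pot q w')‖ ≤ Lf * R * ‖w - w'‖ := by
  have hw0 := hS.norm_high_apply_le w
  have hw0' := hS.norm_high_apply_le w'
  have hmem : ∀ v : TPath T H, ‖v‖ ≤ R → ∀ t,
      (q + pathLift _ S.high v) t ∈ closedBall (q t) R := fun v hv t => by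
    rw [mem_closedBall, dist_eq_norm, ContinuousMap.add_apply, add_sub_cancel_left]
    exact (ContinuousMap.norm_coe_le_norm _ t).trans ((hS.norm_high_apply_le v).trans hv)
  have hball : ∀ t, ∀ y ∈ closedBall (q t) R, ‖y‖ ≤ 4 * R₀ := fun t y hy => by
    rw [mem_closedBall, dist_eq_norm] at hy
    have := norm_le_norm_add_norm_sub' y (q t)
    have := hq t
    linarith
  have := norm_pathMap_sub_sub_le (𝕜 := ℝ) (F := S.highNonlin)
    (m := pathMap (fderiv ℝ S.highNonlin) q)
    (a := q + pathLift _ S.high w) (b := q + pathLift _ S.high w') (κ := Lf * R)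
    (mul_nonneg hS.Lf_nonneg hR)
    (hS.continuous.comp (ContinuousMap.continuous _))
    (hS.continuous.comp (ContinuousMap.continuous _)) (s := fun t => closedBall (q t) R)
    (fun t => convex_closedBall _ _) (hmem w hw) (hmem w' hw')
    (fun t y _ => hS.differentiable y) (fun t y hy => by
      rw [pathMap_apply (hS.continuous_fderiv.comp q.continuous)]
      refine (hS.lipschitz_fderiv _ (hball t y hy) _
        (by have := hq t; linarith [norm_nonneg (q t)])).trans ?_
      rw [mem_closedBall, dist_eq_norm] at hy
      exact mul_le_mul_of_nonneg_left hy hS.Lf_nonneg)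
  have e : q + pathLift _ S.high w - (q + pathLift _ S.high w') = pathLift _ S.high (w - w') := by
    rw [map_sub]; abel
  rw [e] at this
  have e2 : (pathMap S.highNonlin (q + pathLift _ S.high w) - S.pot q w) -
      (pathMap S.highNonlin (q + pathLift _ S.high w') - S.pot q w') =
      pathMap S.highNonlin (q + pathLift _ S.high w) -
      pathMap S.highNonlin (q + pathLift _ S.high w') -
      pathMul (pathMap (fderiv ℝ S.highNonlin) q) (pathLift _ S.high (w - w')) := by
    have : pathMul (pathMap (fderiv ℝ S.highNonlin) q) (pathLift _ S.high (w - w')) =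
      S.pot q w - S.pot q w' := by rw [← map_sub]; rfl
    rw [this]; abel
  rw [e2]
  exact this.trans (mul_le_mul_of_nonneg_left (hS.norm_high_apply_le _)
    (mul_nonneg hS.Lf_nonneg hR))

end Regular

variable [CompleteSpace H] [CompleteSpace Wh]

variable (S) in
/-- Observability of the equation linearized at `q`, with bounds. -/
structure Good (j c : ℝ) (q : TPath T Y) : Prop where
  observable : Observable (realTransp H Wh) S.duh S.free S.obsHigh (S.pot q)
  norm_inv : ‖volterraInv S.duh (S.pot q)‖ ≤ j
  norm_gram : ‖Ring.inverse (gramian (realTransp H Wh) S.duh S.free S.obsHigh (S.pot q))‖ ≤ c ^ 2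

variable (S) in
/-- The reconstruction map, in which the observation of the low frequencies is truncated at
level `ε`. -/
def realMap (ε : ℝ) : TPath T Lo × TPath T Y × TPath T Y → TPath T H → TPath T H :=
  reconMap (realTransp H Wh) S.duh S.free S.obsHigh S.pot (pathMap S.highNonlin)
    (pathLift _ S.high) (pathLift _ S.low) (pathLift _ S.proj)
    (fun v => S.emb (radialCut ε (S.obsLow v)))

/-- The linearized reconstruction operators are bounded at `q`. -/
structure ReconBound (S : SplitData T Y H Lo Wh) (cS cK : ℝ) (q : TPath T Y) : Prop where
  norm_src : ‖srcRecon (realTransp H Wh) S.duh S.free S.obsHigh (S.pot q)‖ ≤ cS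
  norm_obs : ‖obsRecon (realTransp H Wh) S.duh S.free S.obsHigh (S.pot q)‖ ≤ cK

theorem norm_realMap_sub_le (hS : S.Regular R₀ m Lf) (hR : 0 < R) (hRR : R ≤ R₀)
    (hcS : 0 ≤ cS) (hcon : cS * (Lf * R) ≤ 1 / 4) {p : TPath T Lo × TPath T Y × TPath T Y}
    (hb : ReconBound S cS cK (S.input p)) (hq : ∀ t, ‖S.input p t‖ ≤ 2 * R₀)
    {w w' : TPath T H} (hw : ‖w‖ ≤ R) (hw' : ‖w'‖ ≤ R) :
    ‖S.realMap ε p w - S.realMap ε p w'‖ ≤ 1 / 4 * ‖w - w'‖ := by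
  have h1 := hS.norm_remainder_sub_le hR.le hRR hq hw hw'
  set L := srcRecon (realTransp H Wh) S.duh S.free S.obsHigh (S.pot (S.input p)) with hL
  have e : S.realMap ε p w - S.realMap ε p w' =
      L ((pathMap S.highNonlin (S.input p + pathLift _ S.high w) - S.pot (S.input p) w) -
      (pathMap S.highNonlin (S.input p + pathLift _ S.high w') - S.pot (S.input p) w')) := by
    rw [realMap, reconMap, reconMap, add_sub_add_right_eq_sub, ← map_sub, add_sub_add_right_eq_sub]
    rfl
  rw [e]
  calc _ ≤ cS * (Lf * R * ‖w - w'‖) := (L.le_opNorm _).trans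
        (mul_le_mul hb.norm_src h1 (norm_nonneg _) hcS)
    _ = cS * (Lf * R) * ‖w - w'‖ := by ring
    _ ≤ _ := by gcongr

theorem bddLip_realMap (hS : S.Regular R₀ m Lf) (hR0 : 0 ≤ R₀) (hRR : R ≤ R₀) (hε : 0 < ε)
    (hj : 0 ≤ j)
    {Dm : Set (TPath T Lo × TPath T Y × TPath T Y)} (hDb : Bornology.IsBounded Dm)
    (hg : ∀ p ∈ Dm, S.Good j c (S.input p)) (hq : ∀ p ∈ Dm, ∀ t, ‖S.input p t‖ ≤ 2 * R₀) :
    BddLip (Dm ×ˢ closedBall (0 : TPath T H) R) fun x => S.realMap ε x.1 x.2 := by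
  set s := Dm ×ˢ closedBall (0 : TPath T H) R with hs
  have hsb : Bornology.IsBounded s := hDb.prod isBounded_closedBall
  have hid := BddLip.id hsb
  have hp := hid.fst
  have hw := hid.snd
  have hv := hp.fst
  have h1 := hp.snd.fst
  have h2 := hp.snd.snd
  have hin : BddLip s fun x => S.input x.1 :=
    ((BddLip.const (pathLift (Icc 0 T) S.low)).clm_apply hv).add h1
  have hin4 : ∀ x ∈ s, ∀ t, ‖S.input x.1 t‖ ≤ 4 * R₀ := fun x hx t => by
    have := hq x.1 hx.1 t; linarith
  have hpot : BddLip s fun x => S.pot (S.input x.1) := by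
    obtain ⟨K, k0, -, k2⟩ := hin
    refine ⟨m + Lf * K, by have := hS.m_nonneg; have := hS.Lf_nonneg; positivity,
      fun x hx => ?_, fun x hx y hy => ?_⟩
    · exact (hS.norm_pot_le (hin4 x hx)).trans
        (le_add_of_nonneg_right (mul_nonneg hS.Lf_nonneg k0))
    · refine (hS.norm_pot_sub_le (hin4 x hx) (hin4 y hy)).trans ?_
      have := mul_le_mul_of_nonneg_left (k2 x hx y hy) hS.Lf_nonneg
      nlinarith [mul_nonneg hS.m_nonneg (norm_nonneg (x - y))]
  have hN : BddLip s fun x => pathMap S.highNonlin (S.input x.1 + pathLift _ S.high x.2) := by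
    have harg : BddLip s fun x => S.input x.1 + pathLift _ S.high x.2 :=
      hin.add ((BddLip.const (pathLift (Icc 0 T) S.high)).clm_apply hw)
    have harg4 : ∀ x ∈ s, ∀ t, ‖(S.input x.1 + pathLift _ S.high x.2) t‖ ≤ 4 * R₀ :=
      fun x hx t => by
      have a1 := hq x.1 hx.1 t
      have a2 := (ContinuousMap.norm_coe_le_norm (pathLift _ S.high x.2) t).trans
        (hS.norm_high_apply_le x.2)
      have a3 : ‖x.2‖ ≤ R := by simpa using hx.2
      rw [ContinuousMap.add_apply]
      refine (norm_add_le _ _).trans ?_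
      linarith
    obtain ⟨K, k0, -, k2⟩ := harg
    have hb : ∀ y : Y, ‖y‖ ≤ 4 * R₀ → ‖S.highNonlin y‖ ≤ ‖S.highNonlin 0‖ + m * (4 * R₀) :=
      fun y hy => by
      have b1 := hS.norm_sub_le hy (y := 0) (by simpa using hR0)
      have b2 := norm_le_norm_add_norm_sub' (S.highNonlin y) (S.highNonlin 0)
      have b3 : m * ‖y - 0‖ ≤ m * (4 * R₀) :=
        mul_le_mul_of_nonneg_left (by simpa using hy) hS.m_nonneg
      linarith
    have hb0 : 0 ≤ ‖S.highNonlin 0‖ + m * (4 * R₀) := by have := hS.m_nonneg; positivity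
    refine ⟨(‖S.highNonlin 0‖ + m * (4 * R₀)) + m * K, by have := hS.m_nonneg; positivity,
      fun x hx => ?_, fun x hx y hy => ?_⟩
    · refine (norm_pathMap_le (s := {x | ‖x‖ ≤ 4 * R₀}) hS.continuous.continuousOn hb0 hb
        (harg4 x hx)).trans (le_add_of_nonneg_right (mul_nonneg hS.m_nonneg k0))
    · refine (norm_pathMap_sub_le (s := {x | ‖x‖ ≤ 4 * R₀}) hS.continuous.continuousOn hS.m_nonneg
        (fun x hx y hy => hS.norm_sub_le hx hy) (harg4 x hx) (harg4 y hy)).trans ?_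
      have := mul_le_mul_of_nonneg_left (k2 x hx y hy) hS.m_nonneg
      nlinarith [mul_nonneg hb0 (norm_nonneg (x - y))]
  set P := (fun x => S.pot (S.input x.1)) '' s with hP
  have hPb : Bornology.IsBounded P := by
    refine isBounded_iff_forall_norm_le.2 ⟨m, ?_⟩
    rintro _ ⟨x, hx, rfl⟩
    exact hS.norm_pot_le (hin4 x hx)
  obtain ⟨hK, hL⟩ := bddLip_recon (H := H) (Wh := Wh) (D := S.duh) (E := S.free) (B := S.obsHigh)
    (s := P) hPb (j := j) (c := c)
    (by rintro _ ⟨x, hx, rfl⟩; exact (hg x.1 hx.1).observable) hj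
    (by rintro _ ⟨x, hx, rfl⟩; exact (hg x.1 hx.1).norm_inv)
    (by rintro _ ⟨x, hx, rfl⟩; exact (hg x.1 hx.1).norm_gram)
  have hpot' := hpot
  obtain ⟨K, k0, -, k2⟩ := hpot'
  have hK' := hK.comp_maps (t := s) (g := fun x => S.pot (S.input x.1)) k0
    (fun x hx => mem_image_of_mem _ hx) k2
  have hL' := hL.comp_maps (t := s) (g := fun x => S.pot (S.input x.1)) k0
    (fun x hx => mem_image_of_mem _ hx) k2
  have hχ : BddLip s fun x => radialCut ε (S.obsLow x.1.1) :=
    ((BddLip.const S.obsLow).clm_apply hv).comp_lipschitz (φ := radialCut ε) zero_le_two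
      (fun v => (norm_radialCut_le_self hε v).trans (by linarith [norm_nonneg v]))
      (norm_radialCut_sub_le hε)
  exact (hL'.clm_apply ((hN.sub (hpot.clm_apply hw)).add
    ((BddLip.const (pathLift (Icc 0 T) S.proj)).clm_apply h2))).add
    (hK'.clm_apply ((BddLip.const S.emb).clm_apply hχ))

/-- The nonlinear reconstruction: on a bounded set of data the map `realMap` has a unique fixed
point in the ball of radius `R / 2`, and this fixed point is a Lipschitz function of the data. -/
theorem exists_realRecon (hS : S.Regular R₀ m Lf) (hR : 0 < R) (hRR : R ≤ R₀) (hε : 0 < ε)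
    (hj : 0 ≤ j) (hcS : 0 ≤ cS) (hcK : 0 ≤ cK) (hcon : cS * (Lf * R) ≤ 1 / 4)
    {Dm : Set (TPath T Lo × TPath T Y × TPath T Y)} (hDb : Bornology.IsBounded Dm)
    (hg : ∀ p ∈ Dm, S.Good j c (S.input p)) (hb : ∀ p ∈ Dm, ReconBound S cS cK (S.input p))
    (hq : ∀ p ∈ Dm, ∀ t, ‖S.input p t‖ ≤ 2 * R₀)
    (hsmall : ∀ p ∈ Dm, cS * ‖pathMap S.highNonlin (S.input p) + pathLift _ S.proj p.2.2‖ +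
      cK * (‖S.emb‖ * ε) ≤ R / 4) :
    ∃ 𝓡 : TPath T Lo × TPath T Y × TPath T Y → TPath T H,
      (∀ p ∈ Dm, ‖𝓡 p‖ ≤ R / 2 ∧ S.realMap ε p (𝓡 p) = 𝓡 p ∧
        ∀ w, ‖w‖ ≤ R / 2 → S.realMap ε p w = w → w = 𝓡 p) ∧
      ∃ K : ℝ, 0 ≤ K ∧ ∀ p ∈ Dm, ∀ p' ∈ Dm, ‖𝓡 p - 𝓡 p'‖ ≤ K * ‖p - p'‖ := by
  classical
  have hcontr : ∀ p ∈ Dm, ∀ w w' : TPath T H, ‖w‖ ≤ R / 2 → ‖w'‖ ≤ R / 2 →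
      ‖S.realMap ε p w - S.realMap ε p w'‖ ≤ 1 / 4 * ‖w - w'‖ := fun p hp w w' hw hw' =>
    norm_realMap_sub_le hS hR hRR hcS hcon (hb p hp) (hq p hp) (hw.trans (by linarith))
      (hw'.trans (by linarith))
  have hex : ∀ p ∈ Dm, ∃ w : TPath T H, ‖w‖ ≤ R / 2 ∧ S.realMap ε p w = w := fun p hp => by
    obtain ⟨w, hw, hf⟩ := exists_fixedPoint_closedBall (Φ := S.realMap ε p) (c := 0) (r := R / 2)
      (k := 1 / 4) (by linarith) (by norm_num) (by norm_num)
      (fun w hw w' hw' => hcontr p hp w w' (by simpa using hw) (by simpa using hw')) (by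
        have e : S.realMap ε p 0 = srcRecon (realTransp H Wh) S.duh S.free S.obsHigh
            (S.pot (S.input p)) (pathMap S.highNonlin (S.input p) + pathLift _ S.proj p.2.2) +
            obsRecon (realTransp H Wh) S.duh S.free S.obsHigh (S.pot (S.input p))
              (S.emb (radialCut ε (S.obsLow p.1))) := by
          rw [realMap, reconMap, map_zero, map_zero, add_zero, sub_zero]; rfl
        rw [sub_zero, e]
        refine (norm_add_le _ _).trans ?_
        have h1 := (ContinuousLinearMap.le_opNorm (srcRecon (realTransp H Wh) S.duh S.free
          S.obsHigh (S.pot (S.input p)))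
          (pathMap S.highNonlin (S.input p) + pathLift _ S.proj p.2.2)).trans
          (mul_le_mul_of_nonneg_right (hb p hp).norm_src (norm_nonneg _))
        have h2 := (ContinuousLinearMap.le_opNorm (obsRecon (realTransp H Wh) S.duh S.free
          S.obsHigh (S.pot (S.input p))) (S.emb (radialCut ε (S.obsLow p.1)))).trans
          (mul_le_mul (hb p hp).norm_obs ((S.emb.le_opNorm _).trans
            (mul_le_mul_of_nonneg_left (norm_radialCut_le hε _) (norm_nonneg _)))
            (norm_nonneg _) hcK)
        have h3 := hsmall p hp
        linarith)
    exact ⟨w, by simpa using hw, hf⟩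
  choose! 𝓡 h1 h2 using hex
  refine ⟨𝓡, fun p hp => ⟨h1 p hp, h2 p hp, fun w hw hfw => ?_⟩, ?_⟩
  · have := hcontr p hp w (𝓡 p) hw (h1 p hp)
    rw [hfw, h2 p hp] at this
    have : ‖w - 𝓡 p‖ ≤ 0 := by linarith [norm_nonneg (w - 𝓡 p)]
    exact sub_eq_zero.1 (norm_le_zero_iff.1 this)
  · obtain ⟨K, k0, -, k2⟩ :=
      bddLip_realMap (R := R) (c := c) hS (hR.le.trans hRR) hRR hε hj hDb hg hq
    refine ⟨2 * K, by positivity, fun p hp p' hp' => ?_⟩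
    have a1 := hcontr p' hp' (𝓡 p) (𝓡 p') (h1 p hp) (h1 p' hp')
    have hm : 𝓡 p ∈ closedBall (0 : TPath T H) R := by
      have := h1 p hp; rw [mem_closedBall_zero_iff]; linarith
    have a2 := k2 (p, 𝓡 p) ⟨hp, hm⟩ (p', 𝓡 p) ⟨hp', hm⟩
    have e : ((p, 𝓡 p) : _ × TPath T H) - (p', 𝓡 p) = (p - p', 0) := by simp
    rw [e, Prod.norm_def, norm_zero, max_eq_left (norm_nonneg _)] at a2
    have e2 : 𝓡 p - 𝓡 p' = (S.realMap ε p (𝓡 p) - S.realMap ε p' (𝓡 p)) +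
        (S.realMap ε p' (𝓡 p) - S.realMap ε p' (𝓡 p')) := by
      rw [h2 p hp, h2 p' hp']; abel
    have a3 := norm_add_le (S.realMap ε p (𝓡 p) - S.realMap ε p' (𝓡 p))
      (S.realMap ε p' (𝓡 p) - S.realMap ε p' (𝓡 p'))
    rw [← e2] at a3
    linarith [norm_nonneg (𝓡 p - 𝓡 p')]

end SplitData

/-! ### Holomorphic extension of the reconstruction map -/

theorem CxPair.isometry_ofR {V Vc : Type*} [NormedAddCommGroup V] [NormedSpace ℝ V]
    [NormedAddCommGroup Vc] [NormedSpace ℂ Vc] [CxPair V Vc] :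
    Isometry (CxPair.ofR : V → Vc) :=
  Isometry.of_dist_eq fun x y => by rw [dist_eq_norm, dist_eq_norm, CxPair.norm_ofR_sub]

/-- A property holding near every point of a compact set holds in a uniform neighbourhood of it. -/
theorem exists_forall_near_of_isCompact {X : Type*} [PseudoMetricSpace X] {K : Set X}
    (hK : IsCompact K) {P : X → Prop} (h : ∀ x ∈ K, ∀ᶠ y in 𝓝 x, P y) :
    ∃ η > 0, ∀ x ∈ K, ∀ y, dist y x < η → P y := by
  obtain ⟨η, hη, hsub⟩ := hK.exists_thickening_subset_open (isOpen_interior (s := {y | P y}))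
    fun x hx => mem_interior_iff_mem_nhds.2 (h x hx)
  exact ⟨η, hη, fun x hx y hy => interior_subset (hsub (mem_thickening_iff.2 ⟨x, hx, hy⟩))⟩

theorem exists_forall_near_norm_sub_lt {X Y : Type*} [NormedAddCommGroup X] [NormedAddCommGroup Y]
    {K : Set X} (hK : IsCompact K) {f : X → Y} (h : ∀ x ∈ K, ContinuousAt f x) {ε : ℝ}
    (hε : 0 < ε) : ∃ η > 0, ∀ x ∈ K, ∀ y, ‖y - x‖ < η → ‖f y - f x‖ < ε := by
  have := hK.uniformContinuousAt_of_continuousAt f h (Metric.dist_mem_uniformity hε)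
  obtain ⟨η, hη, hsub⟩ := Metric.mem_uniformity_dist.1 this
  refine ⟨η, hη, fun x hx y hy => ?_⟩
  rw [← dist_eq_norm, dist_comm] at hy ⊢
  exact hsub hy hx

theorem differentiableAt_reconMap {𝕜 Z H Wh PY PL : Type*} [NontriviallyNormedField 𝕜]
    [NormedAddCommGroup Z] [NormedSpace 𝕜 Z] [NormedAddCommGroup H] [NormedSpace 𝕜 H]
    [NormedAddCommGroup Wh] [NormedSpace 𝕜 Wh] [NormedAddCommGroup PY] [NormedSpace 𝕜 PY]
    [NormedAddCommGroup PL] [NormedSpace 𝕜 PL] [CompleteSpace Z] [CompleteSpace H]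
    {tr : (H →L[𝕜] Wh) →L[𝕜] (Wh →L[𝕜] H)} {D : Z →L[𝕜] Z} {E : H →L[𝕜] Z}
    {B : Z →L[𝕜] Wh} {pot : PY → Z →L[𝕜] Z} {N : PY → Z} {hi : Z →L[𝕜] PY} {lo : PL →L[𝕜] PY}
    {pr : PY →L[𝕜] Z} {obs : PL →L[𝕜] Wh} {p : PL × PY × PY} {w : Z}
    (hO : Observable tr D E B (pot (lo p.1 + p.2.1)))
    (hpot : DifferentiableAt 𝕜 pot (lo p.1 + p.2.1))
    (hN : DifferentiableAt 𝕜 N (lo p.1 + p.2.1 + hi w)) :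
    DifferentiableAt 𝕜
      (fun x : (PL × PY × PY) × Z => reconMap tr D E B pot N hi lo pr obs x.1 x.2) (p, w) := by
  have hq : DifferentiableAt 𝕜 (fun x : (PL × PY × PY) × Z => lo x.1.1 + x.1.2.1) (p, w) := by
    fun_prop
  have hqw : DifferentiableAt 𝕜 (fun x : (PL × PY × PY) × Z => lo x.1.1 + x.1.2.1 + hi x.2)
      (p, w) := by fun_prop
  have hP : DifferentiableAt 𝕜 (fun x : (PL × PY × PY) × Z => pot (lo x.1.1 + x.1.2.1)) (p, w) :=
    DifferentiableAt.comp (g := pot) (p, w) hpot hq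
  have hNx : DifferentiableAt 𝕜
      (fun x : (PL × PY × PY) × Z => N (lo x.1.1 + x.1.2.1 + hi x.2)) (p, w) :=
    DifferentiableAt.comp (g := N) (p, w) hN hqw
  have hS : DifferentiableAt 𝕜
      (fun x : (PL × PY × PY) × Z => srcRecon tr D E B (pot (lo x.1.1 + x.1.2.1))) (p, w) :=
    DifferentiableAt.comp (g := fun M => srcRecon tr D E B M) (p, w)
      (differentiableAt_srcRecon hO) hP
  have hK : DifferentiableAt 𝕜
      (fun x : (PL × PY × PY) × Z => obsRecon tr D E B (pot (lo x.1.1 + x.1.2.1))) (p, w) :=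
    DifferentiableAt.comp (g := fun M => obsRecon tr D E B M) (p, w)
      (differentiableAt_obsRecon hO) hP
  have h2 : DifferentiableAt 𝕜 (fun x : (PL × PY × PY) × Z => pr x.1.2.2) (p, w) := by fun_prop
  have hw : DifferentiableAt 𝕜 (fun x : (PL × PY × PY) × Z => x.2) (p, w) := by fun_prop
  have ho : DifferentiableAt 𝕜 (fun x : (PL × PY × PY) × Z => obs x.1.1) (p, w) := by fun_prop
  exact (hS.clm_apply ((hNx.sub (hP.clm_apply hw)).add h2)).add (hK.clm_apply ho)

/-- The open cylinder `‖Re z‖ < 4 R₀`, `‖Im z‖ < 2δ`. -/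
def strip (Y : Type*) [NormedAddCommGroup Y] (R₀ δ : ℝ) : Set (Cx Y) :=
  {z | ‖z.re‖ < 4 * R₀ ∧ ‖z.im‖ < 2 * δ}

section Strip

variable {Y : Type*} [NormedAddCommGroup Y] {R₀ δ : ℝ}

theorem strip_subset_cylinder : strip Y R₀ δ ⊆ cylinder Y (4 * R₀) (2 * δ) :=
  fun _ hz => ⟨hz.1.le, hz.2.le⟩

theorem isOpen_strip : IsOpen (strip Y R₀ δ) :=
  (isOpen_lt Cx.continuous_re.norm continuous_const).inter
    (isOpen_lt Cx.continuous_im.norm continuous_const)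

theorem strip_subset_interior : strip Y R₀ δ ⊆ interior (cylinder Y (4 * R₀) (2 * δ)) :=
  isOpen_strip.subset_interior_iff.2 strip_subset_cylinder

theorem mem_strip_of_near {x : Y} {z : Cx Y} {r : ℝ} (hx : ‖x‖ ≤ 3 * R₀)
    (hz : ‖z - Cx.ofReal x‖ ≤ r) (h1 : r < R₀) (h2 : r < 2 * δ) : z ∈ strip Y R₀ δ := by
  have a1 : ‖z.re - x‖ ≤ r := (Cx.norm_re_le (z - Cx.ofReal x)).trans hz
  have a2 : ‖z.im - 0‖ ≤ r := (Cx.norm_im_le (z - Cx.ofReal x)).trans hz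
  have a3 := norm_le_norm_add_norm_sub' z.re x
  rw [sub_zero] at a2
  exact ⟨by linarith, by linarith⟩

variable [InnerProductSpace ℝ Y]

theorem convex_strip : Convex ℝ (strip Y R₀ δ) := by
  have hre : ∀ (a : ℝ) (z : Cx Y), (a • z).re = a • z.re := fun a z => by
    change ((a : ℂ) • z).re = _
    rw [Cx.re_smul, Complex.ofReal_re, Complex.ofReal_im, zero_smul, sub_zero]
  have him : ∀ (a : ℝ) (z : Cx Y), (a • z).im = a • z.im := fun a z => by
    change ((a : ℂ) • z).im = _
    rw [Cx.im_smul, Complex.ofReal_re, Complex.ofReal_im, zero_smul, add_zero]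
  intro z hz w hw a b ha hb hab
  have h1 := convex_ball (0 : Y) (4 * R₀) (mem_ball_zero_iff.2 hz.1) (mem_ball_zero_iff.2 hw.1)
    ha hb hab
  have h2 := convex_ball (0 : Y) (2 * δ) (mem_ball_zero_iff.2 hz.2) (mem_ball_zero_iff.2 hw.2)
    ha hb hab
  rw [mem_ball_zero_iff] at h1 h2
  exact ⟨by rwa [Cx.re_add, hre, hre], by rwa [Cx.im_add, him, him]⟩

end Strip

namespace SplitData

open CxPair

variable {T : ℝ} {Y H Lo Wh : Type*} [NormedAddCommGroup Y] [InnerProductSpace ℝ Y]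
  [NormedAddCommGroup H] [InnerProductSpace ℝ H] [NormedAddCommGroup Lo] [InnerProductSpace ℝ Lo]
  [NormedAddCommGroup Wh] [InnerProductSpace ℝ Wh]

variable (S : SplitData T Y H Lo Wh)

/-- `G` is a holomorphic extension of the high-frequency part of the nonlinearity to the cylinder
`strip Y R₀ δ`, bounded and Lipschitz with a Lipschitz derivative. -/
structure ComplexRegular (G : Cx Y → Cx H) (R₀ δ LG : ℝ) : Prop where
  pos : 0 < δ
  nonneg : 0 ≤ LG
  real : ∀ x, ‖x‖ < 4 * R₀ → G (Cx.ofReal x) = Cx.ofReal (S.highNonlin x)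
  diff : ∀ z ∈ strip Y R₀ δ, DifferentiableAt ℂ G z
  bound : ∀ z ∈ strip Y R₀ δ, ‖G z‖ ≤ LG
  lip : ∀ z ∈ strip Y R₀ δ, ∀ z' ∈ strip Y R₀ δ, ‖G z - G z'‖ ≤ LG * ‖z - z'‖
  lip_fderiv : ∀ z ∈ strip Y R₀ δ, ∀ z' ∈ strip Y R₀ δ,
    ‖fderiv ℂ G z - fderiv ℂ G z'‖ ≤ LG * ‖z - z'‖

/-- The complexified potential. -/
def potC (G : Cx Y → Cx H) (q : TPath T (Cx Y)) : TPath T (Cx H) →L[ℂ] TPath T (Cx H) :=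
  (pathMul (pathMap (fderiv ℂ G) q)).comp (cxify (pathLift (Icc 0 T) S.high))

/-- The complexified input. -/
def inputC (p : TPath T (Cx Lo) × TPath T (Cx Y) × TPath T (Cx Y)) : TPath T (Cx Y) :=
  cxify (pathLift (Icc 0 T) S.low) p.1 + p.2.1

/-- A triple of real paths, seen as a triple of complex ones. -/
def ofRTriple (p : TPath T Lo × TPath T Y × TPath T Y) :
    TPath T (Cx Lo) × TPath T (Cx Y) × TPath T (Cx Y) := (ofR p.1, ofR p.2.1, ofR p.2.2)

variable {S} {G : Cx Y → Cx H} {R₀ δ LG m Lf : ℝ}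

theorem norm_ofRTriple_sub (p p' : TPath T Lo × TPath T Y × TPath T Y) :
    ‖ofRTriple p - ofRTriple p'‖ = ‖p - p'‖ := by
  simp only [Prod.norm_def, ofRTriple, Prod.fst_sub, Prod.snd_sub, norm_ofR_sub]

theorem inputC_ofR (p : TPath T Lo × TPath T Y × TPath T Y) :
    S.inputC (ofRTriple p) = ofR (S.input p) := by
  rw [inputC, input, ofR_add, ofRTriple, cxify_ofR]

namespace ComplexRegular

theorem fderiv_ofReal (hC : S.ComplexRegular G R₀ δ LG) (hg : Differentiable ℝ S.highNonlin)
    {x : Y} (hx : ‖x‖ < 4 * R₀) :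
    fderiv ℂ G (Cx.ofReal x) = cxify (fderiv ℝ S.highNonlin x) := by
  have hxs : Cx.ofReal x ∈ strip Y R₀ δ := ⟨hx, by simpa using hC.pos⟩
  refine clm_ext (V := Y) fun h => ?_
  rw [cxify_ofR]
  -- compare the derivatives along the real line `s ↦ x + s h`
  have hline : HasDerivAt (fun s : ℝ => x + s • h) h 0 := by
    simpa using ((hasDerivAt_id (0 : ℝ)).smul_const h).const_add x
  have hlineC :
      HasDerivAt (fun s : ℂ => (Cx.ofReal x : Cx Y) + s • Cx.ofReal h) (Cx.ofReal h) 0 := by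
    simpa using ((hasDerivAt_id (0 : ℂ)).smul_const (Cx.ofReal h : Cx Y)).const_add (Cx.ofReal x)
  have h1 : HasDerivAt (fun s : ℂ => G (Cx.ofReal x + s • Cx.ofReal h))
      (fderiv ℂ G (Cx.ofReal x) (Cx.ofReal h)) 0 := by
    have hx' : HasFDerivAt G (fderiv ℂ G (Cx.ofReal x))
        (Cx.ofReal x + (0 : ℂ) • Cx.ofReal h) := by
      simpa using (hC.diff _ hxs).hasFDerivAt
    exact hx'.comp_hasDerivAt (0 : ℂ) hlineC
  have h2 : HasDerivAt (fun s : ℝ => S.highNonlin (x + s • h)) (fderiv ℝ S.highNonlin x h) 0 := by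
    have hx' : HasFDerivAt S.highNonlin (fderiv ℝ S.highNonlin x) (x + (0 : ℝ) • h) := by
      simpa using (hg x).hasFDerivAt
    have := hx'.comp_hasDerivAt (0 : ℝ) hline
    exact this
  have t1 := (hasDerivAt_iff_tendsto_slope.1 h1)
  have t2 := (hasDerivAt_iff_tendsto_slope.1 h2)
  have t3 : Tendsto (fun s : ℝ => (Cx.ofReal (slope (fun s : ℝ => S.highNonlin (x + s • h)) 0 s) :
      Cx H)) (𝓝[≠] 0) (𝓝 (Cx.ofReal (fderiv ℝ S.highNonlin x h))) :=
    (Cx.isometry_ofReal.continuous.tendsto _).comp t2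
  have t4 : Tendsto (fun s : ℝ => (s : ℂ)) (𝓝[≠] 0) (𝓝[≠] 0) := by
    refine tendsto_nhdsWithin_iff.2 ⟨?_, ?_⟩
    · exact (Complex.continuous_ofReal.tendsto' 0 0 Complex.ofReal_zero).mono_left
        nhdsWithin_le_nhds
    · filter_upwards [self_mem_nhdsWithin] with s hs
      simpa using hs
  refine tendsto_nhds_unique (t1.comp t4) (t3.congr' ?_)
  have hnear : ∀ᶠ s : ℝ in 𝓝[≠] 0, ‖x + s • h‖ < 4 * R₀ := by
    refine nhdsWithin_le_nhds ?_
    have : Continuous fun s : ℝ => ‖x + s • h‖ := by fun_prop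
    exact (this.tendsto 0).eventually (gt_mem_nhds (by simpa using hx))
  filter_upwards [hnear] with s hs
  have e : (Cx.ofReal x : Cx Y) + (s : ℂ) • Cx.ofReal h = Cx.ofReal (x + s • h) := by
    have := ofR_add (Vc := Cx Y) x (s • h)
    rw [ofR_smul] at this
    exact this.symm
  simp only [Function.comp_apply, slope_def_module, sub_zero]
  rw [e, hC.real _ hs, zero_smul, add_zero, zero_smul, add_zero, hC.real _ hx]
  have h5 := ofR_smul (Vc := Cx H) s⁻¹ (S.highNonlin (x + s • h) - S.highNonlin x)
  rw [ofR_sub, Complex.ofReal_inv] at h5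
  exact h5

theorem continuousOn (hC : S.ComplexRegular G R₀ δ LG) : ContinuousOn G (strip Y R₀ δ) :=
  fun y hy => (hC.diff y hy).continuousAt.continuousWithinAt

theorem continuousOn_fderiv (hC : S.ComplexRegular G R₀ δ LG) :
    ContinuousOn (fderiv ℂ G) (strip Y R₀ δ) := continuousOn_of_lipschitz hC.lip_fderiv

theorem ofReal_mem (hC : S.ComplexRegular G R₀ δ LG) {x : Y} (hx : ‖x‖ < 4 * R₀) :
    Cx.ofReal x ∈ strip Y R₀ δ := ⟨hx, by simpa using hC.pos⟩

theorem potC_ofR (hC : S.ComplexRegular G R₀ δ LG) (hS : S.Regular R₀ m Lf) {q : TPath T Y}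
    (hq : ∀ t, ‖q t‖ < 4 * R₀) : S.potC G (ofR q) = cxify (S.pot q) := by
  refine clm_ext (V := TPath T H) fun w => ?_
  rw [cxify_ofR, potC, ContinuousLinearMap.comp_apply, cxify_ofR]
  ext1 t
  have hqs : ∀ t, (ofR q : TPath T (Cx Y)) t ∈ strip Y R₀ δ := fun t => hC.ofReal_mem (hq t)
  rw [pathMul_apply, pathMap_apply (continuous_comp_path hC.continuousOn_fderiv hqs)]
  have e1 : (ofR q : TPath T (Cx Y)) t = Cx.ofReal (q t) := rfl
  rw [e1, hC.fderiv_ofReal hS.differentiable (hq t)]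
  change cxify (fderiv ℝ S.highNonlin (q t)) (ofR (S.high (w t)) : Cx Y) =
    Cx.ofReal (pathMap (fderiv ℝ S.highNonlin) q t (S.high (w t)))
  rw [cxify_ofR, pathMap_apply (hS.continuous_fderiv.comp q.continuous)]
  rfl

theorem pathMap_ofR (hC : S.ComplexRegular G R₀ δ LG) (hS : S.Regular R₀ m Lf) {q : TPath T Y}
    (hq : ∀ t, ‖q t‖ < 4 * R₀) :
    pathMap G (ofR q : TPath T (Cx Y)) = ofR (pathMap S.highNonlin q) := by
  ext1 t
  have hqs : ∀ t, (ofR q : TPath T (Cx Y)) t ∈ strip Y R₀ δ := fun t => hC.ofReal_mem (hq t)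
  rw [pathMap_apply (continuous_comp_path hC.continuousOn hqs)]
  change G (Cx.ofReal (q t)) = Cx.ofReal (pathMap S.highNonlin q t)
  rw [hC.real _ (hq t), pathMap_apply (hS.continuous.comp q.continuous)]

theorem norm_potC_sub_le (hC : S.ComplexRegular G R₀ δ LG) (hS : S.Regular R₀ m Lf)
    {q q' : TPath T (Cx Y)} (hq : ∀ t, q t ∈ strip Y R₀ δ) (hq' : ∀ t, q' t ∈ strip Y R₀ δ) :
    ‖S.potC G q - S.potC G q'‖ ≤ 2 * LG * ‖q - q'‖ := by
  rw [potC, potC, ← ContinuousLinearMap.sub_comp, pathMul_sub]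
  refine (ContinuousLinearMap.opNorm_comp_le _ _).trans ?_
  have h1 : ‖(cxify (pathLift (Icc 0 T) S.high) : TPath T (Cx H) →L[ℂ] TPath T (Cx Y))‖ ≤ 2 :=
    (norm_cxify_le _).trans (by
      have := (norm_pathLift_le (α := Icc 0 T) S.high).trans hS.norm_high
      linarith)
  have h2 := (norm_pathMul_le _).trans (norm_pathMap_sub_le (s := strip Y R₀ δ)
    hC.continuousOn_fderiv hC.nonneg hC.lip_fderiv hq hq')
  have h3 : 0 ≤ LG * ‖q - q'‖ := mul_nonneg hC.nonneg (norm_nonneg _)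
  refine (mul_le_mul h2 h1 (norm_nonneg _) h3).trans (by linarith)

variable [CompleteSpace H]

theorem differentiableAt_potC (hC : S.ComplexRegular G R₀ δ LG) {q : TPath T (Cx Y)}
    (hq : ∀ t, q t ∈ strip Y R₀ δ) : DifferentiableAt ℂ (S.potC G) q :=
  (differentiableAt_pathMul_fderiv isOpen_strip hC.diff hC.nonneg hC.lip_fderiv convex_strip
    hq).clm_comp (differentiableAt_const _)

end ComplexRegular

variable [CompleteSpace H] [CompleteSpace Wh]

variable (S) in
/-- The complexified reconstruction map. -/
def complexMap (G : Cx Y → Cx H) :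
    TPath T (Cx Lo) × TPath T (Cx Y) × TPath T (Cx Y) → TPath T (Cx H) → TPath T (Cx H) :=
  reconMap (transp H (Cx H) Wh (Cx Wh)) (cxify S.duh) (cxify S.free) (cxify S.obsHigh) (S.potC G)
    (pathMap G) (cxify (pathLift (Icc 0 T) S.high)) (cxify (pathLift (Icc 0 T) S.low))
    (cxify (pathLift (Icc 0 T) S.proj)) (cxify (S.emb.comp S.obsLow))

variable (S) in
/-- The complexified reconstruction operator acting on sources. -/
def srcC (G : Cx Y → Cx H) (q : TPath T (Cx Y)) : TPath T (Cx H) →L[ℂ] TPath T (Cx H) :=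
  srcRecon (transp H (Cx H) Wh (Cx Wh)) (cxify S.duh) (cxify S.free) (cxify S.obsHigh) (S.potC G q)

variable (S) in
/-- The complexified reconstruction operator acting on observations. -/
def obsC (G : Cx Y → Cx H) (q : TPath T (Cx Y)) : Cx Wh →L[ℂ] TPath T (Cx H) :=
  obsRecon (transp H (Cx H) Wh (Cx Wh)) (cxify S.duh) (cxify S.free) (cxify S.obsHigh) (S.potC G q)

variable (S) in
/-- The complexified linear equation at `q` is observable. -/
def ObservableC (G : Cx Y → Cx H) (q : TPath T (Cx Y)) : Prop :=
  Observable (transp H (Cx H) Wh (Cx Wh)) (cxify S.duh : TPath T (Cx H) →L[ℂ] TPath T (Cx H))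
    (cxify S.free) (cxify S.obsHigh) (S.potC G q)

theorem complexMap_eq (p : TPath T (Cx Lo) × TPath T (Cx Y) × TPath T (Cx Y))
    (w : TPath T (Cx H)) : S.complexMap G p w =
      S.srcC G (S.inputC p) (pathMap G (S.inputC p + cxify (pathLift (Icc 0 T) S.high) w) -
        S.potC G (S.inputC p) w + cxify (pathLift (Icc 0 T) S.proj) p.2.2) +
      S.obsC G (S.inputC p) (cxify (S.emb.comp S.obsLow) p.1) := rfl

variable {j c cS cK R ε : ℝ}

/-- At real points the complex map is the real one, provided that the radial truncation is inactive
there. -/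
theorem complexMap_ofR (hC : S.ComplexRegular G R₀ δ LG) (hS : S.Regular R₀ m Lf) (hR₀ : 0 < R₀)
    (hRR : R ≤ R₀) (hε : 0 < ε) {p : TPath T Lo × TPath T Y × TPath T Y} {w : TPath T H}
    (hg : S.Good j c (S.input p)) (hq : ∀ t, ‖S.input p t‖ ≤ 2 * R₀) (hw : ‖w‖ ≤ R)
    (hcut : ‖S.obsLow p.1‖ ≤ ε) :
    S.complexMap G (ofRTriple p) (ofR w) = ofR (S.realMap ε p w) := by
  have hq4 : ∀ t, ‖S.input p t‖ < 4 * R₀ := fun t => (hq t).trans_lt (by linarith)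
  have hqw : ∀ t, ‖(S.input p + pathLift _ S.high w) t‖ < 4 * R₀ := fun t => by
    have := (ContinuousMap.norm_coe_le_norm (pathLift _ S.high w) t).trans
      (hS.norm_high_apply_le w)
    rw [ContinuousMap.add_apply]
    refine (norm_add_le _ _).trans_lt ?_
    linarith [hq t]
  rw [complexMap_eq, inputC_ofR, srcC, obsC, hC.potC_ofR hS hq4, srcRecon_cxify hg.observable,
    obsRecon_cxify hg.observable]
  simp only [ofRTriple, cxify_ofR]
  rw [← ofR_add, hC.pathMap_ofR hS hqw, ← ofR_sub, ← ofR_add, cxify_ofR, ← ofR_add]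
  rw [realMap, reconMap, radialCut_of_norm_le hε hcut]
  rfl

theorem differentiableAt_complexMap (hC : S.ComplexRegular G R₀ δ LG)
    {p : TPath T (Cx Lo) × TPath T (Cx Y) × TPath T (Cx Y)} {w : TPath T (Cx H)}
    (hO : S.ObservableC G (S.inputC p)) (hq : ∀ t, S.inputC p t ∈ strip Y R₀ δ)
    (hqw : ∀ t, (S.inputC p + cxify (pathLift (Icc 0 T) S.high) w) t ∈ strip Y R₀ δ) :
    DifferentiableAt ℂ (fun x : (TPath T (Cx Lo) × TPath T (Cx Y) × TPath T (Cx Y)) ×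
      TPath T (Cx H) => S.complexMap G x.1 x.2) (p, w) :=
  differentiableAt_reconMap (obs := cxify (S.emb.comp S.obsLow)) hO (hC.differentiableAt_potC hq)
    (hasFDerivAt_pathMap isOpen_strip hC.diff hC.nonneg hC.lip_fderiv convex_strip
      hqw).differentiableAt

/-- Near the paths of a compact set of real inputs, the complexified linear equation is observable
with uniform bounds, and the reconstruction operators are uniformly continuous. -/
theorem exists_near_compact (hC : S.ComplexRegular G R₀ δ LG) (hS : S.Regular R₀ m Lf)
    (hR₀ : 0 < R₀) {K : Set (TPath T Y)} (hK : IsCompact K) (hg : ∀ q ∈ K, S.Good j c q)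
    (hb : ∀ q ∈ K, ReconBound S cS cK q) (hq : ∀ q ∈ K, ∀ t, ‖q t‖ ≤ 2 * R₀) {ε' : ℝ}
    (hε' : 0 < ε') (hε'1 : ε' ≤ 1) :
    ∃ η > 0, ∀ q₀ ∈ K, ∀ q : TPath T (Cx Y), ‖q - ofR q₀‖ < η →
      S.ObservableC G q ∧ ‖S.srcC G q‖ ≤ 2 * cS + 1 ∧ ‖S.obsC G q‖ ≤ 2 * cK + 1 ∧
      ‖S.srcC G q - S.srcC G (ofR q₀)‖ ≤ ε' ∧ ‖S.obsC G q - S.obsC G (ofR q₀)‖ ≤ ε' := by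
  set Kc : Set (TPath T (Cx Y)) := ofR '' K with hKc
  have hKcc : IsCompact Kc := hK.image isometry_ofR.continuous
  have hpotd : ∀ q ∈ K, DifferentiableAt ℂ (S.potC G) (ofR q) := fun q hqK =>
    hC.differentiableAt_potC fun t => hC.ofReal_mem ((hq q hqK t).trans_lt (by linarith))
  have hpote : ∀ q ∈ K, S.potC G (ofR q) = cxify (S.pot q) := fun q hqK =>
    hC.potC_ofR hS fun t => (hq q hqK t).trans_lt (by linarith)
  have hobs : ∀ q ∈ K, S.ObservableC G (ofR q) := fun q hqK => by
    rw [ObservableC, hpote q hqK]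
    exact observable_cxify (hg q hqK).observable
  have hsc : ∀ z ∈ Kc, ContinuousAt (S.srcC G) z := by
    rintro _ ⟨q, hqK, rfl⟩
    exact ((differentiableAt_srcRecon (hobs q hqK)).comp (ofR q) (hpotd q hqK)).continuousAt
  have hoc : ∀ z ∈ Kc, ContinuousAt (S.obsC G) z := by
    rintro _ ⟨q, hqK, rfl⟩
    exact ((differentiableAt_obsRecon (hobs q hqK)).comp (ofR q) (hpotd q hqK)).continuousAt
  obtain ⟨η₁, h1, h1'⟩ := exists_forall_near_norm_sub_lt
    (Y := TPath T (Cx H) →L[ℂ] TPath T (Cx H)) hKcc hsc hε'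
  obtain ⟨η₂, h2, h2'⟩ := exists_forall_near_norm_sub_lt
    (Y := Cx Wh →L[ℂ] TPath T (Cx H)) hKcc hoc hε'
  obtain ⟨η₃, h3, h3'⟩ := exists_forall_near_of_isCompact (P := S.ObservableC G) hKcc (by
    rintro _ ⟨q, hqK, rfl⟩
    exact (hpotd q hqK).continuousAt.eventually (eventually_observable (hobs q hqK)))
  refine ⟨min η₁ (min η₂ η₃), by positivity, fun q₀ hq₀ q hqq => ?_⟩
  have hm : (ofR q₀ : TPath T (Cx Y)) ∈ Kc := ⟨q₀, hq₀, rfl⟩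
  have a1 := h3' _ hm q (by
    rw [dist_eq_norm]
    exact hqq.trans_le ((min_le_right _ _).trans (min_le_right _ _)))
  have b1 := h1' _ hm q (hqq.trans_le (min_le_left _ _))
  have b2 := h2' _ hm q (hqq.trans_le ((min_le_right _ _).trans (min_le_left _ _)))
  have c1 : ‖S.srcC G (ofR q₀)‖ ≤ 2 * cS := by
    rw [srcC, hpote q₀ hq₀, srcRecon_cxify (hg q₀ hq₀).observable]
    exact (norm_cxify_le _).trans (by linarith [(hb q₀ hq₀).norm_src])
  have c2 : ‖S.obsC G (ofR q₀)‖ ≤ 2 * cK := by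
    rw [obsC, hpote q₀ hq₀, obsRecon_cxify (hg q₀ hq₀).observable]
    exact (norm_cxify_le _).trans (by linarith [(hb q₀ hq₀).norm_obs])
  have d1 := norm_le_norm_add_norm_sub' (S.srcC G q) (S.srcC G (ofR q₀))
  have d2 := norm_le_norm_add_norm_sub' (S.obsC G q) (S.obsC G (ofR q₀))
  exact ⟨a1, by linarith, by linarith, b1.le, b2.le⟩

end SplitData

/-! ### The complex fixed point equation -/

namespace SplitData

open CxPair

variable {T : ℝ} {Y H Lo Wh : Type*} [NormedAddCommGroup Y] [InnerProductSpace ℝ Y]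
  [NormedAddCommGroup H] [InnerProductSpace ℝ H] [NormedAddCommGroup Lo] [InnerProductSpace ℝ Lo]
  [NormedAddCommGroup Wh] [InnerProductSpace ℝ Wh]
  {S : SplitData T Y H Lo Wh} {G : Cx Y → Cx H} {R₀ δ LG m Lf : ℝ}

theorem norm_cxify_pathLift_apply_le {E F : Type*} [NormedAddCommGroup E] [InnerProductSpace ℝ E]
    [NormedAddCommGroup F] [InnerProductSpace ℝ F] {U : E →L[ℝ] F} (hU : ‖U‖ ≤ 1)
    (w : TPath T (Cx E)) :
    ‖(cxify (pathLift (Icc 0 T) U) w : TPath T (Cx F))‖ ≤ 2 * ‖w‖ := by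
  refine (ContinuousLinearMap.le_opNorm _ _).trans ?_
  gcongr
  refine (norm_cxify_le _).trans ?_
  have := (norm_pathLift_le (α := Icc 0 T) U).trans hU
  linarith

theorem norm_inputC_sub_le (hS : S.Regular R₀ m Lf)
    (p p' : TPath T (Cx Lo) × TPath T (Cx Y) × TPath T (Cx Y)) :
    ‖S.inputC p - S.inputC p'‖ ≤ 3 * ‖p - p'‖ := by
  have e : S.inputC p - S.inputC p' =
      cxify (pathLift (Icc 0 T) S.low) (p - p').1 + (p - p').2.1 := by
    rw [inputC, inputC, Prod.fst_sub, Prod.snd_sub, Prod.fst_sub, map_sub]; abel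
  have h1 := norm_cxify_pathLift_apply_le (T := T) hS.norm_low (p - p').1
  have h2 := norm_fst_le (p - p')
  have h3 := (norm_fst_le (p - p').2).trans (norm_snd_le (p - p'))
  rw [e]
  refine (norm_add_le _ _).trans ?_
  linarith

/-- The paths `q` and `q + w` stay in the cylinder when `q` and `w` are close to real paths. -/
theorem mem_strip_of_near_real (hS : S.Regular R₀ m Lf) {q₀ : TPath T Y} {w₀ : TPath T H}
    (hq₀ : ∀ t, ‖q₀ t‖ ≤ 2 * R₀) (hw₀ : ‖w₀‖ ≤ R₀) {q : TPath T (Cx Y)} {w : TPath T (Cx H)}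
    {a b : ℝ} (hq : ‖q - ofR q₀‖ ≤ a) (hw : ‖w - ofR w₀‖ ≤ b) (h1 : a + 2 * b < R₀)
    (h2 : a + 2 * b < 2 * δ) :
    (∀ t, (q + cxify (pathLift (Icc 0 T) S.high) w) t ∈
      closedBall (Cx.ofReal ((q₀ + pathLift _ S.high w₀) t)) (a + 2 * b)) ∧
    (∀ t, closedBall (Cx.ofReal ((q₀ + pathLift _ S.high w₀) t)) (a + 2 * b) ⊆ strip Y R₀ δ) := by
  refine ⟨fun t => ?_, fun t z hz => ?_⟩
  · have e : q + cxify (pathLift (Icc 0 T) S.high) w - ofR (q₀ + pathLift _ S.high w₀) =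
        (q - ofR q₀) + cxify (pathLift (Icc 0 T) S.high) (w - ofR w₀) := by
      rw [map_sub, cxify_ofR, ofR_add]; abel
    have h3 := norm_cxify_pathLift_apply_le (T := T) hS.norm_high (w - ofR w₀)
    have h4 : ‖q + cxify (pathLift (Icc 0 T) S.high) w - ofR (q₀ + pathLift _ S.high w₀)‖ ≤
        a + 2 * b := by
      rw [e]; refine (norm_add_le _ _).trans ?_; linarith
    rw [mem_closedBall, dist_eq_norm]
    exact (ContinuousMap.norm_coe_le_norm
      (q + cxify (pathLift (Icc 0 T) S.high) w - ofR (q₀ + pathLift _ S.high w₀)) t).trans h4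
  · rw [mem_closedBall, dist_eq_norm] at hz
    refine mem_strip_of_near ?_ hz h1 h2
    have := (ContinuousMap.norm_coe_le_norm (pathLift _ S.high w₀) t).trans
      (hS.norm_high_apply_le w₀)
    rw [ContinuousMap.add_apply]
    refine (norm_add_le _ _).trans ?_
    linarith [hq₀ t]

theorem mem_strip_input {q₀ : TPath T Y} (hq₀ : ∀ t, ‖q₀ t‖ ≤ 2 * R₀) (hR₀ : 0 < R₀)
    {q : TPath T (Cx Y)} {a : ℝ} (hq : ‖q - ofR q₀‖ ≤ a) (h1 : a < R₀) (h2 : a < 2 * δ) (t) :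
    q t ∈ strip Y R₀ δ :=
  mem_strip_of_near (x := q₀ t) (by linarith [hq₀ t])
    ((ContinuousMap.norm_coe_le_norm (q - ofR q₀) t).trans hq) h1 h2

variable [CompleteSpace H] [CompleteSpace Wh]

/-- Near a real path, the complexified reconstruction map contracts as well as the real one, up to
an error of the size of the neighbourhood. -/
theorem norm_complexMap_sub_le (hC : S.ComplexRegular G R₀ δ LG) (hS : S.Regular R₀ m Lf)
    (hR₀ : 0 < R₀)
    {q₀ : TPath T Y} {w₀ : TPath T H} (hq₀ : ∀ t, ‖q₀ t‖ ≤ 2 * R₀) {R : ℝ} (hw₀R : ‖w₀‖ ≤ R)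
    (hRR : R ≤ R₀) {p : TPath T (Cx Lo) × TPath T (Cx Y) × TPath T (Cx Y)}
    {w w' : TPath T (Cx H)} {a b CS : ℝ} (hq : ‖S.inputC p - ofR q₀‖ ≤ a) (hw : ‖w - ofR w₀‖ ≤ b)
    (hw' : ‖w' - ofR w₀‖ ≤ b) (h1 : a + 2 * b < R₀) (h2 : a + 2 * b < 2 * δ) (ha : 0 ≤ a)
    (hb : 0 ≤ b) (hsrc : ‖S.srcC G (S.inputC p)‖ ≤ CS) :
    ‖S.complexMap G p w - S.complexMap G p w'‖ ≤
      CS * (2 * (LG * (2 * a + 2 * b) + 2 * (Lf * R))) * ‖w - w'‖ := by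
  set q := S.inputC p with hqdef
  obtain ⟨m1, m2⟩ := mem_strip_of_near_real (δ := δ) hS hq₀ (hw₀R.trans hRR) hq hw h1 h2
  obtain ⟨m1', -⟩ := mem_strip_of_near_real (δ := δ) hS hq₀ (hw₀R.trans hRR) hq hw' h1 h2
  have hqs : ∀ t, q t ∈ strip Y R₀ δ :=
    mem_strip_input hq₀ hR₀ hq (by linarith) (by linarith)
  have hR : 0 ≤ R := (norm_nonneg _).trans hw₀R
  set κ := LG * (2 * a + 2 * b) + 2 * (Lf * R) with hκ
  have hκ0 : 0 ≤ κ := by have := hC.nonneg; have := hS.Lf_nonneg; positivity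
  have key := norm_pathMap_sub_sub_le (𝕜 := ℂ) (F := G) (m := pathMap (fderiv ℂ G) q)
    (a := q + cxify (pathLift (Icc 0 T) S.high) w) (b := q + cxify (pathLift (Icc 0 T) S.high) w')
    hκ0 (continuous_comp_path hC.continuousOn fun t => m2 t (m1 t))
    (continuous_comp_path hC.continuousOn fun t => m2 t (m1' t))
    (s := fun t => closedBall (Cx.ofReal ((q₀ + pathLift _ S.high w₀) t)) (a + 2 * b))
    (fun t => convex_closedBall _ _) m1 m1' (fun t y hy => hC.diff y (m2 t hy))
    (fun t y hy => by
      rw [pathMap_apply (continuous_comp_path hC.continuousOn_fderiv hqs)]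
      have hws : ‖(pathLift _ S.high w₀) t‖ ≤ R :=
        (ContinuousMap.norm_coe_le_norm (pathLift _ S.high w₀) t).trans
          ((hS.norm_high_apply_le w₀).trans hw₀R)
      have hx : ‖(q₀ + pathLift _ S.high w₀) t‖ < 4 * R₀ := by
        rw [ContinuousMap.add_apply]
        refine (norm_add_le _ _).trans_lt ?_
        linarith [hq₀ t]
      have hx0 : ‖q₀ t‖ < 4 * R₀ := (hq₀ t).trans_lt (by linarith)
      have s1 := hC.lip_fderiv y (m2 t hy) _ (hC.ofReal_mem hx)
      have s2 : ‖fderiv ℂ G (Cx.ofReal ((q₀ + pathLift _ S.high w₀) t)) -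
          fderiv ℂ G (Cx.ofReal (q₀ t))‖ ≤ 2 * (Lf * R) := by
        rw [hC.fderiv_ofReal hS.differentiable hx, hC.fderiv_ofReal hS.differentiable hx0,
          ← cxify_sub]
        refine (norm_cxify_le _).trans ?_
        have := hS.lipschitz_fderiv _ hx.le _ hx0.le
        rw [ContinuousMap.add_apply, add_sub_cancel_left] at this
        have := this.trans (mul_le_mul_of_nonneg_left hws hS.Lf_nonneg)
        rw [ContinuousMap.add_apply]
        linarith
      have s3 := hC.lip_fderiv _ (hC.ofReal_mem hx0) _ (hqs t)
      have s4 : ‖Cx.ofReal (q₀ t) - q t‖ ≤ a := by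
        rw [norm_sub_rev]
        exact (ContinuousMap.norm_coe_le_norm (q - ofR q₀) t).trans hq
      have s5 : ‖y - Cx.ofReal ((q₀ + pathLift _ S.high w₀) t)‖ ≤ a + 2 * b := by
        rwa [mem_closedBall, dist_eq_norm] at hy
      have s6 := s1.trans (mul_le_mul_of_nonneg_left s5 hC.nonneg)
      have s7 := s3.trans (mul_le_mul_of_nonneg_left s4 hC.nonneg)
      have e : fderiv ℂ G y - fderiv ℂ G (q t) =
          (fderiv ℂ G y - fderiv ℂ G (Cx.ofReal ((q₀ + pathLift _ S.high w₀) t))) +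
          (fderiv ℂ G (Cx.ofReal ((q₀ + pathLift _ S.high w₀) t)) -
            fderiv ℂ G (Cx.ofReal (q₀ t))) +
          (fderiv ℂ G (Cx.ofReal (q₀ t)) - fderiv ℂ G (q t)) := by abel
      rw [e]
      refine (norm_add₃_le).trans ?_
      rw [hκ]
      linarith)
  have e1 : q + cxify (pathLift (Icc 0 T) S.high) w - (q + cxify (pathLift (Icc 0 T) S.high) w') =
      cxify (pathLift (Icc 0 T) S.high) (w - w') := by rw [map_sub]; abel
  rw [e1] at key
  have e2 : S.complexMap G p w - S.complexMap G p w' = S.srcC G q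
      (pathMap G (q + cxify (pathLift (Icc 0 T) S.high) w) -
        pathMap G (q + cxify (pathLift (Icc 0 T) S.high) w') -
        pathMul (pathMap (fderiv ℂ G) q) (cxify (pathLift (Icc 0 T) S.high) (w - w'))) := by
    have : pathMul (pathMap (fderiv ℂ G) q) (cxify (pathLift (Icc 0 T) S.high) (w - w')) =
      S.potC G q w - S.potC G q w' := by rw [← map_sub]; rfl
    rw [this, complexMap_eq, complexMap_eq, add_sub_add_right_eq_sub, ← map_sub,
      add_sub_add_right_eq_sub]
    congr 1
    abel
  rw [e2]
  have hCS : 0 ≤ CS := (norm_nonneg (S.srcC G q)).trans hsrc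
  have h3 := norm_cxify_pathLift_apply_le (T := T) hS.norm_high (w - w')
  calc _ ≤ CS * (κ * (2 * ‖w - w'‖)) := (ContinuousLinearMap.le_opNorm _ _).trans
        (mul_le_mul hsrc (key.trans (mul_le_mul_of_nonneg_left h3 hκ0)) (norm_nonneg _) hCS)
    _ = _ := by ring

set_option maxHeartbeats 800000 in
/-- The complexified reconstruction map depends on the data in a uniformly continuous way near
real data. -/
theorem norm_complexMap_param_sub_le (hC : S.ComplexRegular G R₀ δ LG) (hS : S.Regular R₀ m Lf)
    (hR₀ : 0 < R₀) {p₀ : TPath T Lo × TPath T Y × TPath T Y} {w₀ : TPath T H}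
    {R Rh ε θ ε' CS CK : ℝ}
    (hq₀ : ∀ t, ‖S.input p₀ t‖ ≤ 2 * R₀) (hw₀ : ‖w₀‖ ≤ R) (hRR : R ≤ R₀) (hh : ‖p₀.2.2‖ ≤ Rh)
    (hcut : ‖S.obsLow p₀.1‖ ≤ ε) {p : TPath T (Cx Lo) × TPath T (Cx Y) × TPath T (Cx Y)}
    (hp : ‖p - ofRTriple p₀‖ ≤ θ) (hθ1 : 3 * θ < R₀) (hθ2 : 3 * θ < 2 * δ)
    (hsrc : ‖S.srcC G (S.inputC p)‖ ≤ CS) (hobs : ‖S.obsC G (S.inputC p)‖ ≤ CK)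
    (hdsrc : ‖S.srcC G (S.inputC p) - S.srcC G (ofR (S.input p₀))‖ ≤ ε')
    (hdobs : ‖S.obsC G (S.inputC p) - S.obsC G (ofR (S.input p₀))‖ ≤ ε') :
    ‖S.complexMap G p (ofR w₀) - S.complexMap G (ofRTriple p₀) (ofR w₀)‖ ≤
      CS * (θ * (3 * LG + 6 * LG * R + 2)) + ε' * (LG + m * R + Rh) +
      CK * (‖(cxify (S.emb.comp S.obsLow) : TPath T (Cx Lo) →L[ℂ] Cx Wh)‖ * θ) +
      ε' * (‖S.emb‖ * ε) := by
  have hθ0 : 0 ≤ θ := (norm_nonneg _).trans hp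
  have hR0 : 0 ≤ R := (norm_nonneg _).trans hw₀
  have hLG := hC.nonneg
  have hε'0 : 0 ≤ ε' :=
    (norm_nonneg (S.srcC G (S.inputC p) - S.srcC G (ofR (S.input p₀)))).trans hdsrc
  have hin : ‖S.inputC p - ofR (S.input p₀)‖ ≤ 3 * θ := by
    rw [← inputC_ofR]
    exact (norm_inputC_sub_le hS _ _).trans (by linarith)
  set q := S.inputC p with hq
  set q₀ := S.input p₀ with hq₀d
  set hi : TPath T (Cx H) →L[ℂ] TPath T (Cx Y) := cxify (pathLift (Icc 0 T) S.high) with hhi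
  set pr : TPath T (Cx Y) →L[ℂ] TPath T (Cx H) := cxify (pathLift (Icc 0 T) S.proj) with hpr
  have hz : ‖(ofR w₀ : TPath T (Cx H)) - ofR w₀‖ ≤ 0 := by rw [sub_self, norm_zero]
  obtain ⟨m1, m2⟩ := mem_strip_of_near_real (δ := δ) hS hq₀ (hw₀.trans hRR) hin hz
    (by linarith) (by linarith)
  have hz0 : ‖(ofR q₀ : TPath T (Cx Y)) - ofR q₀‖ ≤ 0 := by rw [sub_self, norm_zero]
  obtain ⟨n1, n2⟩ := mem_strip_of_near_real (δ := δ) hS hq₀ (hw₀.trans hRR) hz0 hz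
    (by linarith) (by linarith [hC.pos])
  have hqs : ∀ t, q t ∈ strip Y R₀ δ := mem_strip_input hq₀ hR₀ hin hθ1 hθ2
  have hqs0 : ∀ t, (ofR q₀ : TPath T (Cx Y)) t ∈ strip Y R₀ δ :=
    mem_strip_input hq₀ hR₀ hz0 hR₀ (by linarith [hC.pos])
  -- the source terms
  have f1 : ‖pathMap G (q + hi (ofR w₀)) - pathMap G (ofR q₀ + hi (ofR w₀))‖ ≤ LG * (3 * θ) := by
    refine (norm_pathMap_sub_le hC.continuousOn hLG hC.lip (fun t => m2 t (m1 t))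
      (fun t => n2 t (n1 t))).trans ?_
    rw [add_sub_add_right_eq_sub]
    gcongr
  have f2 : ‖S.potC G q (ofR w₀) - S.potC G (ofR q₀) (ofR w₀)‖ ≤ 2 * LG * (3 * θ) * R := by
    rw [← sub_apply]
    refine (ContinuousLinearMap.le_opNorm _ _).trans (mul_le_mul ?_ (by rwa [norm_ofR])
      (norm_nonneg _) (by positivity))
    exact (hC.norm_potC_sub_le hS hqs hqs0).trans (by gcongr)
  have f3 : ‖pr p.2.2 - pr (ofR p₀.2.2)‖ ≤ 2 * θ := by
    rw [← map_sub]
    refine (norm_cxify_pathLift_apply_le (T := T) hS.norm_proj _).trans ?_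
    have := (norm_snd_le (p - ofRTriple p₀).2).trans (norm_snd_le (p - ofRTriple p₀))
    have h' : ‖p.2.2 - ofR p₀.2.2‖ ≤ ‖p - ofRTriple p₀‖ := this
    linarith
  have g1 : ‖pathMap G (ofR q₀ + hi (ofR w₀))‖ ≤ LG :=
    norm_pathMap_le hC.continuousOn hLG hC.bound (fun t => n2 t (n1 t))
  have g2 : ‖S.potC G (ofR q₀) (ofR w₀)‖ ≤ m * R := by
    rw [hC.potC_ofR hS (fun t => (hq₀ t).trans_lt (by linarith)), cxify_ofR, norm_ofR]
    exact ((S.pot q₀).le_opNorm _).trans (mul_le_mul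
      (hS.norm_pot_le fun t => (hq₀ t).trans (by linarith)) hw₀ (norm_nonneg _) hS.m_nonneg)
  have g3 : ‖pr (ofR p₀.2.2)‖ ≤ Rh := by
    rw [hpr, cxify_ofR, norm_ofR]
    refine (norm_pathLift_apply_le _ _).trans ?_
    exact (mul_le_of_le_one_left (norm_nonneg _) hS.norm_proj).trans hh
  set f := pathMap G (q + hi (ofR w₀)) - S.potC G q (ofR w₀) + pr p.2.2 with hf
  set f₀ := pathMap G (ofR q₀ + hi (ofR w₀)) - S.potC G (ofR q₀) (ofR w₀) + pr (ofR p₀.2.2) with hf0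
  have hff : ‖f - f₀‖ ≤ θ * (3 * LG + 6 * LG * R + 2) := by
    have e : f - f₀ = (pathMap G (q + hi (ofR w₀)) - pathMap G (ofR q₀ + hi (ofR w₀))) -
        (S.potC G q (ofR w₀) - S.potC G (ofR q₀) (ofR w₀)) + (pr p.2.2 - pr (ofR p₀.2.2)) := by
      rw [hf, hf0]; abel
    rw [e]
    refine (norm_add_le _ _).trans ?_
    have := norm_sub_le (pathMap G (q + hi (ofR w₀)) - pathMap G (ofR q₀ + hi (ofR w₀)))
      (S.potC G q (ofR w₀) - S.potC G (ofR q₀) (ofR w₀))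
    linarith
  have hf0n : ‖f₀‖ ≤ LG + m * R + Rh := by
    refine (norm_add_le _ _).trans ?_
    have := norm_sub_le (pathMap G (ofR q₀ + hi (ofR w₀))) (S.potC G (ofR q₀) (ofR w₀))
    linarith
  set ob : TPath T (Cx Lo) →L[ℂ] Cx Wh := cxify (S.emb.comp S.obsLow) with hob
  have hbb : ‖ob p.1 - ob (ofR p₀.1)‖ ≤ ‖ob‖ * θ := by
    rw [← map_sub]
    refine (ContinuousLinearMap.le_opNorm _ _).trans ?_
    have h' : ‖p.1 - ofR p₀.1‖ ≤ ‖p - ofRTriple p₀‖ := norm_fst_le (p - ofRTriple p₀)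
    gcongr
    exact h'.trans hp
  have hb0 : ‖ob (ofR p₀.1)‖ ≤ ‖S.emb‖ * ε := by
    rw [hob, cxify_ofR, norm_ofR]
    exact (S.emb.le_opNorm _).trans (mul_le_mul_of_nonneg_left hcut (norm_nonneg _))
  have hCS : 0 ≤ CS := (norm_nonneg (S.srcC G q)).trans hsrc
  have hCK : 0 ≤ CK := (norm_nonneg (S.obsC G q)).trans hobs
  have e1 : S.complexMap G p (ofR w₀) = S.srcC G q f + S.obsC G q (ob p.1) :=
    complexMap_eq p _
  have e2 : S.complexMap G (ofRTriple p₀) (ofR w₀) =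
      S.srcC G (ofR q₀) f₀ + S.obsC G (ofR q₀) (ob (ofR p₀.1)) := by
    have h := complexMap_eq (S := S) (G := G) (ofRTriple p₀) (ofR w₀)
    rw [inputC_ofR] at h
    exact h
  have e : S.complexMap G p (ofR w₀) - S.complexMap G (ofRTriple p₀) (ofR w₀) =
      S.srcC G q (f - f₀) + (S.srcC G q - S.srcC G (ofR q₀)) f₀ +
      (S.obsC G q (ob p.1 - ob (ofR p₀.1)) + (S.obsC G q - S.obsC G (ofR q₀)) (ob (ofR p₀.1))) := by
    rw [e1, e2, map_sub, map_sub, sub_apply, sub_apply]; abel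
  rw [e]
  have t1 : ‖S.srcC G q (f - f₀)‖ ≤ CS * (θ * (3 * LG + 6 * LG * R + 2)) :=
    (ContinuousLinearMap.le_opNorm _ _).trans (mul_le_mul hsrc hff (norm_nonneg _) hCS)
  have t2 : ‖(S.srcC G q - S.srcC G (ofR q₀)) f₀‖ ≤ ε' * (LG + m * R + Rh) :=
    (ContinuousLinearMap.le_opNorm _ _).trans (mul_le_mul hdsrc hf0n (norm_nonneg _) hε'0)
  have t3 : ‖S.obsC G q (ob p.1 - ob (ofR p₀.1))‖ ≤ CK * (‖ob‖ * θ) :=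
    (ContinuousLinearMap.le_opNorm _ _).trans (mul_le_mul hobs hbb (norm_nonneg _) hCK)
  have t4 : ‖(S.obsC G q - S.obsC G (ofR q₀)) (ob (ofR p₀.1))‖ ≤ ε' * (‖S.emb‖ * ε) :=
    (ContinuousLinearMap.le_opNorm _ _).trans (mul_le_mul hdobs hb0 (norm_nonneg _) hε'0)
  refine (norm_add_le _ _).trans ?_
  have u1 := norm_add_le (S.srcC G q (f - f₀)) ((S.srcC G q - S.srcC G (ofR q₀)) f₀)
  have u2 := norm_add_le (S.obsC G q (ob p.1 - ob (ofR p₀.1)))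
    ((S.obsC G q - S.obsC G (ofR q₀)) (ob (ofR p₀.1)))
  linarith

/-- The holomorphic extension of the real reconstruction `𝓡` to a uniform complex neighbourhood of
the data whose input `v + h₁` ranges over a compact set. -/
theorem exists_complexRecon (hC : S.ComplexRegular G R₀ δ LG) (hS : S.Regular R₀ m Lf)
    {j c cS cK R ε Rh K : ℝ} (hR : 0 < R) (hRR : R ≤ R₀) (hε : 0 < ε) (hcS : 0 ≤ cS)
    (hcK : 0 ≤ cK) (hcon : (2 * cS + 1) * (Lf * R) ≤ 1 / 16)
    {Dm : Set (TPath T Lo × TPath T Y × TPath T Y)}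
    (hg : ∀ p ∈ Dm, S.Good j c (S.input p))
    (hq : ∀ p ∈ Dm, ∀ t, ‖S.input p t‖ ≤ 2 * R₀)
    {𝓡 : TPath T Lo × TPath T Y × TPath T Y → TPath T H}
    (h𝓡 : ∀ p ∈ Dm, ‖𝓡 p‖ ≤ R / 2 ∧ S.realMap ε p (𝓡 p) = 𝓡 p) (hK0 : 0 ≤ K)
    (hK : ∀ p ∈ Dm, ∀ p' ∈ Dm, ‖𝓡 p - 𝓡 p'‖ ≤ K * ‖p - p'‖)
    {Bs : Set (TPath T Lo × TPath T Y × TPath T Y)} (hBs : Bs ⊆ Dm)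
    {KB : Set (TPath T Y)} (hKB : IsCompact KB)
    (hKBg : ∀ q ∈ KB, S.Good j c q) (hKBb : ∀ q ∈ KB, ReconBound S cS cK q)
    (hKBq : ∀ q ∈ KB, ∀ t, ‖q t‖ ≤ 2 * R₀) (hBK : ∀ p ∈ Bs, S.input p ∈ KB)
    (hBh : ∀ p ∈ Bs, ‖p.2.2‖ ≤ Rh) (hBc : ∀ p ∈ Bs, ‖S.obsLow p.1‖ ≤ ε / 2) :
    ∃ θ > 0, ∃ 𝓡c : TPath T (Cx Lo) × TPath T (Cx Y) × TPath T (Cx Y) → TPath T (Cx H),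
      DifferentiableOn ℂ 𝓡c {p | ∃ p₀ ∈ Bs, ‖p - ofRTriple p₀‖ < θ} ∧
      (∀ p, (∃ p₀ ∈ Bs, ‖p - ofRTriple p₀‖ < θ) → ‖𝓡c p‖ ≤ R) ∧
      ∀ p ∈ Dm, (∃ p₀ ∈ Bs, ‖ofRTriple p - ofRTriple p₀‖ < θ) →
        𝓡c (ofRTriple p) = ofR (𝓡 p) := by
  have hR₀ : 0 < R₀ := hR.trans_le hRR
  have hδ := hC.pos
  have hLG := hC.nonneg
  have hm := hS.m_nonneg
  rcases Bs.eq_empty_or_nonempty with rfl | ⟨pb, hpb⟩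
  · exact ⟨1, one_pos, 0, fun p hp => by simp at hp, fun p hp => by simp at hp,
      fun p _ hp => by simp at hp⟩
  have hRh : 0 ≤ Rh := (norm_nonneg _).trans (hBh pb hpb)
  set CS := 2 * cS + 1 with hCS
  set CK := 2 * cK + 1 with hCK
  have hCS0 : 0 < CS := by positivity
  have hCK0 : 0 < CK := by positivity
  -- `ρ`: radius of the ball around the real solution on which the complex map is a contraction
  obtain ⟨ρ, hρ0, hρR, hρR₀, hρδ, hρc⟩ : ∃ ρ : ℝ, 0 < ρ ∧ ρ ≤ R / 2 ∧ ρ ≤ R₀ / 8 ∧ ρ ≤ δ / 8 ∧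
      CS * (LG * (10 * ρ)) ≤ 1 / 8 := by
    refine ⟨min (R / 2) (min (R₀ / 8) (min (δ / 8) (1 / (80 * (CS * LG + 1))))), by positivity,
      min_le_left _ _, (min_le_right _ _).trans (min_le_left _ _),
      (min_le_right _ _).trans ((min_le_right _ _).trans (min_le_left _ _)), ?_⟩
    have h1 : min (R / 2) (min (R₀ / 8) (min (δ / 8) (1 / (80 * (CS * LG + 1))))) ≤
        1 / (80 * (CS * LG + 1)) :=
      (min_le_right _ _).trans ((min_le_right _ _).trans (min_le_right _ _))
    set x := min (R / 2) (min (R₀ / 8) (min (δ / 8) (1 / (80 * (CS * LG + 1)))))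
    have hx0 : 0 ≤ x := by positivity
    rw [le_div_iff₀ (by positivity)] at h1
    nlinarith [mul_nonneg hCS0.le hLG]
  -- `F0` bounds the source term, `ε'` the variation of the reconstruction operators
  set F0 := LG + m * R + Rh with hF0
  have hF00 : 0 ≤ F0 := by positivity
  obtain ⟨ε', hε'0, hε'1, hε'2⟩ : ∃ ε' : ℝ, 0 < ε' ∧ ε' ≤ 1 ∧ ε' * (F0 + ‖S.emb‖ * ε) ≤ ρ / 4 := by
    have hpos : 0 < F0 + ‖S.emb‖ * ε + 1 := by positivity
    refine ⟨min 1 (ρ / (4 * (F0 + ‖S.emb‖ * ε + 1))), by positivity, min_le_left _ _, ?_⟩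
    have h1 : min 1 (ρ / (4 * (F0 + ‖S.emb‖ * ε + 1))) ≤ ρ / (4 * (F0 + ‖S.emb‖ * ε + 1)) :=
      min_le_right _ _
    set x := min 1 (ρ / (4 * (F0 + ‖S.emb‖ * ε + 1)))
    have hx0 : 0 ≤ x := by positivity
    rw [le_div_iff₀ (by positivity)] at h1
    nlinarith
  obtain ⟨η, hη0, hη⟩ := exists_near_compact hC hS hR₀ hKB hKBg hKBb hKBq hε'0 hε'1
  set ob : TPath T (Cx Lo) →L[ℂ] Cx Wh := cxify (S.emb.comp S.obsLow) with hob
  set Q := CS * (3 * LG + 6 * LG * R + 2) + CK * ‖ob‖ with hQ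
  have hQ0 : 0 ≤ Q := by positivity
  -- `θ`: size of the neighbourhood of the data; it has to keep the input `3 θ`-close to a real one,
  -- the map almost fixing the real solution, and the truncation of the observation inactive
  obtain ⟨θ, hθ0, hθρ, hθη, hθQ, hθK, hθL⟩ : ∃ θ : ℝ, 0 < θ ∧ θ ≤ ρ ∧ 3 * θ < η ∧ Q * θ ≤ ρ / 4 ∧
      K * (3 * θ) ≤ ρ ∧ ‖S.obsLow‖ * θ ≤ ε / 2 := by
    have hc : ∀ a : ℝ, ∀ b > 0, ∀ᶠ θ in 𝓝[>] (0 : ℝ), a * θ < b := fun a b hb => by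
      refine nhdsWithin_le_nhds ?_
      have : Continuous fun θ : ℝ => a * θ := by fun_prop
      exact (this.tendsto' 0 0 (mul_zero a)).eventually (gt_mem_nhds hb)
    have h0 : ∀ᶠ θ in 𝓝[>] (0 : ℝ), θ ∈ Ioi 0 := self_mem_nhdsWithin
    have := h0.and ((hc 1 ρ hρ0).and
      ((hc 3 η hη0).and ((hc Q (ρ / 4) (by positivity)).and ((hc (3 * K) ρ hρ0).and
        (hc ‖S.obsLow‖ (ε / 2) (by positivity))))))
    obtain ⟨θ, a1, a2, a3, a4, a5, a6⟩ := this.exists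
    exact ⟨θ, a1, by linarith, a3, a4.le, by linarith, a6.le⟩
  have hin : ∀ p₀ ∈ Bs, ∀ p : TPath T (Cx Lo) × TPath T (Cx Y) × TPath T (Cx Y),
      ‖p - ofRTriple p₀‖ < θ → ‖S.inputC p - ofR (S.input p₀)‖ ≤ 3 * θ := fun p₀ _ p hp => by
    rw [← inputC_ofR]
    exact (norm_inputC_sub_le hS _ _).trans (by linarith)
  have hnear : ∀ p₀ ∈ Bs, ∀ p : TPath T (Cx Lo) × TPath T (Cx Y) × TPath T (Cx Y),
      ‖p - ofRTriple p₀‖ < θ → _ := fun p₀ hp₀ p hp =>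
    hη (S.input p₀) (hBK p₀ hp₀) (S.inputC p) ((hin p₀ hp₀ p hp).trans_lt hθη)
  have hcontr : ∀ p₀ ∈ Bs, ∀ p : TPath T (Cx Lo) × TPath T (Cx Y) × TPath T (Cx Y),
      ‖p - ofRTriple p₀‖ < θ → ∀ w w' : TPath T (Cx H), ‖w - ofR (𝓡 p₀)‖ ≤ 2 * ρ →
      ‖w' - ofR (𝓡 p₀)‖ ≤ 2 * ρ →
      ‖S.complexMap G p w - S.complexMap G p w'‖ ≤ 1 / 2 * ‖w - w'‖ := by
    intro p₀ hp₀ p hp w w' hw hw'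
    refine (norm_complexMap_sub_le hC hS hR₀ (hq p₀ (hBs hp₀)) (R := R / 2) (h𝓡 p₀ (hBs hp₀)).1
      (by linarith) (hin p₀ hp₀ p hp) hw hw' (by linarith) (by linarith) (by linarith)
      (by linarith) (hnear p₀ hp₀ p hp).2.1).trans ?_
    gcongr
    have h1 : CS * (LG * (2 * (3 * θ) + 2 * (2 * ρ))) ≤ CS * (LG * (10 * ρ)) := by
      gcongr; linarith
    linarith
  -- the real solution at the base point is almost a fixed point
  have hself : ∀ p₀ ∈ Bs, ∀ p : TPath T (Cx Lo) × TPath T (Cx Y) × TPath T (Cx Y),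
      ‖p - ofRTriple p₀‖ < θ → ‖S.complexMap G p (ofR (𝓡 p₀)) - ofR (𝓡 p₀)‖ ≤ ρ / 2 := by
    intro p₀ hp₀ p hp
    have hcut : ‖S.obsLow p₀.1‖ ≤ ε := (hBc p₀ hp₀).trans (by linarith)
    have hw : ‖𝓡 p₀‖ ≤ R := (h𝓡 p₀ (hBs hp₀)).1.trans (by linarith)
    have e : S.complexMap G (ofRTriple p₀) (ofR (𝓡 p₀)) = ofR (𝓡 p₀) := by
      rw [complexMap_ofR hC hS hR₀ hRR hε (hg p₀ (hBs hp₀)) (hq p₀ (hBs hp₀)) hw hcut,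
        (h𝓡 p₀ (hBs hp₀)).2]
    have := norm_complexMap_param_sub_le hC hS hR₀ (hq p₀ (hBs hp₀)) hw hRR (hBh p₀ hp₀) hcut
      hp.le (by linarith) (by linarith) (hnear p₀ hp₀ p hp).2.1 (hnear p₀ hp₀ p hp).2.2.1
      (hnear p₀ hp₀ p hp).2.2.2.1 (hnear p₀ hp₀ p hp).2.2.2.2
    rw [e] at this
    refine this.trans ?_
    rw [← hob, ← hF0]
    have h1 : CS * (θ * (3 * LG + 6 * LG * R + 2)) + CK * (‖ob‖ * θ) = Q * θ := by rw [hQ]; ring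
    linarith
  have hex : ∀ p : TPath T (Cx Lo) × TPath T (Cx Y) × TPath T (Cx Y),
      (∃ p₀ ∈ Bs, ‖p - ofRTriple p₀‖ < θ) → ∃ w : TPath T (Cx H), ∃ p₀ ∈ Bs,
        ‖p - ofRTriple p₀‖ < θ ∧ ‖w - ofR (𝓡 p₀)‖ ≤ ρ ∧ S.complexMap G p w = w := by
    rintro p ⟨p₀, hp₀, hp⟩
    obtain ⟨w, hw, hf⟩ := exists_fixedPoint_closedBall (Φ := S.complexMap G p) (c := ofR (𝓡 p₀))
      (r := ρ) (k := 1 / 2) hρ0.le (by norm_num) (by norm_num)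
      (fun w hw w' hw' => by
        rw [mem_closedBall, dist_eq_norm] at hw hw'
        exact hcontr p₀ hp₀ p hp w w' (by linarith) (by linarith))
      ((hself p₀ hp₀ p hp).trans (by linarith))
    rw [mem_closedBall, dist_eq_norm] at hw
    exact ⟨w, p₀, hp₀, hp, hw, hf⟩
  choose! 𝓡c bs hbs hbsθ hρw hfix using hex
  -- the real solutions at two real points close to the same complex point are close
  have hclose : ∀ p₀ ∈ Dm, ∀ p₁ ∈ Dm, ‖ofRTriple p₀ - ofRTriple p₁‖ ≤ 3 * θ →
      ‖(ofR (𝓡 p₀) : TPath T (Cx H)) - ofR (𝓡 p₁)‖ ≤ ρ := fun p₀ hp₀ p₁ hp₁ h => by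
    rw [norm_ofRTriple_sub] at h
    rw [norm_ofR_sub]
    exact (hK p₀ hp₀ p₁ hp₁).trans ((mul_le_mul_of_nonneg_left h hK0).trans hθK)
  refine ⟨θ, hθ0, 𝓡c, fun p hp => ?_, fun p hp => ?_, fun p hp hp' => ?_⟩
  -- base points chosen at neighbouring data may differ, but `hclose` keeps all solutions in the
  -- ball on which the map is a contraction
  · refine (differentiableAt_fixedPoint (Φ := fun x => S.complexMap G x.1 x.2) ?_ ?_ ?_
      ?_).differentiableWithinAt
    · have h1 := hin _ (hbs p hp) p (hbsθ p hp)
      have h2 := hρw p hp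
      refine differentiableAt_complexMap hC (hnear _ (hbs p hp) p (hbsθ p hp)).1
        (mem_strip_input (hq _ (hBs (hbs p hp))) hR₀ h1 (by linarith) (by linarith)) ?_
      obtain ⟨m1, m2⟩ := mem_strip_of_near_real (δ := δ) hS (hq _ (hBs (hbs p hp)))
        ((h𝓡 _ (hBs (hbs p hp))).1.trans (by linarith)) h1 h2 (by linarith) (by linarith)
      exact fun t => m2 t (m1 t)
    · have hopen : ∀ᶠ p' in 𝓝 p, ‖p' - ofRTriple (bs p)‖ < θ := by
        have : Continuous fun p' : TPath T (Cx Lo) × TPath T (Cx Y) × TPath T (Cx Y) =>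
          ‖p' - ofRTriple (bs p)‖ := by fun_prop
        exact (this.tendsto p).eventually (gt_mem_nhds (hbsθ p hp))
      filter_upwards [hopen] with p' hp'
      exact hfix p' ⟨bs p, hbs p hp, hp'⟩
    · have hopen : ∀ᶠ p' in 𝓝 p, ‖p' - ofRTriple (bs p)‖ < θ := by
        have : Continuous fun p' : TPath T (Cx Lo) × TPath T (Cx Y) × TPath T (Cx Y) =>
          ‖p' - ofRTriple (bs p)‖ := by fun_prop
        exact (this.tendsto p).eventually (gt_mem_nhds (hbsθ p hp))
      filter_upwards [hopen] with p' hp'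
      have hex' : ∃ p₀ ∈ Bs, ‖p' - ofRTriple p₀‖ < θ := ⟨bs p, hbs p hp, hp'⟩
      refine hcontr (bs p) (hbs p hp) p' hp' _ _ ?_ ((hρw p hp).trans (by linarith))
      have h1 := hρw p' hex'
      have h2 := hclose (bs p') (hBs (hbs p' hex')) (bs p) (hBs (hbs p hp)) (by
        have a1 := hbsθ p' hex'
        have e : ofRTriple (bs p') - ofRTriple (bs p) =
            (p' - ofRTriple (bs p)) - (p' - ofRTriple (bs p')) := by abel
        rw [e]
        exact (norm_sub_le _ _).trans (by linarith))
      have e : 𝓡c p' - ofR (𝓡 (bs p)) =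
          (𝓡c p' - ofR (𝓡 (bs p'))) + (ofR (𝓡 (bs p')) - ofR (𝓡 (bs p))) := by abel
      rw [e]
      exact (norm_add_le _ _).trans (by linarith)
    · have hopen : ∀ᶠ w in 𝓝 (𝓡c p), ‖w - ofR (𝓡 (bs p))‖ < 2 * ρ := by
        have : Continuous fun w : TPath T (Cx H) => ‖w - ofR (𝓡 (bs p))‖ := by fun_prop
        exact (this.tendsto _).eventually (gt_mem_nhds ((hρw p hp).trans_lt (by linarith)))
      filter_upwards [hopen] with w hw
      exact hcontr (bs p) (hbs p hp) p (hbsθ p hp) _ _ hw.le ((hρw p hp).trans (by linarith))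
  · have h1 := hρw p hp
    have h2 := (h𝓡 _ (hBs (hbs p hp))).1
    have h3 := norm_le_norm_add_norm_sub' (𝓡c p) (ofR (𝓡 (bs p)))
    rw [norm_ofR] at h3
    linarith
  · have hb' := hbs _ hp'
    have hbθ := hbsθ _ hp'
    have hcl := hclose p hp _ (hBs hb') (by linarith)
    have hcut : ‖S.obsLow p.1‖ ≤ ε := by
      have a1 := hBc _ hb'
      have a2 : ‖p.1 - (bs (ofRTriple p)).1‖ ≤ θ := by
        rw [norm_ofRTriple_sub] at hbθ
        exact (norm_fst_le (p - bs (ofRTriple p))).trans hbθ.le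
      have a3 := S.obsLow.le_opNorm (p.1 - (bs (ofRTriple p)).1)
      have a4 := mul_le_mul_of_nonneg_left a2 (norm_nonneg S.obsLow)
      have a5 := norm_le_norm_add_norm_sub' (S.obsLow p.1) (S.obsLow (bs (ofRTriple p)).1)
      rw [← map_sub] at a5
      linarith
    -- `𝓡 p` and `𝓡c p` are two fixed points in the same ball
    have hreal : S.complexMap G (ofRTriple p) (ofR (𝓡 p)) = ofR (𝓡 p) := by
      rw [complexMap_ofR hC hS hR₀ hRR hε (hg p hp) (hq p hp)
        ((h𝓡 p hp).1.trans (by linarith)) hcut, (h𝓡 p hp).2]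
    have := hcontr _ hb' _ hbθ (𝓡c (ofRTriple p)) (ofR (𝓡 p)) ((hρw _ hp').trans (by linarith))
      (hcl.trans (by linarith))
    rw [hfix _ hp', hreal] at this
    have h0 : ‖𝓡c (ofRTriple p) - ofR (𝓡 p)‖ ≤ 0 := by
      linarith [norm_nonneg (𝓡c (ofRTriple p) - ofR (𝓡 p))]
    exact sub_eq_zero.1 (norm_le_zero_iff.1 h0)

end SplitData

/-! ### The operator on the eigenbasis -/

section Operator

variable {X : Type*} [NormedAddCommGroup X] [InnerProductSpace ℝ X]
  {A : X →ₗ.[ℝ] X} {e : HilbertBasis ℕ ℝ X} {lam : ℕ → ℝ≥0}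

theorem applyOp_of_mem {x : X} (hx : x ∈ A.domain) : applyOp A x = A ⟨x, hx⟩ := dif_pos hx

theorem inner_basis (e : HilbertBasis ℕ ℝ X) (j k : ℕ) :
    inner ℝ (e j) (e k) = if j = k then (1 : ℝ) else 0 :=
  orthonormal_iff_ite.1 e.orthonormal j k

variable [CompleteSpace X]

theorem SkewAdjointCompactResolvent.mem_adjoint_domain (hA : SkewAdjointCompactResolvent A)
    {x : X} : x ∈ A.adjoint.domain ↔ x ∈ A.domain := by
  rw [hA.adjoint_eq_neg, LinearPMap.neg_domain]

theorem SkewAdjointCompactResolvent.inner_applyOp (hA : SkewAdjointCompactResolvent A) {x y : X}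
    (hx : x ∈ A.domain) (hy : y ∈ A.domain) :
    inner ℝ (applyOp A x) y = -inner ℝ x (applyOp A y) := by
  have h := LinearPMap.adjoint_isFormalAdjoint hA.dense_domain
  rw [hA.adjoint_eq_neg] at h
  have := h ⟨x, hx⟩ ⟨y, hy⟩
  rw [LinearPMap.neg_apply, inner_neg_left] at this
  rw [applyOp_of_mem hx, applyOp_of_mem hy, ← this, neg_neg]

theorem IsOrderedEigenbasis.mem_domain (he : IsOrderedEigenbasis A e lam) (j : ℕ) :
    e j ∈ A.domain := (he.eigen j).1

theorem IsOrderedEigenbasis.applyOp_mem_domain (hA : SkewAdjointCompactResolvent A)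
    (he : IsOrderedEigenbasis A e lam) (j : ℕ) : applyOp A (e j) ∈ A.domain := by
  obtain ⟨hx, hy, -⟩ := he.eigen j
  rw [applyOp_of_mem hx]
  exact hA.mem_adjoint_domain.1 hy

theorem IsOrderedEigenbasis.applyOp_applyOp (hA : SkewAdjointCompactResolvent A)
    (he : IsOrderedEigenbasis A e lam) (j : ℕ) :
    applyOp A (applyOp A (e j)) = -((lam j : ℝ) • e j) := by
  obtain ⟨hx, hy, h⟩ := he.eigen j
  have hy' : A ⟨e j, hx⟩ ∈ A.domain := hA.mem_adjoint_domain.1 hy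
  have key : ∀ (B : X →ₗ.[ℝ] X) (_ : B = -A) (hB : A ⟨e j, hx⟩ ∈ B.domain),
      B ⟨A ⟨e j, hx⟩, hB⟩ = -A ⟨A ⟨e j, hx⟩, hy'⟩ := by
    rintro B rfl hB
    rw [LinearPMap.neg_apply]
  rw [applyOp_of_mem hx, applyOp_of_mem hy', ← h, key _ hA.adjoint_eq_neg, neg_neg]

theorem IsOrderedEigenbasis.inner_applyOp_applyOp (hA : SkewAdjointCompactResolvent A)
    (he : IsOrderedEigenbasis A e lam) (j k : ℕ) :
    inner ℝ (applyOp A (e j)) (applyOp A (e k)) = if j = k then (lam j : ℝ) else 0 := by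
  rw [hA.inner_applyOp (he.mem_domain j) (he.applyOp_mem_domain hA k), he.applyOp_applyOp hA,
    inner_neg_right, neg_neg, inner_smul_right, inner_basis]
  split_ifs with h
  · rw [h, mul_one]
  · rw [mul_zero]

theorem IsOrderedEigenbasis.inner_applyOp_comm (hA : SkewAdjointCompactResolvent A)
    (he : IsOrderedEigenbasis A e lam) (j k : ℕ) :
    inner ℝ (e k) (applyOp A (e j)) = -inner ℝ (e j) (applyOp A (e k)) := by
  rw [real_inner_comm, hA.inner_applyOp (he.mem_domain j) (he.mem_domain k)]

/-- `A` maps each eigenspace of `A*A` into itself. -/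
theorem IsOrderedEigenbasis.inner_applyOp_eq_zero (hA : SkewAdjointCompactResolvent A)
    (he : IsOrderedEigenbasis A e lam) {j k : ℕ} (h : lam k ≠ lam j) :
    inner ℝ (e k) (applyOp A (e j)) = 0 := by
  have h1 : inner ℝ (applyOp A (applyOp A (e k))) (applyOp A (e j)) =
      -inner ℝ (applyOp A (e k)) (applyOp A (applyOp A (e j))) :=
    hA.inner_applyOp (he.applyOp_mem_domain hA k) (he.applyOp_mem_domain hA j)
  have h2 : inner ℝ (applyOp A (e k)) (e j) = -inner ℝ (e k) (applyOp A (e j)) :=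
    hA.inner_applyOp (he.mem_domain k) (he.mem_domain j)
  rw [he.applyOp_applyOp hA, he.applyOp_applyOp hA, inner_neg_left, inner_neg_right,
    real_inner_smul_left, real_inner_smul_right, h2] at h1
  have h3 : ((lam k : ℝ) - lam j) * inner ℝ (e k) (applyOp A (e j)) = 0 := by linarith
  refine (mul_eq_zero.1 h3).resolve_left fun h4 => h ?_
  exact NNReal.coe_injective (sub_eq_zero.1 h4)

/-- The image `e^{tA} e_j` of a basis vector under the group. -/
def groupVec (A : X →ₗ.[ℝ] X) (e : HilbertBasis ℕ ℝ X) (lam : ℕ → ℝ≥0) (t : ℝ) (j : ℕ) : X :=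
  Real.cos (t * √(lam j : ℝ)) • e j +
    (t * Real.sinc (t * √(lam j : ℝ))) • applyOp A (e j)

theorem inner_groupVec (hA : SkewAdjointCompactResolvent A)
    (he : IsOrderedEigenbasis A e lam) (t : ℝ) (j k : ℕ) :
    inner ℝ (groupVec A e lam t j) (groupVec A e lam t k) = if j = k then (1 : ℝ) else 0 := by
  have hc : inner ℝ (applyOp A (e j)) (e k) = inner ℝ (e k) (applyOp A (e j)) :=
    real_inner_comm _ _
  simp only [groupVec, inner_add_left, inner_add_right, real_inner_smul_left,
    real_inner_smul_right, inner_basis, he.inner_applyOp_applyOp hA, hc]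
  by_cases h : lam k = lam j
  · rw [he.inner_applyOp_comm hA j k, h]
    split_ifs with hjk
    · set s := √(lam j : ℝ) with hs
      have h1 : (lam j : ℝ) = s ^ 2 := (Real.sq_sqrt (NNReal.coe_nonneg _)).symm
      have h2 : t * s * Real.sinc (t * s) = Real.sin (t * s) := by
        by_cases h0 : t * s = 0
        · rw [h0]; simp
        · rw [Real.sinc_of_ne_zero h0, mul_div_cancel₀ _ h0]
      have h3 := Real.sin_sq_add_cos_sq (t * s)
      rw [← h2] at h3
      rw [h1]
      linarith
    · ring
  · have hjk : j ≠ k := fun hh => h (by rw [hh])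
    rw [he.inner_applyOp_eq_zero hA h, he.inner_applyOp_eq_zero hA (Ne.symm h), if_neg hjk,
      if_neg hjk]
    ring

theorem inner_groupVec_eq_zero (hA : SkewAdjointCompactResolvent A)
    (he : IsOrderedEigenbasis A e lam) (t : ℝ) {j k : ℕ} (h : lam k ≠ lam j) :
    inner ℝ (e k) (groupVec A e lam t j) = 0 := by
  have hjk : k ≠ j := fun hh => h (by rw [hh])
  rw [groupVec, inner_add_right, real_inner_smul_right, real_inner_smul_right, inner_basis,
    he.inner_applyOp_eq_zero hA h, if_neg hjk]
  ring

/-- The eigenvalues are unbounded, since the resolvent is compact. -/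
theorem exists_lt_lam (hA : SkewAdjointCompactResolvent A)
    (he : IsOrderedEigenbasis A e lam) (M : ℝ) : ∃ j, M < lam j := by
  by_contra! hM
  obtain ⟨μ, K, hK, hres⟩ := hA.compact_resolvent
  have h1 : ∀ j, e j = ((lam j : ℝ) - μ) • K (e j) := fun j => by
    rw [← map_smul]
    refine (hres _ _).1 ?_
    have := he.eigen j
    rwa [← add_smul, sub_add_cancel]
  obtain ⟨s, hs, hKs⟩ := hK.image_closedBall_subset_compact 1
  have hmem : ∀ j, K (e j) ∈ s := fun j => hKs ⟨e j, by simp [e.orthonormal.1 j], rfl⟩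
  obtain ⟨a, -, φ, hφ, hlim⟩ := hs.tendsto_subseq hmem
  set N := |M| + |μ| with hN
  have hN0 : 0 ≤ N := by positivity
  have hb : ∀ j, |(lam j : ℝ) - μ| ≤ N := fun j => by
    refine (abs_sub _ _).trans ?_
    rw [abs_of_nonneg (NNReal.coe_nonneg _)]
    exact add_le_add ((hM j).trans (le_abs_self _)) le_rfl
  -- distinct vectors `K e_j` are orthogonal, so they stay apart
  have hsep : ∀ j k, j ≠ k → 1 ≤ N * ‖K (e j) - K (e k)‖ := fun j k hjk => by
    have hj : (lam j : ℝ) - μ ≠ 0 := fun h => by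
      have := h1 j
      rw [h, zero_smul] at this
      have h2 := e.orthonormal.1 j
      rw [this, norm_zero] at h2
      exact zero_ne_one h2
    have hk : (lam k : ℝ) - μ ≠ 0 := fun h => by
      have := h1 k
      rw [h, zero_smul] at this
      have h2 := e.orthonormal.1 k
      rw [this, norm_zero] at h2
      exact zero_ne_one h2
    have hKk : K (e k) = ((lam k : ℝ) - μ)⁻¹ • e k := by
      conv_rhs => rw [h1 k]
      rw [inv_smul_smul₀ hk]
    have h2 : inner ℝ (e j) (((lam j : ℝ) - μ) • (K (e j) - K (e k))) = 1 := by
      rw [smul_sub, ← h1 j, inner_sub_right, inner_basis, if_pos rfl, hKk, real_inner_smul_right,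
        real_inner_smul_right, inner_basis, if_neg hjk]
      ring
    have h3 := real_inner_le_norm (e j) (((lam j : ℝ) - μ) • (K (e j) - K (e k)))
    rw [h2, e.orthonormal.1 j, one_mul, norm_smul, Real.norm_eq_abs] at h3
    exact h3.trans (mul_le_mul_of_nonneg_right (hb j) (norm_nonneg _))
  have hlim' : Tendsto (fun n => K (e (φ (n + 1))) - K (e (φ n))) atTop (𝓝 (a - a)) :=
    (hlim.comp (tendsto_add_atTop_nat 1)).sub hlim
  rw [sub_self] at hlim'
  have hlim2 : Tendsto (fun n => N * ‖K (e (φ (n + 1))) - K (e (φ n))‖) atTop (𝓝 (N * ‖(0 : X)‖)) :=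
    hlim'.norm.const_mul N
  rw [norm_zero, mul_zero] at hlim2
  have := ge_of_tendsto' hlim2 fun n => hsep (φ (n + 1)) (φ n) (hφ (Nat.lt_succ_self n)).ne'
  linarith

/-- There are arbitrarily high frequencies at which the spectrum has a gap. -/
theorem exists_gap (hA : SkewAdjointCompactResolvent A)
    (he : IsOrderedEigenbasis A e lam) (N : ℕ) :
    ∃ n, N ≤ n ∧ ∀ j < n, ∀ k, n ≤ k → lam j < lam k := by
  obtain ⟨j₀, hj₀⟩ := exists_lt_lam hA he (lam N)
  have hex : ∃ j, lam N < lam j := ⟨j₀, NNReal.coe_lt_coe.1 hj₀⟩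
  classical
  refine ⟨Nat.find hex, ?_, fun j hj k hk => ?_⟩
  · by_contra! h
    exact absurd (Nat.find_spec hex) (not_lt.2 (he.monotone h.le))
  · exact (not_lt.1 (Nat.find_min hex hj)).trans_lt ((Nat.find_spec hex).trans_le (he.monotone hk))

end Operator

/-! ### The group and the spectral projections on the scale -/

section ScaleGroup

variable {X : Type*} [NormedAddCommGroup X] [InnerProductSpace ℝ X]
  {e : HilbertBasis ℕ ℝ X} {lam : ℕ → ℝ≥0} {σ : ℝ≥0}

namespace Scale

theorem weight_pos (j : ℕ) : 0 < weight lam σ j := one_pos.trans_le (one_le_weight lam σ j)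

theorem coord_apply (x : Scale e lam σ) (j : ℕ) : coord j x = e.repr (incl x) j :=
  (e.repr_apply_apply _ _).symm

theorem coords_eq (x : Scale e lam σ) (j : ℕ) : coords x j = weight lam σ j * coord j x := by
  rw [coord_apply, coords_apply]

theorem ext_coord {x y : Scale e lam σ} (h : ∀ j, coord j x = coord j y) : x = y :=
  coords_injective (by ext j; rw [coords_eq, coords_eq, h])

theorem norm_le_of_coord {x y : Scale e lam σ} (h : ∀ j, ‖coord j x‖ ≤ ‖coord j y‖) :
    ‖x‖ ≤ ‖y‖ := by
  rw [← norm_coords, ← norm_coords]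
  refine lp.norm_mono (by norm_num) fun j => ?_
  rw [coords_eq, coords_eq, norm_mul, norm_mul]
  gcongr
  exact h j

theorem norm_incl_le (x : Scale e lam σ) : ‖incl x‖ ≤ ‖x‖ := by
  rw [← e.repr.norm_map, ← norm_coords]
  refine lp.norm_mono (by norm_num) fun j => ?_
  rw [coords_apply, norm_mul]
  exact le_mul_of_one_le_left (norm_nonneg _) ((one_le_weight lam σ j).trans (le_abs_self _))

variable (e lam σ) in
/-- The embedding of the scale, as a continuous linear map. -/
def inclL : Scale e lam σ →L[ℝ] X :=
  LinearMap.mkContinuous incl 1 fun x => by rw [one_mul]; exact norm_incl_le x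

theorem inclL_apply (x : Scale e lam σ) : inclL e lam σ x = incl x := rfl

theorem coord_basisVec (j k : ℕ) : coord k (basisVec e lam σ j) = if k = j then (1 : ℝ) else 0 :=
  inner_basis e k j

theorem coord_lowProj (n k : ℕ) (x : Scale e lam σ) :
    coord k (lowProj e lam σ n x) = if k < n then coord k x else 0 := by
  simp only [lowProj, sum_apply, ContinuousLinearMap.smulRight_apply, map_sum,
    map_smul, coord_basisVec, smul_eq_mul, mul_ite, mul_one, mul_zero]
  rw [Finset.sum_ite_eq]
  simp

theorem coord_highProj (n k : ℕ) (x : Scale e lam σ) :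
    coord k (highProj e lam σ n x) = if k < n then 0 else coord k x := by
  rw [highProj, sub_apply, map_sub, coord_lowProj, ContinuousLinearMap.id_apply]
  split_ifs <;> simp

theorem norm_lowProj_apply_le (n : ℕ) (x : Scale e lam σ) : ‖lowProj e lam σ n x‖ ≤ ‖x‖ :=
  norm_le_of_coord fun j => by rw [coord_lowProj]; split_ifs <;> simp

theorem norm_highProj_apply_le (n : ℕ) (x : Scale e lam σ) : ‖highProj e lam σ n x‖ ≤ ‖x‖ :=
  norm_le_of_coord fun j => by rw [coord_highProj]; split_ifs <;> simp

theorem highProj_highProj (n : ℕ) (x : Scale e lam σ) :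
    highProj e lam σ n (highProj e lam σ n x) = highProj e lam σ n x :=
  ext_coord fun j => by simp only [coord_highProj]; split_ifs <;> rfl

theorem lowProj_add_highProj (n : ℕ) (x : Scale e lam σ) :
    lowProj e lam σ n x + highProj e lam σ n x = x := by
  rw [highProj, sub_apply, ContinuousLinearMap.id_apply]; abel

theorem highProj_coe (n : ℕ) (x : High e lam σ n) : highProj e lam σ n x = x := by
  obtain ⟨x, y, rfl⟩ := x
  exact highProj_highProj n y

instance (n : ℕ) : CompleteSpace (High e lam σ n) := by
  have : IsClosed ((High e lam σ n : Submodule ℝ (Scale e lam σ)) : Set (Scale e lam σ)) := by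
    have h : ((High e lam σ n : Submodule ℝ (Scale e lam σ)) : Set (Scale e lam σ)) =
        {x | highProj e lam σ n x = x} := by
      ext x
      exact ⟨fun hx => highProj_coe n ⟨x, hx⟩, fun hx => ⟨x, hx⟩⟩
    rw [h]
    exact isClosed_eq (highProj e lam σ n).continuous continuous_id
  exact this.completeSpace_coe

/-- If the coordinates of `x` and `y` only involve the frequencies of weight `a` and `b`, then
their inner products in the scale and in the pivot space are proportional. -/
theorem inner_eq_of_weight {x y : Scale e lam σ} {a b : ℝ}
    (hx : ∀ k, coord k x ≠ 0 → weight lam σ k = a) (hy : ∀ k, coord k y ≠ 0 → weight lam σ k = b) :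
    inner ℝ x y = a * b * inner ℝ (incl x) (incl y) := by
  have h : ∀ (z : Scale e lam σ) (c : ℝ), (∀ k, coord k z ≠ 0 → weight lam σ k = c) →
      coords z = c • e.repr (incl z) := fun z c hz => by
    ext k
    rw [lp.coeFn_smul, Pi.smul_apply, smul_eq_mul, coords_apply, ← coord_apply]
    by_cases h0 : coord k z = 0
    · rw [h0, mul_zero, mul_zero]
    · rw [hz k h0]
  change inner ℝ (coords x) (coords y) = _
  rw [h x a hx, h y b hy, real_inner_smul_left, real_inner_smul_right,
    LinearIsometryEquiv.inner_map_map]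
  ring

theorem hasSum_basisVec (x : Scale e lam σ) :
    HasSum (fun j => coord j x • basisVec e lam σ j) x := by
  have hi : Isometry (coords : Scale e lam σ → lp (fun _ : ℕ => ℝ) 2) :=
    AddMonoidHomClass.isometry_of_norm coords norm_coords
  refine (hi.isUniformInducing.isInducing.hasSum_iff _ _).1 ?_
  have h := lp.hasSum_single (p := 2) (by norm_num) (coords x)
  convert h using 2 with j
  ext k
  rw [Function.comp_apply, map_smul, lp.coeFn_smul, Pi.smul_apply, coords_eq, coord_basisVec]
  by_cases hk : k = j
  · subst hk
    simp [coords_eq, mul_comm]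
  · simp [hk]

theorem tendsto_lowProj (x : Scale e lam σ) :
    Tendsto (fun n => lowProj e lam σ n x) atTop (𝓝 x) := by
  refine (hasSum_basisVec x).tendsto_sum_nat.congr fun n => ?_
  simp [lowProj, sum_apply]

/-- The high-frequency projections tend to zero uniformly on compact sets. -/
theorem eventually_norm_highProj_lt {K : Set (Scale e lam σ)} (hK : IsCompact K)
    {ε : ℝ} (hε : 0 < ε) : ∀ᶠ n in atTop, ∀ x ∈ K, ‖highProj e lam σ n x‖ < ε := by
  obtain ⟨s, -, hfin, hs⟩ := hK.finite_cover_balls (half_pos hε)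
  have h1 : ∀ y : Scale e lam σ, ∀ᶠ n in atTop, ‖highProj e lam σ n y‖ < ε / 2 := fun y => by
    filter_upwards [Metric.tendsto_nhds.1 (tendsto_lowProj y) _ (half_pos hε)] with n hn
    rw [highProj, sub_apply, ContinuousLinearMap.id_apply]
    rwa [dist_comm, dist_eq_norm] at hn
  filter_upwards [hfin.eventually_all.2 fun y _ => h1 y] with n hn x hx
  obtain ⟨y, hy, hxy⟩ := mem_iUnion₂.1 (hs hx)
  rw [mem_ball, dist_eq_norm] at hxy
  have e1 : highProj e lam σ n x = highProj e lam σ n (x - y) + highProj e lam σ n y := by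
    rw [← map_add, sub_add_cancel]
  rw [e1]
  have h3 := norm_highProj_apply_le n (x - y)
  refine (norm_add_le _ _).trans_lt ?_
  linarith [hn y hy]

end Scale

end ScaleGroup

section ScaleGroupConstruction

variable {X : Type*} [NormedAddCommGroup X] [InnerProductSpace ℝ X] [CompleteSpace X]
  {A : X →ₗ.[ℝ] X} {e : HilbertBasis ℕ ℝ X} {lam : ℕ → ℝ≥0} {σ : ℝ≥0}
  (hA : SkewAdjointCompactResolvent A) (he : IsOrderedEigenbasis A e lam)

theorem applyOp_mem_scaleSubmodule (hA : SkewAdjointCompactResolvent A)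
    (he : IsOrderedEigenbasis A e lam) (σ : ℝ≥0) (j : ℕ) :
    applyOp A (e j) ∈ scaleSubmodule e lam σ := by
  change Memℓp (fun k => weight lam σ k * e.repr (applyOp A (e j)) k) 2
  have h := (lp.memℓp (e.repr (applyOp A (e j)))).const_smul (weight lam σ j)
  refine (congrArg (fun g : ℕ → ℝ => Memℓp g 2) ?_).mp h
  funext k
  rw [Pi.smul_apply, smul_eq_mul]
  by_cases hk : lam k = lam j
  · rw [weight, weight, hk]
  · rw [e.repr_apply_apply, he.inner_applyOp_eq_zero hA hk, mul_zero, mul_zero]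

namespace Scale

/-- `A e_j`, as an element of the scale. -/
def opVec (σ : ℝ≥0) (j : ℕ) : Scale e lam σ :=
  ⟨applyOp A (e j), applyOp_mem_scaleSubmodule hA he σ j⟩

/-- `e^{tA} e_j`, as an element of the scale. -/
def scaleVec (σ : ℝ≥0) (t : ℝ) (j : ℕ) : Scale e lam σ :=
  Real.cos (t * √(lam j : ℝ)) • basisVec e lam σ j +
    (t * Real.sinc (t * √(lam j : ℝ))) • opVec hA he σ j

theorem incl_scaleVec (t : ℝ) (j : ℕ) : incl (scaleVec hA he σ t j) = groupVec A e lam t j := rfl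

theorem coord_scaleVec_eq_zero (t : ℝ) {j k : ℕ} (h : lam k ≠ lam j) :
    coord k (scaleVec hA he σ t j) = 0 :=
  inner_groupVec_eq_zero hA he t h

theorem orthonormal_scaleVec (t : ℝ) :
    Orthonormal ℝ fun j => (weight lam σ j)⁻¹ • scaleVec hA he σ t j := by
  have hw : ∀ j k, coord k (scaleVec hA he σ t j) ≠ 0 → weight lam σ k = weight lam σ j :=
    fun j k h => by
      have : lam k = lam j := not_not.1 fun h' => h (coord_scaleVec_eq_zero hA he t h')
      rw [weight, weight, this]
  rw [orthonormal_iff_ite]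
  intro j k
  have hj := (weight_pos (lam := lam) (σ := σ) j).ne'
  rw [real_inner_smul_left, real_inner_smul_right, inner_eq_of_weight (hw j) (hw k), incl_scaleVec,
    incl_scaleVec, inner_groupVec hA he]
  split_ifs with h
  · rw [← h]; field_simp
  · ring

/-- The group `e^{tA}` on the scale: it maps the orthonormal basis of the normalized `e_j` to an
orthonormal family. -/
def scaleGroup (σ : ℝ≥0) (t : ℝ) : Scale e lam σ →L[ℝ] Scale e lam σ :=
  (orthonormal_scaleVec hA he (σ := σ) t).orthogonalFamily.linearIsometry.toContinuousLinearMap.comp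
    (LinearMap.mkContinuous coords 1 fun x => by rw [norm_coords, one_mul])

theorem norm_scaleGroup_apply (t : ℝ) (x : Scale e lam σ) : ‖scaleGroup hA he σ t x‖ = ‖x‖ :=
  ((orthonormal_scaleVec hA he (σ := σ) t).orthogonalFamily.linearIsometry.norm_map _).trans
    (norm_coords x)

theorem hasSum_scaleGroup (t : ℝ) (x : Scale e lam σ) :
    HasSum (fun j => coord j x • scaleVec hA he σ t j) (scaleGroup hA he σ t x) := by
  have h :=
    (orthonormal_scaleVec hA he (σ := σ) t).orthogonalFamily.hasSum_linearIsometry (coords x)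
  convert h using 2 with j
  swap
  · rfl
  rw [LinearIsometry.toSpanSingleton_apply, coords_eq, smul_smul, mul_right_comm,
    mul_inv_cancel₀ (weight_pos j).ne', one_mul]

theorem incl_scaleGroup (t : ℝ) (x : Scale e lam σ) :
    incl (scaleGroup hA he σ t x) = expGroup A e lam t (incl x) := by
  have h := (hasSum_scaleGroup hA he t x).mapL (inclL e lam σ)
  rw [← inclL_apply, ← h.tsum_eq, expGroup]
  refine tsum_congr fun j => ?_
  rw [map_smul, inclL_apply, incl_scaleVec, coord_apply, groupVec]

theorem scaleGroup_zero (x : Scale e lam σ) : scaleGroup hA he σ 0 x = x := by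
  apply incl_injective
  rw [incl_scaleGroup, expGroup]
  simpa using (e.hasSum_repr (incl x)).tsum_eq

theorem scaleGroup_basisVec (t : ℝ) (j : ℕ) :
    scaleGroup hA he σ t (basisVec e lam σ j) = scaleVec hA he σ t j := by
  refine (hasSum_scaleGroup hA he t (basisVec e lam σ j)).unique ?_
  have h := hasSum_single (f := fun k => coord k (basisVec e lam σ j) • scaleVec hA he σ t k) j
    fun k hk => by rw [coord_basisVec, if_neg hk, zero_smul]
  simpa [coord_basisVec] using h

theorem continuous_scaleGroup_lowProj (n : ℕ) (x : Scale e lam σ) :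
    Continuous fun t => scaleGroup hA he σ t (lowProj e lam σ n x) := by
  simp only [lowProj, sum_apply, ContinuousLinearMap.smulRight_apply, map_sum, map_smul,
    scaleGroup_basisVec, scaleVec]
  have := Real.continuous_sinc
  fun_prop

theorem continuous_scaleGroup_left (x : Scale e lam σ) :
    Continuous fun t => scaleGroup hA he σ t x := by
  refine TendstoUniformly.continuous (F := fun n t => scaleGroup hA he σ t (lowProj e lam σ n x))
    (p := atTop) ?_ (Frequently.of_forall fun n => continuous_scaleGroup_lowProj hA he n x)
  rw [Metric.tendstoUniformly_iff]
  intro ε hε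
  filter_upwards [Metric.tendsto_nhds.1 (tendsto_lowProj x) ε hε] with n hn t
  rwa [dist_eq_norm, ← map_sub, norm_scaleGroup_apply, ← dist_eq_norm, dist_comm]

theorem continuous_scaleGroup :
    Continuous fun p : ℝ × Scale e lam σ => scaleGroup hA he σ p.1 p.2 := by
  refine continuous_iff_continuousAt.2 fun ⟨t₀, x₀⟩ => ?_
  rw [ContinuousAt, tendsto_iff_norm_sub_tendsto_zero]
  have h1 : Tendsto (fun p : ℝ × Scale e lam σ =>
      ‖p.2 - x₀‖ + ‖scaleGroup hA he σ p.1 x₀ - scaleGroup hA he σ t₀ x₀‖) (𝓝 (t₀, x₀))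
      (𝓝 (‖x₀ - x₀‖ + ‖scaleGroup hA he σ t₀ x₀ - scaleGroup hA he σ t₀ x₀‖)) := by
    have := continuous_scaleGroup_left hA he x₀
    have h : Continuous fun p : ℝ × Scale e lam σ =>
      ‖p.2 - x₀‖ + ‖scaleGroup hA he σ p.1 x₀ - scaleGroup hA he σ t₀ x₀‖ := by fun_prop
    exact h.tendsto (t₀, x₀)
  simp only [sub_self, norm_zero, add_zero] at h1
  refine squeeze_zero (fun _ => norm_nonneg _) (fun p => ?_) h1
  rw [← norm_scaleGroup_apply hA he p.1 (p.2 - x₀), map_sub]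
  exact norm_sub_le_norm_sub_add_norm_sub _ _ _

/-- The group commutes with the spectral projection at a gap of the spectrum. -/
theorem highProj_scaleGroup {n : ℕ} (hgap : ∀ j < n, ∀ k, n ≤ k → lam j < lam k) (t : ℝ)
    (x : Scale e lam σ) :
    highProj e lam σ n (scaleGroup hA he σ t x) = scaleGroup hA he σ t (highProj e lam σ n x) := by
  have h1 := (hasSum_scaleGroup hA he t x).mapL (highProj e lam σ n)
  have h2 := hasSum_scaleGroup hA he t (highProj e lam σ n x)
  refine h1.unique ?_
  convert h2 using 2 with j
  rw [map_smul, coord_highProj]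
  split_ifs with hj
  · rw [zero_smul]
    have : highProj e lam σ n (scaleVec hA he σ t j) = 0 := ext_coord fun k => by
      rw [coord_highProj, map_zero]
      split_ifs with hk
      · rfl
      · exact coord_scaleVec_eq_zero hA he t (hgap j hj k (not_lt.1 hk)).ne'
    rw [this, smul_zero]
  · have : highProj e lam σ n (scaleVec hA he σ t j) = scaleVec hA he σ t j := ext_coord fun k => by
      rw [coord_highProj]
      split_ifs with hk
      · exact (coord_scaleVec_eq_zero hA he t (hgap k hk j (not_lt.1 hj)).ne).symm
      · rfl
    rw [this]

end Scale

end ScaleGroupConstruction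

/-! ### Duhamel's formula on the scale -/

section Emb

open MeasureTheory

variable {Y : Type*} [NormedAddCommGroup Y] [InnerProductSpace ℝ Y]

/-- The extension of a path on `[0, T]` to a bounded continuous function on the line, constant
outside `[0, T]`. -/
def pathExtend {T : ℝ} (hT : 0 ≤ T) : TPath T Y →ₗ[ℝ] BoundedContinuousFunction ℝ Y where
  toFun g := (BoundedContinuousFunction.mkOfCompact g).compContinuous
    ⟨projIcc 0 T hT, continuous_projIcc⟩
  map_add' _ _ := by ext; rfl
  map_smul' _ _ := by ext; rfl

theorem pathExtend_apply {T : ℝ} (hT : 0 ≤ T) (g : TPath T Y) (t : ℝ) :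
    pathExtend hT g t = g (projIcc 0 T hT t) := rfl

/-- Continuous paths on `[0, T]`, seen as elements of `L²(0, T; Y)`. -/
def pathEmb (Y : Type*) [NormedAddCommGroup Y] [InnerProductSpace ℝ Y] {T : ℝ} (hT : 0 ≤ T) :
    TPath T Y →L[ℝ] Lp Y 2 (volume.restrict (Ioc 0 T)) :=
  (BoundedContinuousFunction.toLp 2 (volume.restrict (Ioc 0 T)) ℝ).comp
    (LinearMap.mkContinuous (pathExtend hT) 1 fun g => by
      rw [one_mul]
      exact (BoundedContinuousFunction.norm_le (norm_nonneg _)).2 fun t => g.norm_coe_le_norm _)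

theorem norm_pathEmb_sq {T : ℝ} (hT : 0 ≤ T) (g : TPath T Y) :
    ‖pathEmb Y hT g‖ ^ 2 = ∫ t in (0 : ℝ)..T, ‖g (projIcc 0 T hT t)‖ ^ 2 := by
  rw [intervalIntegral.integral_of_le hT, ← real_inner_self_eq_norm_sq, L2.inner_def]
  refine integral_congr_ae ?_
  have h : (pathEmb Y hT g : ℝ → Y) =ᵐ[volume.restrict (Ioc 0 T)] pathExtend hT g :=
    BoundedContinuousFunction.coeFn_toLp 2 (volume.restrict (Ioc 0 T)) ℝ (pathExtend hT g)
  filter_upwards [h] with t ht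
  rw [ht, pathExtend_apply, real_inner_self_eq_norm_sq]

end Emb

section Duhamel

variable {X : Type*} [NormedAddCommGroup X] [InnerProductSpace ℝ X] [CompleteSpace X]
  {A : X →ₗ.[ℝ] X} {e : HilbertBasis ℕ ℝ X} {lam : ℕ → ℝ≥0} {σ : ℝ≥0}
  (hA : SkewAdjointCompactResolvent A) (he : IsOrderedEigenbasis A e lam) {T : ℝ} (hT : 0 ≤ T)

/-- The free evolution `x ↦ e^{tA} x`, as a map into paths. -/
def freePath (σ : ℝ≥0) (T : ℝ) : Scale e lam σ →L[ℝ] TPath T (Scale e lam σ) :=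
  LinearMap.mkContinuous
    { toFun := fun x => (⟨fun t => scaleGroup hA he σ t x,
        (continuous_scaleGroup_left hA he x).comp continuous_subtype_val⟩ :
          TPath T (Scale e lam σ))
      map_add' := fun x y => by
        ext1 t; exact map_add (scaleGroup hA he σ (t : ℝ)) x y
      map_smul' := fun c x => by
        ext1 t; exact map_smul (scaleGroup hA he σ (t : ℝ)) c x } 1 fun x => by
    rw [one_mul]
    exact (ContinuousMap.norm_le _ (norm_nonneg _)).2 fun t =>
      (norm_scaleGroup_apply hA he (t : ℝ) x).le

theorem freePath_apply (x : Scale e lam σ) (t : Icc (0 : ℝ) T) :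
    freePath hA he σ T x t = scaleGroup hA he σ t x := rfl

theorem continuous_duhamelIntegrand (g : TPath T (Scale e lam σ)) :
    Continuous fun p : ℝ × ℝ => scaleGroup hA he σ (p.1 - p.2) (g (projIcc 0 T hT p.2)) := by
  have h1 : Continuous fun p : ℝ × ℝ => g (projIcc 0 T hT p.2) :=
    g.continuous.comp (continuous_projIcc.comp continuous_snd)
  have h2 : Continuous fun p : ℝ × ℝ => (p.1 - p.2, g (projIcc 0 T hT p.2)) :=
    (continuous_fst.sub continuous_snd).prodMk h1
  have h3 := (continuous_scaleGroup hA he (σ := σ)).comp h2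
  exact h3

theorem continuous_duhamelIntegral (g : TPath T (Scale e lam σ)) :
    Continuous fun t : ℝ => ∫ τ in (0 : ℝ)..t, scaleGroup hA he σ (t - τ) (g (projIcc 0 T hT τ)) :=
  intervalIntegral.continuous_parametric_intervalIntegral_of_continuous
    (μ := MeasureTheory.volume) (a₀ := 0)
    (f := fun t τ => scaleGroup hA he σ (t - τ) (g (projIcc 0 T hT τ)))
    (continuous_duhamelIntegrand hA he hT g) continuous_id

theorem intervalIntegrable_duhamel (g : TPath T (Scale e lam σ)) (t a b : ℝ) :
    IntervalIntegrable (fun τ => scaleGroup hA he σ (t - τ) (g (projIcc 0 T hT τ)))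
      MeasureTheory.volume a b :=
  ((continuous_duhamelIntegrand hA he hT g).comp (Continuous.prodMk_right t)).intervalIntegrable _ _

theorem norm_duhamel_le (g : TPath T (Scale e lam σ)) {t : ℝ} (ht : 0 ≤ t) :
    ‖∫ τ in (0 : ℝ)..t, scaleGroup hA he σ (t - τ) (g (projIcc 0 T hT τ))‖ ≤
      ∫ τ in (0 : ℝ)..t, ‖g (projIcc 0 T hT τ)‖ := by
  refine (intervalIntegral.norm_integral_le_integral_norm ht).trans (le_of_eq ?_)
  simp only [norm_scaleGroup_apply]

theorem integral_norm_path_le {E : Type*} [NormedAddCommGroup E] (g : TPath T E)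
    (t : Icc (0 : ℝ) T) : ∫ τ in (0 : ℝ)..t, ‖g (projIcc 0 T hT τ)‖ ≤ T * ‖g‖ := by
  have h1 : Continuous fun τ => ‖g (projIcc 0 T hT τ)‖ :=
    (g.continuous.comp continuous_projIcc).norm
  have h2 := intervalIntegral.integral_mono_on (a := 0) (b := (t : ℝ)) t.2.1
    (h1.intervalIntegrable (μ := MeasureTheory.volume) _ _) (intervalIntegrable_const (c := ‖g‖))
    fun τ _ => g.norm_coe_le_norm _
  refine h2.trans ?_
  rw [intervalIntegral.integral_const, sub_zero, smul_eq_mul]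
  exact mul_le_mul_of_nonneg_right t.2.2 (norm_nonneg _)

/-- Duhamel's integral `g ↦ ∫₀ᵗ e^{(t-τ)A} g(τ) dτ`. -/
def duhamelPath (σ : ℝ≥0) : TPath T (Scale e lam σ) →L[ℝ] TPath T (Scale e lam σ) :=
  LinearMap.mkContinuous
    { toFun := fun g =>
        ⟨fun t => ∫ τ in (0 : ℝ)..t, scaleGroup hA he σ (t - τ) (g (projIcc 0 T hT τ)),
          (continuous_duhamelIntegral hA he hT g).comp continuous_subtype_val⟩
      map_add' := fun g h => by
        ext1 t
        simp only [ContinuousMap.coe_mk, ContinuousMap.add_apply, map_add]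
        exact intervalIntegral.integral_add (intervalIntegrable_duhamel hA he hT g t _ _)
          (intervalIntegrable_duhamel hA he hT h t _ _)
      map_smul' := fun c g => by
        ext1 t
        simp only [ContinuousMap.coe_mk, ContinuousMap.smul_apply, map_smul, RingHom.id_apply]
        exact intervalIntegral.integral_smul _ _ } T fun g => by
    refine (ContinuousMap.norm_le _ (by positivity)).2 fun t => ?_
    exact (norm_duhamel_le hA he hT g t.2.1).trans (integral_norm_path_le hT g t)

theorem duhamelPath_apply (g : TPath T (Scale e lam σ)) (t : Icc (0 : ℝ) T) :
    duhamelPath hA he hT σ g t =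
      ∫ τ in (0 : ℝ)..t, scaleGroup hA he σ (t - τ) (g (projIcc 0 T hT τ)) := rfl

theorem norm_duhamelPath_apply_le (g : TPath T (Scale e lam σ)) (t : Icc (0 : ℝ) T) :
    ‖duhamelPath hA he hT σ g t‖ ≤ ∫ τ in (0 : ℝ)..t, ‖g (projIcc 0 T hT τ)‖ :=
  norm_duhamel_le hA he hT g t.2.1

/-- Mild solutions satisfy Duhamel's formula in the scale. -/
theorem isMildSolution_iff (hT : 0 < T) (u g : TPath T (Scale e lam σ)) :
    IsMildSolution A hT u g ↔
      u = freePath hA he σ T (u ⟨0, left_mem_Icc.2 hT.le⟩) + duhamelPath hA he hT.le σ g := by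
  have key : ∀ t : Icc (0 : ℝ) T, incl ((freePath hA he σ T (u ⟨0, left_mem_Icc.2 hT.le⟩) +
      duhamelPath hA he hT.le σ g) t) =
      expGroup A e lam t (incl (u ⟨0, left_mem_Icc.2 hT.le⟩)) +
      ∫ τ in (0 : ℝ)..t, expGroup A e lam (t - τ) (incl (g (projIcc 0 T hT.le τ))) := fun t => by
    rw [ContinuousMap.add_apply, map_add, freePath_apply, incl_scaleGroup, duhamelPath_apply,
      ← inclL_apply (∫ τ in (0 : ℝ)..t, _),
      ← ContinuousLinearMap.intervalIntegral_comp_comm _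
        (intervalIntegrable_duhamel hA he hT.le g t 0 t)]
    simp only [inclL_apply, incl_scaleGroup]
  constructor
  · intro h
    ext1 t
    exact incl_injective ((h t).trans (key t).symm)
  · intro h t
    rw [← key t, ← h]

variable {n : ℕ}

theorem pathLift_highProj_freePath (hgap : ∀ j < n, ∀ k, n ≤ k → lam j < lam k)
    (x : Scale e lam σ) :
    pathLift (Icc 0 T) (highProj e lam σ n) (freePath hA he σ T x) =
      freePath hA he σ T (highProj e lam σ n x) := by
  ext1 t
  exact highProj_scaleGroup hA he hgap t x

theorem pathLift_highProj_duhamelPath (hgap : ∀ j < n, ∀ k, n ≤ k → lam j < lam k)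
    (g : TPath T (Scale e lam σ)) :
    pathLift (Icc 0 T) (highProj e lam σ n) (duhamelPath hA he hT σ g) =
      duhamelPath hA he hT σ (pathLift (Icc 0 T) (highProj e lam σ n) g) := by
  ext1 t
  rw [duhamelPath_apply]
  change highProj e lam σ n (∫ τ in (0 : ℝ)..t, _) = _
  rw [← ContinuousLinearMap.intervalIntegral_comp_comm _
    (intervalIntegrable_duhamel hA he hT g t 0 t)]
  simp only [highProj_scaleGroup hA he hgap]
  rfl

end Duhamel

/-! ### The frequency splitting of the equation -/

section Splitting

variable {X : Type*} [NormedAddCommGroup X] [InnerProductSpace ℝ X]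
  {e : HilbertBasis ℕ ℝ X} {lam : ℕ → ℝ≥0} {σ : ℝ≥0}

variable (e lam σ) in
/-- The projection `Q_n`, as a map onto `Q_n X^σ`. -/
def highMap (n : ℕ) : Scale e lam σ →L[ℝ] High e lam σ n :=
  (highProj e lam σ n).codRestrict (High e lam σ n) fun x => ⟨x, rfl⟩

theorem norm_highMap_apply_le (n : ℕ) (x : Scale e lam σ) : ‖highMap e lam σ n x‖ ≤ ‖x‖ :=
  norm_highProj_apply_le n x

theorem norm_highMap_le (n : ℕ) : ‖highMap e lam σ n‖ ≤ 1 :=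
  ContinuousLinearMap.opNorm_le_bound _ zero_le_one fun x => by
    rw [one_mul]; exact norm_highMap_apply_le n x

variable {T : ℝ}

/-- Inclusion of paths in `Q_n X^σ` into paths in `X^σ`. -/
abbrev highIncl (n : ℕ) (w : TPath T (High e lam σ n)) : TPath T (Scale e lam σ) :=
  pathLift (Icc 0 T) (High e lam σ n).subtypeL w

theorem highIncl_injective (n : ℕ) :
    Function.Injective (highIncl n : TPath T (High e lam σ n) → TPath T (Scale e lam σ)) :=
  fun w w' h => by
    ext1 t
    exact Subtype.ext (congrArg (fun g : TPath T (Scale e lam σ) => g t) h)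

theorem highProj_highIncl (n : ℕ) (w : TPath T (High e lam σ n)) :
    pathLift (Icc 0 T) (highProj e lam σ n) (highIncl n w) = highIncl n w := by
  ext1 t
  exact highProj_coe n (w t)

variable [CompleteSpace X] {A : X →ₗ.[ℝ] X}
  (hA : SkewAdjointCompactResolvent A) (he : IsOrderedEigenbasis A e lam) (hT : 0 ≤ T)
  (n : ℕ) (f : Scale e lam σ → Scale e lam σ) (C : Scale e lam σ →L[ℝ] Scale e lam σ)

/-- The reconstruction problem for the splitting at frequency `n`. -/
def splitSystem : SplitData T (Scale e lam σ) (High e lam σ n) (Low e lam σ n)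
    (MeasureTheory.Lp (Scale e lam σ) 2 (MeasureTheory.volume.restrict (Ioc 0 T))) where
  low := (Low e lam σ n).subtypeL
  high := (High e lam σ n).subtypeL
  proj := highMap e lam σ n
  obs := C
  emb := pathEmb (Scale e lam σ) hT
  duh := (pathLift (Icc 0 T) (highMap e lam σ n)).comp
    ((duhamelPath hA he hT σ).comp (pathLift (Icc 0 T) (High e lam σ n).subtypeL))
  free := (pathLift (Icc 0 T) (highMap e lam σ n)).comp
    ((freePath hA he σ T).comp (High e lam σ n).subtypeL)
  nonlin := f

variable {n f C}

theorem highIncl_free (hgap : ∀ j < n, ∀ k, n ≤ k → lam j < lam k) (x : High e lam σ n) :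
    highIncl n ((splitSystem hA he hT n f C).free x) = freePath hA he σ T (x : Scale e lam σ) := by
  change pathLift (Icc 0 T) (highProj e lam σ n) (freePath hA he σ T (x : Scale e lam σ)) = _
  rw [pathLift_highProj_freePath hA he hgap, highProj_coe]

theorem highIncl_duh (hgap : ∀ j < n, ∀ k, n ≤ k → lam j < lam k) (g : TPath T (High e lam σ n)) :
    highIncl n ((splitSystem hA he hT n f C).duh g) = duhamelPath hA he hT σ (highIncl n g) := by
  change pathLift (Icc 0 T) (highProj e lam σ n) (duhamelPath hA he hT σ (highIncl n g)) = _
  rw [pathLift_highProj_duhamelPath hA he hT hgap, highProj_highIncl]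

theorem norm_splitSystem_duh_apply_le (g : TPath T (High e lam σ n)) (t : Icc (0 : ℝ) T) :
    ‖(splitSystem hA he hT n f C).duh g t‖ ≤ ∫ τ in (0 : ℝ)..t, ‖g (projIcc 0 T hT τ)‖ :=
  (norm_highMap_apply_le n _).trans (norm_duhamelPath_apply_le hA he hT (highIncl n g) t)

theorem norm_splitSystem_duh_le : ‖(splitSystem hA he hT n f C).duh‖ ≤ T :=
  ContinuousLinearMap.opNorm_le_bound _ hT fun g =>
    (ContinuousMap.norm_le _ (by positivity)).2 fun t =>
      (norm_splitSystem_duh_apply_le hA he hT g t).trans (integral_norm_path_le hT g t)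

theorem norm_splitSystem_free_le : ‖(splitSystem hA he hT n f C).free‖ ≤ 1 :=
  ContinuousLinearMap.opNorm_le_bound _ zero_le_one fun x =>
    (ContinuousMap.norm_le _ (by positivity)).2 fun t => by
      rw [one_mul]
      refine (norm_highMap_apply_le n _).trans ?_
      exact (norm_scaleGroup_apply hA he (t : ℝ) (x : Scale e lam σ)).le

theorem norm_splitSystem_obsHigh_le :
    ‖(splitSystem hA he hT n f C).obsHigh‖ ≤ ‖pathEmb (Scale e lam σ) hT‖ * ‖C‖ := by
  refine (ContinuousLinearMap.opNorm_comp_le _ _).trans ?_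
  refine mul_le_mul_of_nonneg_left ?_ (norm_nonneg _)
  refine (ContinuousLinearMap.opNorm_comp_le _ _).trans ?_
  have h1 : ‖pathLift (Icc 0 T) C‖ ≤ ‖C‖ := norm_pathLift_le C
  have h2 : ‖pathLift (Icc 0 T) (High e lam σ n).subtypeL‖ ≤ 1 :=
    (norm_pathLift_le _).trans (Submodule.norm_subtypeL_le _)
  exact (mul_le_mul h1 h2 (norm_nonneg (pathLift (Icc 0 T) (High e lam σ n).subtypeL))
    (norm_nonneg C)).trans (by rw [mul_one])

theorem fderiv_highNonlin (hf : Differentiable ℝ f) (x : Scale e lam σ) :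
    fderiv ℝ (splitSystem hA he hT n f C).highNonlin x = (highMap e lam σ n).comp (fderiv ℝ f x) :=
  ((highMap e lam σ n).hasFDerivAt.comp x (hf x).hasFDerivAt).fderiv

theorem splitSystem_regular {R₀ m Lf : ℝ} (hf : ContDiff ℝ 2 f) (hm : 0 ≤ m) (hLf : 0 ≤ Lf)
    (hb : ∀ x, ‖x‖ ≤ 4 * R₀ → ‖fderiv ℝ f x‖ ≤ m)
    (hl : ∀ x, ‖x‖ ≤ 4 * R₀ → ∀ y, ‖y‖ ≤ 4 * R₀ →
      ‖fderiv ℝ f x - fderiv ℝ f y‖ ≤ Lf * ‖x - y‖) :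
    (splitSystem hA he hT n f C).Regular R₀ m Lf where
  contDiff := (highMap e lam σ n).contDiff.comp hf
  norm_low := Submodule.norm_subtypeL_le _
  norm_high := Submodule.norm_subtypeL_le _
  norm_proj := norm_highMap_le n
  m_nonneg := hm
  Lf_nonneg := hLf
  norm_fderiv x hx := by
    rw [fderiv_highNonlin hA he hT (hf.differentiable (by norm_num))]
    refine (ContinuousLinearMap.opNorm_comp_le _ _).trans ?_
    exact (mul_le_of_le_one_left (norm_nonneg _) (norm_highMap_le n)).trans (hb x hx)
  lipschitz_fderiv x hx y hy := by
    rw [fderiv_highNonlin hA he hT (hf.differentiable (by norm_num)),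
      fderiv_highNonlin hA he hT (hf.differentiable (by norm_num)), ← ContinuousLinearMap.comp_sub]
    refine (ContinuousLinearMap.opNorm_comp_le _ _).trans ?_
    exact (mul_le_of_le_one_left (norm_nonneg _) (norm_highMap_le n)).trans (hl x hx y hy)

theorem splitSystem_pot_apply (hf : ContDiff ℝ 2 f) (q : TPath T (Scale e lam σ))
    (w : TPath T (High e lam σ n)) (t : Icc (0 : ℝ) T) :
    ((splitSystem hA he hT n f C).pot q w t : Scale e lam σ) =
      highProj e lam σ n (fderiv ℝ f (q t) (w t)) := by
  have hd : Differentiable ℝ f := hf.differentiable (by norm_num)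
  have h1 : Continuous (fderiv ℝ (splitSystem hA he hT n f C).highNonlin) := by
    have : ContDiff ℝ 2 (splitSystem hA he hT n f C).highNonlin :=
      (highMap e lam σ n).contDiff.comp hf
    exact this.continuous_fderiv (by norm_num)
  have h2 : (splitSystem hA he hT n f C).pot q w t =
      pathMap (fderiv ℝ (splitSystem hA he hT n f C).highNonlin) q t (w t) := rfl
  rw [h2, pathMap_apply (h1.comp q.continuous), fderiv_highNonlin hA he hT hd]
  rfl

variable {R₀ m Lf c : ℝ}

/-- The observability inequality makes the linearized equation observable, with uniform bounds. -/
theorem splitSystem_good (hT : 0 < T) (hgap : ∀ j < n, ∀ k, n ≤ k → lam j < lam k)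
    (hf : ContDiff ℝ 2 f) (hS : (splitSystem hA he hT.le n f C).Regular R₀ m Lf) (hc : 0 < c)
    {q : TPath T (Scale e lam σ)} (hq : ∀ t, ‖q t‖ ≤ 4 * R₀)
    (hobs : ∀ w : TPath T (High e lam σ n),
      IsMildSolution A hT (subPath w) (fun t => highProj e lam σ n (fderiv ℝ f (q t) (w t))) →
      ‖w ⟨0, left_mem_Icc.2 hT.le⟩‖ ^ 2 ≤
        c ^ 2 * ∫ t in (0 : ℝ)..T, ‖C (w (projIcc 0 T hT.le t))‖ ^ 2) :
    (splitSystem hA he hT.le n f C).Good (Real.exp (m * T)) c q := by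
  set S := splitSystem hA he hT.le n f C with hSdef
  have hv := isUnit_volterra hT.le (D := S.duh) (M := S.pot q) zero_le_one hS.m_nonneg
    (fun g t => by rw [one_mul]; exact norm_splitSystem_duh_apply_le hA he hT.le g t)
    (hS.norm_pot_apply_le hq)
  rw [one_mul] at hv
  have hO : ∀ x, ‖x‖ ≤ c * ‖obsOp S.duh S.free S.obsHigh (S.pot q) x‖ := fun x => by
    set w := volterraInv S.duh (S.pot q) (S.free x) with hw
    have hw1 : w = S.free x + S.duh (S.pot q w) :=
      sub_eq_iff_eq_add.1 (sub_volterraInv_apply hv.1 (S.free x))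
    have hw2 : highIncl n w = freePath hA he σ T (x : Scale e lam σ) +
        duhamelPath hA he hT.le σ (highIncl n (S.pot q w)) := by
      conv_lhs => rw [hw1]
      rw [highIncl, map_add]
      exact congrArg₂ _ (highIncl_free hA he hT.le hgap x) (highIncl_duh hA he hT.le hgap _)
    have hw0 : (w ⟨0, left_mem_Icc.2 hT.le⟩ : Scale e lam σ) = x := by
      have := congrArg (fun g : TPath T (Scale e lam σ) => g ⟨0, left_mem_Icc.2 hT.le⟩) hw2
      simp only [ContinuousMap.add_apply, freePath_apply, duhamelPath_apply, scaleGroup_zero,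
        intervalIntegral.integral_same, add_zero] at this
      exact this
    have hmild : IsMildSolution A hT (subPath w)
        (fun t => highProj e lam σ n (fderiv ℝ f (q t) (w t))) := by
      have h1 : (fun t => highProj e lam σ n (fderiv ℝ f (q t) (w t))) =
          ⇑(highIncl n (S.pot q w)) :=
        funext fun t => (splitSystem_pot_apply hA he hT.le hf q w t).symm
      rw [h1, isMildSolution_iff hA he hT]
      have h2 : subPath w ⟨0, left_mem_Icc.2 hT.le⟩ = (x : Scale e lam σ) := hw0
      rw [h2]
      exact hw2
    have h3 := hobs w hmild
    have h4 : ‖obsOp S.duh S.free S.obsHigh (S.pot q) x‖ ^ 2 =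
        ∫ t in (0 : ℝ)..T, ‖C (w (projIcc 0 T hT.le t))‖ ^ 2 :=
      norm_pathEmb_sq hT.le (pathLift (Icc 0 T) C (highIncl n w))
    rw [← h4, Subtype.ext hw0, ← mul_pow] at h3
    exact le_of_sq_le_sq h3 (by positivity)
  have hg := isUnit_gramian hc hO
  exact ⟨⟨hv.1, hg.1⟩, hv.2, hg.2⟩

theorem splitSystem_reconBound {j : ℝ} {q : TPath T (Scale e lam σ)}
    (hg : (splitSystem hA he hT n f C).Good j c q) :
    SplitData.ReconBound (splitSystem hA he hT n f C)
      (srcReconBound j 1 (‖pathEmb (Scale e lam σ) hT‖ * ‖C‖) c T)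
      (obsReconBound j 1 (‖pathEmb (Scale e lam σ) hT‖ * ‖C‖) c) q :=
  ⟨norm_srcRecon_le hg.norm_inv (norm_splitSystem_free_le hA he hT)
    (norm_splitSystem_obsHigh_le hA he hT) hg.norm_gram (norm_splitSystem_duh_le hA he hT),
  norm_obsRecon_le hg.norm_inv (norm_splitSystem_free_le hA he hT)
    (norm_splitSystem_obsHigh_le hA he hT) hg.norm_gram⟩

/-- The high-frequency part of an unobserved solution is a fixed point of the reconstruction
map. -/
theorem realMap_highPath {ε j : ℝ} (hε : 0 < ε) (hT : 0 < T)
    (hgap : ∀ j < n, ∀ k, n ≤ k → lam j < lam k) (hf : Continuous f)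
    {u h₁ h₂ : TPath T (Scale e lam σ)} (hu : SolvesObserved A hT f C u h₁ h₂)
    (hcut : ‖(splitSystem hA he hT.le n f C).obsLow (lowPath n u)‖ ≤ ε)
    (hg : (splitSystem hA he hT.le n f C).Good j c
      ((splitSystem hA he hT.le n f C).input (lowPath n u, h₁, h₂))) :
    (splitSystem hA he hT.le n f C).realMap ε (lowPath n u, h₁, h₂) (highPath n u) =
      highPath n u := by
  set S := splitSystem hA he hT.le n f C with hSdef
  set q := S.input (lowPath n u, h₁, h₂) with hq
  have hsum : q + pathLift (Icc 0 T) S.high (highPath n u) = u + h₁ := by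
    ext1 t
    have h1 : (q + pathLift (Icc 0 T) S.high (highPath n u)) t =
      lowProj e lam σ n (u t) + h₁ t + highProj e lam σ n (u t) := rfl
    rw [h1, ContinuousMap.add_apply, add_right_comm, lowProj_add_highProj]
  set N := pathMap S.highNonlin (q + pathLift (Icc 0 T) S.high (highPath n u)) with hN
  have hcN : Continuous S.highNonlin := (highMap e lam σ n).continuous.comp hf
  set g : TPath T (Scale e lam σ) := ⟨fun t => f (u t + h₁ t) + h₂ t,
    (hf.comp (u.continuous.add h₁.continuous)).add h₂.continuous⟩ with hgdef
  have hNg : N + pathLift (Icc 0 T) S.proj h₂ = pathLift (Icc 0 T) (highMap e lam σ n) g := by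
    ext1 t
    rw [hN, hsum, ContinuousMap.add_apply, pathMap_apply (hcN.comp (ContinuousMap.continuous _))]
    exact (map_add (highMap e lam σ n) (f (u t + h₁ t)) (h₂ t)).symm
  have hmild := (isMildSolution_iff hA he hT u g).1 hu.1
  set u₀ := u ⟨0, left_mem_Icc.2 hT.le⟩ with hu₀
  have heq : highPath n u = S.free (highMap e lam σ n u₀) +
      S.duh (pathLift (Icc 0 T) (highMap e lam σ n) g) := by
    apply highIncl_injective n
    have h1 : highIncl n (highPath n u) = pathLift (Icc 0 T) (highProj e lam σ n) u := rfl
    have h2 : highIncl n (S.free (highMap e lam σ n u₀) +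
        S.duh (pathLift (Icc 0 T) (highMap e lam σ n) g)) =
        freePath hA he σ T (highProj e lam σ n u₀) +
          duhamelPath hA he hT.le σ (pathLift (Icc 0 T) (highProj e lam σ n) g) := by
      rw [highIncl, map_add]
      exact congrArg₂ _ (highIncl_free hA he hT.le hgap _) (highIncl_duh hA he hT.le hgap _)
    rw [h1, h2]
    conv_lhs => rw [hmild]
    rw [map_add, pathLift_highProj_freePath hA he hgap,
      pathLift_highProj_duhamelPath hA he hT.le hgap]
  have hF : highPath n u = S.free (highMap e lam σ n u₀) + S.duh (S.pot q (highPath n u) +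
      (N - S.pot q (highPath n u) + pathLift (Icc 0 T) S.proj h₂)) := by
    have : S.pot q (highPath n u) + (N - S.pot q (highPath n u) + pathLift (Icc 0 T) S.proj h₂) =
        N + pathLift (Icc 0 T) S.proj h₂ := by abel
    rw [this, hNg]
    exact heq
  have hB : S.obsHigh (highPath n u) = -S.emb (S.obsLow (lowPath n u)) := by
    have h1 : S.obsHigh (highPath n u) =
      S.emb (pathLift (Icc 0 T) C (highIncl n (highPath n u))) := rfl
    rw [h1, ← map_neg]
    congr 1
    ext1 t
    have h2 : C (lowProj e lam σ n (u t)) + C (highProj e lam σ n (u t)) = 0 := by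
      rw [← map_add, lowProj_add_highProj, hu.2 t]
    exact eq_neg_of_add_eq_zero_right h2
  have := eq_recon hg.observable hF hB
  conv_rhs => rw [this]
  rw [SplitData.realMap, reconMap, radialCut_of_norm_le hε hcut]
  rfl

end Splitting

/-! ### Complex data -/

section Extension

open CxPair

variable {X : Type*} [NormedAddCommGroup X] [InnerProductSpace ℝ X]
  {e : HilbertBasis ℕ ℝ X} {lam : ℕ → ℝ≥0} {σ : ℝ≥0} [CompleteSpace X] {A : X →ₗ.[ℝ] X}

/-- The complexified high-frequency part of a holomorphic extension of the nonlinearity. -/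
theorem splitSystem_complexRegular (hA : SkewAdjointCompactResolvent A)
    (he : IsOrderedEigenbasis A e lam) {T : ℝ} (hT : 0 ≤ T) (n : ℕ)
    {f : Scale e lam σ → Scale e lam σ} (C : Scale e lam σ →L[ℝ] Scale e lam σ) {R₀ : ℝ}
    (hf : HolomorphicNonlinearity f R₀) :
    ∃ (G : Cx (Scale e lam σ) → Cx (High e lam σ n)) (δ LG : ℝ),
      (splitSystem hA he hT n f C).ComplexRegular G R₀ δ LG := by
  obtain ⟨δ, L, F, hδ, hreal, hdiff, -, hbound, hlip, hlipd⟩ := hf.extension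
  set P : Cx (Scale e lam σ) →L[ℂ] Cx (High e lam σ n) := cxify (highMap e lam σ n) with hP
  have hP2 : ‖P‖ ≤ 2 := (norm_cxify_le _).trans
    (by linarith [norm_highMap_le (e := e) (lam := lam) (σ := σ) n])
  have hd : ∀ z ∈ strip (Scale e lam σ) R₀ δ, DifferentiableAt ℂ F z := fun z hz =>
    (hdiff z (strip_subset_interior hz)).differentiableAt
      (isOpen_interior.mem_nhds (strip_subset_interior hz))
  have hfd : ∀ z ∈ strip (Scale e lam σ) R₀ δ, fderiv ℂ (fun z => P (F z)) z =
      P.comp (fderiv ℂ F z) := fun z hz => (P.hasFDerivAt.comp z (hd z hz).hasFDerivAt).fderiv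
  have hPL : ∀ x : ℝ, 0 ≤ x → 2 * (L * x) ≤ 2 * |L| * x := fun x hx => by
    have := mul_le_mul_of_nonneg_right (le_abs_self L) hx
    linarith
  refine ⟨fun z => P (F z), δ, 2 * |L|, hδ, by positivity, fun x hx => ?_, fun z hz => ?_,
    fun z hz => ?_, fun z hz z' hz' => ?_, fun z hz z' hz' => ?_⟩
  · rw [hreal x hx.le]
    exact cxify_ofR (highMap e lam σ n) (f x)
  · exact P.differentiableAt.comp z (hd z hz)
  · refine (P.le_opNorm _).trans ((mul_le_mul hP2 (hbound z (strip_subset_cylinder hz))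
      (norm_nonneg _) zero_le_two).trans ?_)
    linarith [le_abs_self L]
  · rw [← map_sub]
    refine (P.le_opNorm _).trans ((mul_le_mul hP2 (hlip z (strip_subset_cylinder hz) z'
      (strip_subset_cylinder hz')) (norm_nonneg _) zero_le_two).trans (hPL _ (norm_nonneg _)))
  · rw [hfd z hz, hfd z' hz', ← ContinuousLinearMap.comp_sub]
    refine (ContinuousLinearMap.opNorm_comp_le _ _).trans ((mul_le_mul hP2
      (hlipd z (strip_subset_interior hz) z' (strip_subset_interior hz')) (norm_nonneg _)
        zero_le_two).trans (hPL _ (norm_nonneg _)))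

end Extension

section Domains

open CxPair

variable {X : Type*} [NormedAddCommGroup X] [InnerProductSpace ℝ X]
  {e : HilbertBasis ℕ ℝ X} {lam : ℕ → ℝ≥0} {σ : ℝ≥0} {T : ℝ}

theorem norm_le_of_mem_pathCylinder {E : Type*} [NormedAddCommGroup E] [InnerProductSpace ℝ E]
    {η : ℝ} (hη : 0 ≤ η) {z : TPath T (Cx E)} (hz : z ∈ pathCylinder E T η η) : ‖z‖ ≤ 2 * η :=
  (ContinuousMap.norm_le _ (by positivity)).2 fun t =>
    (Cx.norm_le_add _).trans (by have := hz t; linarith [this.1, this.2])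

theorem mem_pathCylinder_of_norm_le {E : Type*} [NormedAddCommGroup E] [InnerProductSpace ℝ E]
    {R : ℝ} {z : TPath T (Cx E)} (hz : ‖z‖ ≤ R) : z ∈ pathCylinder E T R R := fun t =>
  have h := (z.norm_coe_le_norm t).trans hz
  ⟨(Cx.norm_re_le _).trans h, (Cx.norm_im_le _).trans h⟩

theorem isBounded_realDomain {n : ℕ} {R₀ R₁ : ℝ} {S : Set (Scale e lam σ)} :
    Bornology.IsBounded (realDomain n T R₀ R₁ S) :=
  Bornology.IsBounded.prod (isBounded_iff_forall_norm_le.2 ⟨R₀, fun _ h => h.1⟩)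
    (Bornology.IsBounded.prod (isBounded_iff_forall_norm_le.2 ⟨R₀, fun _ h => h.1⟩)
      (isBounded_iff_forall_norm_le.2 ⟨R₁, fun _ h => h.1⟩))

theorem isClosed_pathBall {E : Type*} [NormedAddCommGroup E] {R : ℝ} {S : Set E}
    (hS : IsClosed S) : IsClosed (pathBall T R S) := by
  refine (isClosed_le continuous_norm continuous_const).inter ?_
  have h : {y : TPath T E | ∀ t, y t ∈ S} = ⋂ t, {y : TPath T E | y t ∈ S} := by
    ext y; simp
  change IsClosed {y : TPath T E | ∀ t, y t ∈ S}
  rw [h]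
  exact isClosed_iInter fun t => hS.preimage (continuous_eval_const t)

theorem isOpen_near {E ι : Type*} [NormedAddCommGroup E] (B : Set ι) (g : ι → E) (θ : ℝ) :
    IsOpen {x : E | ∃ i ∈ B, ‖x - g i‖ < θ} := by
  have h : {x : E | ∃ i ∈ B, ‖x - g i‖ < θ} = ⋃ i ∈ B, ball (g i) θ := by
    ext x
    simp [dist_eq_norm]
  rw [h]
  exact isOpen_biUnion fun _ _ => isOpen_ball

/-- The points of the complex domain are close to real ones. -/
theorem exists_near_of_mem_complexDomain {n : ℕ} {R₀ R₁ η θ : ℝ} {S : Set (Scale e lam σ)}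
    {K : Set (TPath T (Scale e lam σ))} {v₀ : TPath T (Low e lam σ n)} (hη : 0 ≤ η)
    (hθ : 2 * η < θ)
    {p : TPath T (Cx (Low e lam σ n)) × TPath T (Cx (Scale e lam σ)) ×
      TPath T (Cx (Scale e lam σ))} (hp : p ∈ complexDomain n T R₀ R₁ η S K v₀) :
    ∃ k ∈ pathBall T R₀ S ∩ K, ∃ h ∈ pathBall T R₁ S,
      ‖p - SplitData.ofRTriple (v₀, k, h)‖ < θ := by
  obtain ⟨h1, h2, h3⟩ := hp
  obtain ⟨_, rfl, z1, hz1, e1⟩ := h1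
  obtain ⟨_, ⟨k, hk, rfl⟩, z2, hz2, e2⟩ := h2
  obtain ⟨_, ⟨h, hh, rfl⟩, z3, hz3, e3⟩ := h3
  refine ⟨k, hk, h, hh, ?_⟩
  have d1 : p.1 - Cx.ofRealPath v₀ = z1 := by
    rw [← e1]; exact add_sub_cancel_left (Cx.ofRealPath v₀) z1
  have d2 : p.2.1 - Cx.ofRealPath k = z2 := by
    rw [← e2]; exact add_sub_cancel_left (Cx.ofRealPath k) z2
  have d3 : p.2.2 - Cx.ofRealPath h = z3 := by
    rw [← e3]; exact add_sub_cancel_left (Cx.ofRealPath h) z3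
  have hle : ‖p - SplitData.ofRTriple (v₀, k, h)‖ ≤ 2 * η := by
    refine norm_prod_le_iff.2 ⟨?_, norm_prod_le_iff.2 ⟨?_, ?_⟩⟩
    · exact (congrArg norm d1).le.trans (norm_le_of_mem_pathCylinder hη hz1)
    · exact (congrArg norm d2).le.trans (norm_le_of_mem_pathCylinder hη hz2)
    · exact (congrArg norm d3).le.trans (norm_le_of_mem_pathCylinder hη hz3)
  exact hle.trans_lt hθ

end Domains

/-! ### Admissible data -/

section Assembly

open CxPair

variable {X : Type*} [NormedAddCommGroup X] [InnerProductSpace ℝ X]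
  {e : HilbertBasis ℕ ℝ X} {lam : ℕ → ℝ≥0} {σ : ℝ≥0} {T : ℝ}

/-- The admissible inputs `q = v + h₁`: paths with values in `𝒜 + 𝒜`, bounded by `2 R₀`. -/
def inputSet (T R₀ : ℝ) (S : Set (Scale e lam σ)) : Set (TPath T (Scale e lam σ)) :=
  {q | ∀ t, ‖q t‖ ≤ 2 * R₀ ∧ q t ∈ S + S}

theorem inputSet_subset {R₀ : ℝ} (hR₀ : 0 ≤ R₀) {S : Set (Scale e lam σ)} :
    inputSet T R₀ S ⊆ pathBall T (3 * R₀) (S + S) := fun q hq =>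
  ⟨(ContinuousMap.norm_le _ (by positivity)).2 fun t => (hq t).1.trans (by linarith),
    fun t => (hq t).2⟩

theorem add_mem_inputSet {R₀ : ℝ} {S : Set (Scale e lam σ)} {v h : TPath T (Scale e lam σ)}
    (hv : v ∈ pathBall T R₀ S) (hh : h ∈ pathBall T R₀ S) : v + h ∈ inputSet T R₀ S := fun t => by
  refine ⟨?_, add_mem_add (hv.2 t) (hh.2 t)⟩
  have h1 := (v.norm_coe_le_norm t).trans hv.1
  have h2 := (h.norm_coe_le_norm t).trans hh.1
  rw [ContinuousMap.add_apply]
  exact (norm_add_le _ _).trans (by linarith)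

theorem norm_lowPath_le (n : ℕ) (u : TPath T (Scale e lam σ)) : ‖lowPath n u‖ ≤ ‖u‖ :=
  (ContinuousMap.norm_le _ (norm_nonneg u)).2 fun t =>
    (norm_lowProj_apply_le n (u t)).trans (u.norm_coe_le_norm t)

theorem lowPath_mem {n : ℕ} {R₀ : ℝ} {S : Set (Scale e lam σ)}
    (hS : ∀ x ∈ S, lowProj e lam σ n x ∈ S) {u : TPath T (Scale e lam σ)}
    (hu : u ∈ pathBall T R₀ S) : lowPath n u ∈ pathBall T R₀ (Subtype.val ⁻¹' S) :=
  ⟨(norm_lowPath_le n u).trans hu.1, fun t => hS _ (hu.2 t)⟩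

theorem subPath_lowPath_mem {n : ℕ} {R₀ : ℝ} {S : Set (Scale e lam σ)}
    (hS : ∀ x ∈ S, lowProj e lam σ n x ∈ S) {u : TPath T (Scale e lam σ)}
    (hu : u ∈ pathBall T R₀ S) : pathLift (Icc 0 T) (lowProj e lam σ n) u ∈ pathBall T R₀ S :=
  ⟨(norm_lowPath_le n u).trans hu.1, fun t => hS _ (hu.2 t)⟩

variable [CompleteSpace X] {A : X →ₗ.[ℝ] X}

theorem splitSystem_input_mem {hA : SkewAdjointCompactResolvent A}
    {he : IsOrderedEigenbasis A e lam} {hT : 0 ≤ T} {n : ℕ}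
    {f : Scale e lam σ → Scale e lam σ} {C : Scale e lam σ →L[ℝ] Scale e lam σ} {R₀ R₁ : ℝ}
    {S : Set (Scale e lam σ)}
    {p : TPath T (Low e lam σ n) × TPath T (Scale e lam σ) × TPath T (Scale e lam σ)}
    (hp : p ∈ realDomain n T R₀ R₁ S) :
    (splitSystem hA he hT n f C).input p ∈ inputSet T R₀ S := by
  refine add_mem_inputSet ⟨?_, fun t => hp.1.2 t⟩ hp.2.1
  refine (norm_pathLift_apply_le _ _).trans ?_
  exact (mul_le_of_le_one_left (norm_nonneg _) (Submodule.norm_subtypeL_le _)).trans hp.1.1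

/-- The truncation of the low-frequency observation is inactive for unobserved states, whose low-
and high-frequency observations cancel. -/
theorem norm_obsLow_lowPath_le {hA : SkewAdjointCompactResolvent A}
    {he : IsOrderedEigenbasis A e lam} {hT : 0 ≤ T} {n : ℕ}
    {f : Scale e lam σ → Scale e lam σ} {C : Scale e lam σ →L[ℝ] Scale e lam σ} {ε ε₁ : ℝ}
    (hε : 0 ≤ ε) (hεC : ‖C‖ * ε₁ ≤ ε) {u : TPath T (Scale e lam σ)} (hu : ∀ t, C (u t) = 0)
    (hsmall : ∀ t, ‖highProj e lam σ n (u t)‖ ≤ ε₁) :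
    ‖(splitSystem hA he hT n f C).obsLow (lowPath n u)‖ ≤ ε := by
  refine (ContinuousMap.norm_le _ hε).2 fun t => ?_
  have h1 : (splitSystem hA he hT n f C).obsLow (lowPath n u) t = C (lowProj e lam σ n (u t)) := rfl
  have h2 : C (lowProj e lam σ n (u t)) + C (highProj e lam σ n (u t)) = 0 := by
    rw [← map_add, lowProj_add_highProj, hu t]
  rw [h1, eq_neg_of_add_eq_zero_left h2, norm_neg]
  exact (C.le_opNorm _).trans ((mul_le_mul_of_nonneg_left (hsmall t) (norm_nonneg _)).trans hεC)

/-- The sources are small at high frequencies. -/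
theorem norm_source_le {hA : SkewAdjointCompactResolvent A}
    {he : IsOrderedEigenbasis A e lam} {hT : 0 ≤ T} {n : ℕ}
    {f : Scale e lam σ → Scale e lam σ} {C : Scale e lam σ →L[ℝ] Scale e lam σ} {ε : ℝ}
    (hε : 0 ≤ ε) (hf : Continuous f) {q h : TPath T (Scale e lam σ)}
    (h1 : ∀ t, ‖highProj e lam σ n (f (q t))‖ ≤ ε) (h2 : ∀ t, ‖highProj e lam σ n (h t)‖ ≤ ε) :
    ‖pathMap (splitSystem hA he hT n f C).highNonlin q +
      pathLift (Icc 0 T) (splitSystem hA he hT n f C).proj h‖ ≤ 2 * ε := by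
  refine (ContinuousMap.norm_le _ (by positivity)).2 fun t => ?_
  have hc : Continuous (splitSystem hA he hT n f C).highNonlin :=
    (highMap e lam σ n).continuous.comp hf
  rw [ContinuousMap.add_apply, pathMap_apply (hc.comp q.continuous)]
  refine (norm_add_le _ _).trans ?_
  have h3 : ‖(splitSystem hA he hT n f C).highNonlin (q t)‖ ≤ ε := h1 t
  have h4 : ‖(pathLift (Icc 0 T) (splitSystem hA he hT n f C).proj h) t‖ ≤ ε := h2 t
  linarith

end Assembly

end

end FreqSplit

theorem mainTheorem2 {X : Type*} [NormedAddCommGroup X] [InnerProductSpace ℝ X] [CompleteSpace X]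
    [TopologicalSpace.SeparableSpace X]
    (A : X →ₗ.[ℝ] X) (hA : SkewAdjointCompactResolvent A)
    (e : HilbertBasis ℕ ℝ X) (lam : ℕ → ℝ≥0) (he : IsOrderedEigenbasis A e lam) (σ : ℝ≥0)
    (T R₀ R₁ : ℝ) (hT : 0 < T) (hR₀ : 0 < R₀) (hR₁ : 0 < R₁) (n₀ : ℕ)
    (f : Scale e lam σ → Scale e lam σ) (hf : RealNonlinearity f R₀)
    (C : Scale e lam σ →L[ℝ] Scale e lam σ)
    (𝒜 : Set (Scale e lam σ)) (h𝒜_ne : 𝒜.Nonempty) (h𝒜_comp : IsCompact 𝒜)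
    (h𝒜_stable : ∀ n, n₀ ≤ n → ∀ x ∈ 𝒜, lowProj e lam σ n x ∈ 𝒜)
    (hobs : UniformObservability A hT f C n₀ (pathBall T (3 * R₀) (𝒜 + 𝒜))) :
    ∃ n, n₀ ≤ n ∧ ∃ R : ℝ, 0 < R ∧ R < R₀ ∧
      ∃ 𝓡 : TPath T (Low e lam σ n) × TPath T (Scale e lam σ) × TPath T (Scale e lam σ) →
          TPath T (High e lam σ n),
        (∃ L : ℝ≥0, LipschitzOnWith L 𝓡 (realDomain n T R₀ R₁ 𝒜)) ∧
        Set.MapsTo 𝓡 (realDomain n T R₀ R₁ 𝒜) (pathBall T R Set.univ) ∧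
        (∀ u ∈ pathBall T R₀ 𝒜, ∀ h₁ ∈ pathBall T R₀ 𝒜, ∀ h₂ ∈ pathBall T R₁ 𝒜,
          SolvesObserved A hT f C u h₁ h₂ → highPath n u = 𝓡 (lowPath n u, h₁, h₂)) ∧
        (HolomorphicNonlinearity f R₀ →
          ∀ K : Set (TPath T (Scale e lam σ)), K.Nonempty → IsCompact K →
            (∀ y ∈ K, subPath (lowPath n y) ∈ K) →
            ∃ η η₁ : ℝ, 0 < η ∧ 0 < η₁ ∧
              ∀ u ∈ pathBall T R₀ 𝒜 ∩ K, ∀ h₁ ∈ pathBall T R₀ 𝒜 ∩ K, ∀ h₂ ∈ pathBall T R₁ 𝒜,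
                SolvesObserved A hT f C u h₁ h₂ →
                ∃ 𝓡c : TPath T (Cx (Low e lam σ n)) × TPath T (Cx (Scale e lam σ)) ×
                      TPath T (Cx (Scale e lam σ)) → TPath T (Cx (High e lam σ n)),
                  HolomorphicNear 𝓡c (complexDomain n T R₀ R₁ η 𝒜 K (lowPath n u)) ∧
                  Set.MapsTo 𝓡c (complexDomain n T R₀ R₁ η 𝒜 K (lowPath n u))
                    (pathCylinder (High e lam σ n) T R η₁) ∧
                  ∀ p ∈ realDomain n T R₀ R₁ 𝒜,
                    (Cx.ofRealPath p.1, Cx.ofRealPath p.2.1, Cx.ofRealPath p.2.2) ∈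
                        complexDomain n T R₀ R₁ η 𝒜 K (lowPath n u) →
                      𝓡c (Cx.ofRealPath p.1, Cx.ofRealPath p.2.1, Cx.ofRealPath p.2.2) =
                        Cx.ofRealPath (𝓡 p)) := by
  obtain ⟨c, hc, hobs⟩ := hobs
  obtain ⟨m', hm'⟩ := hf.fderiv_bounded
  obtain ⟨Lf, hLf⟩ := hf.fderiv_lipschitz
  have hm : ∀ x, ‖x‖ ≤ 4 * R₀ → ‖fderiv ℝ f x‖ ≤ |m'| := fun x hx =>
    (hm' x hx).trans (le_abs_self _)
  have hLf' : ∀ x, ‖x‖ ≤ 4 * R₀ → ∀ y, ‖y‖ ≤ 4 * R₀ →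
      ‖fderiv ℝ f x - fderiv ℝ f y‖ ≤ Lf * ‖x - y‖ := fun x hx y hy => by
    have := hLf.dist_le_mul x (by simpa using hx) y (by simpa using hy)
    rwa [dist_eq_norm, dist_eq_norm] at this
  have hfc : Continuous f := hf.contDiff.continuous
  -- bounds for the reconstruction operators, uniform in the splitting frequency
  set b := ‖pathEmb (Scale e lam σ) hT.le‖ with hb
  set j := Real.exp (|m'| * T) with hj
  have hj0 : 0 ≤ j := (Real.exp_pos _).le
  set cS := srcReconBound j 1 (b * ‖C‖) c T with hcS
  set cK := obsReconBound j 1 (b * ‖C‖) c with hcK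
  have hcK0 : 0 ≤ cK := by rw [hcK, obsReconBound]; positivity
  have hcS0 : 0 ≤ cS := by
    rw [hcS, srcReconBound]
    exact add_nonneg (by positivity) (mul_nonneg hcK0 (by positivity))
  -- the radius `R` makes the reconstruction map a contraction
  obtain ⟨R, hR, hRR, hcon⟩ : ∃ R : ℝ, 0 < R ∧ R < R₀ ∧ (2 * cS + 1) * (Lf * R) ≤ 1 / 16 := by
    have hpos : 0 < 16 * ((2 * cS + 1) * Lf + 1) := by positivity
    refine ⟨min (R₀ / 2) (1 / (16 * ((2 * cS + 1) * Lf + 1))), by positivity,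
      (min_le_left _ _).trans_lt (by linarith), ?_⟩
    have h1 := min_le_right (R₀ / 2) (1 / (16 * ((2 * cS + 1) * Lf + 1)))
    have h0 : 0 ≤ min (R₀ / 2) (1 / (16 * ((2 * cS + 1) * Lf + 1))) := by positivity
    set r := min (R₀ / 2) (1 / (16 * ((2 * cS + 1) * Lf + 1)))
    rw [le_div_iff₀ hpos] at h1
    linarith
  -- the truncation level `ε` of the observation and the size `ε₁` of the high frequencies
  obtain ⟨ε, hε, hεK⟩ : ∃ ε : ℝ, 0 < ε ∧ cK * (b * ε) ≤ R / 8 := by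
    have hpos : 0 < 8 * (cK * b + 1) := by positivity
    refine ⟨R / (8 * (cK * b + 1)), by positivity, ?_⟩
    have h1 : R / (8 * (cK * b + 1)) * (8 * (cK * b + 1)) = R := div_mul_cancel₀ _ hpos.ne'
    have h0 : 0 < R / (8 * (cK * b + 1)) := by positivity
    set r := R / (8 * (cK * b + 1))
    linarith
  obtain ⟨ε₁, hε₁, hε₁S, hε₁R, hε₁C⟩ : ∃ ε₁ : ℝ, 0 < ε₁ ∧ cS * (2 * ε₁) ≤ R / 8 ∧ ε₁ ≤ R / 2 ∧
      ‖C‖ * ε₁ ≤ ε / 2 := by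
    have h1 : ∀ a : ℝ, ∀ r > 0, ∀ᶠ x in nhdsWithin (0 : ℝ) (Set.Ioi 0), a * x < r :=
        fun a r hr => by
      refine nhdsWithin_le_nhds ?_
      have : Continuous fun x : ℝ => a * x := by fun_prop
      exact (this.tendsto' 0 0 (mul_zero a)).eventually (gt_mem_nhds hr)
    have h0 : ∀ᶠ x in nhdsWithin (0 : ℝ) (Set.Ioi 0), x ∈ Set.Ioi (0 : ℝ) := self_mem_nhdsWithin
    obtain ⟨x, x0, x1, x2, x3⟩ := (h0.and ((h1 (2 * cS) (R / 8) (by positivity)).and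
      ((h1 1 (R / 2) (by positivity)).and (h1 ‖C‖ (ε / 2) (by positivity))))).exists
    exact ⟨x, x0, by linarith, by linarith, x3.le⟩
  -- the splitting frequency
  have hcompf : IsCompact (f '' (𝒜 + 𝒜)) := (h𝒜_comp.add h𝒜_comp).image hfc
  obtain ⟨N, hN⟩ := Filter.eventually_atTop.1 ((eventually_norm_highProj_lt hcompf hε₁).and
    (eventually_norm_highProj_lt h𝒜_comp hε₁))
  obtain ⟨n, hn, hgap⟩ := exists_gap hA he (max N n₀)
  have hn₀ : n₀ ≤ n := (le_max_right _ _).trans hn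
  obtain ⟨hQf, hQ𝒜⟩ := hN n ((le_max_left _ _).trans hn)
  have hstab := h𝒜_stable n hn₀
  set S := splitSystem hA he hT.le n f C with hSdef
  have hS : S.Regular R₀ |m'| Lf :=
    splitSystem_regular hA he hT.le hf.contDiff (abs_nonneg _) Lf.2 hm hLf'
  have hgood : ∀ q ∈ inputSet T R₀ 𝒜, S.Good j c q := fun q hq =>
    splitSystem_good hA he hT hgap hf.contDiff hS hc
      (fun t => (hq t).1.trans (by linarith)) (hobs n hn₀ q (inputSet_subset hR₀.le hq))
  have hbound : ∀ q ∈ inputSet T R₀ 𝒜, SplitData.ReconBound S cS cK q := fun q hq =>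
    splitSystem_reconBound hA he hT.le (hgood q hq)
  have hin : ∀ p ∈ realDomain n T R₀ R₁ 𝒜, S.input p ∈ inputSet T R₀ 𝒜 := fun p hp =>
    splitSystem_input_mem hp
  obtain ⟨𝓡, h𝓡, K₁, hK₁, hlip⟩ := SplitData.exists_realRecon (Dm := realDomain n T R₀ R₁ 𝒜) hS hR
    hRR.le hε hj0 hcS0 hcK0
    (by have : 0 ≤ (Lf : ℝ) * R := by positivity
        nlinarith)
    isBounded_realDomain (fun p hp => hgood _ (hin p hp)) (fun p hp => hbound _ (hin p hp))
    (fun p hp t => (hin p hp t).1)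
    (fun p hp => by
      have h1 := norm_source_le (hA := hA) (he := he) (hT := hT.le) (C := C) hε₁.le hfc
        (q := S.input p) (h := p.2.2)
        (fun t => (hQf _ ⟨_, (hin p hp t).2, rfl⟩).le) (fun t => (hQ𝒜 _ (hp.2.2.2 t)).le)
      exact (add_le_add ((mul_le_mul_of_nonneg_left h1 hcS0).trans hε₁S) hεK).trans (by linarith))
  have hcut : ∀ u ∈ pathBall T R₀ 𝒜, (∀ t, C (u t) = 0) → ‖S.obsLow (lowPath n u)‖ ≤ ε / 2 :=
    fun u hu hCu => norm_obsLow_lowPath_le (by positivity) hε₁C hCu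
      fun t => (hQ𝒜 _ (hu.2 t)).le
  refine ⟨n, hn₀, R, hR, hRR, 𝓡, ⟨⟨K₁, hK₁⟩, ?_⟩, fun p hp => ?_, ?_, ?_⟩
  · refine LipschitzOnWith.of_dist_le_mul fun p hp p' hp' => ?_
    rw [dist_eq_norm, dist_eq_norm]
    exact hlip p hp p' hp'
  · exact ⟨(h𝓡 p hp).1.trans (by linarith), fun t => Set.mem_univ _⟩
  · intro u hu h₁ hh₁ h₂ hh₂ hsol
    have hp : (lowPath n u, h₁, h₂) ∈ realDomain n T R₀ R₁ 𝒜 := ⟨lowPath_mem hstab hu, hh₁, hh₂⟩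
    refine (h𝓡 _ hp).2.2 _ ?_ (realMap_highPath hA he hε hT hgap hfc hsol
      ((hcut u hu hsol.2).trans (by linarith)) (hgood _ (hin _ hp)))
    exact (ContinuousMap.norm_le _ (by positivity)).2 fun t =>
      (hQ𝒜 _ (hu.2 t)).le.trans hε₁R
  · intro hhol K _ hK _
    obtain ⟨G, δ, LG, hG⟩ := splitSystem_complexRegular hA he hT.le n C hhol
    set KK := pathBall T R₀ 𝒜 ∩ K with hKK
    have hKKc : IsCompact KK := hK.inter_left (isClosed_pathBall h𝒜_comp.isClosed)
    -- real base points of the extension: the observation is at most half the truncation level, so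
    -- that the radial truncation is inactive in a neighbourhood
    set Bs : Set (TPath T (Low e lam σ n) × TPath T (Scale e lam σ) × TPath T (Scale e lam σ)) :=
      {p | (∃ u ∈ KK, p.1 = lowPath n u) ∧ ‖S.obsLow p.1‖ ≤ ε / 2 ∧ p.2.1 ∈ KK ∧
        p.2.2 ∈ pathBall T R₁ 𝒜} with hBs
    have hBD : Bs ⊆ realDomain n T R₀ R₁ 𝒜 := by
      rintro ⟨v, k, h⟩ ⟨⟨u, hu, rfl⟩, -, hk, hh⟩
      exact ⟨lowPath_mem hstab hu.1, hk.1, hh⟩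
    -- the inputs of the linearized equation at the base points lie in a compact set
    set KB : Set (TPath T (Scale e lam σ)) := (fun z : TPath T (Scale e lam σ) ×
      TPath T (Scale e lam σ) => pathLift (Set.Icc 0 T) (lowProj e lam σ n) z.1 + z.2) ''
        (KK ×ˢ KK) with hKB
    have hKBc : IsCompact KB := (hKKc.prod hKKc).image
      (((pathLift (Set.Icc 0 T) (lowProj e lam σ n)).continuous.comp continuous_fst).add
        continuous_snd)
    have hKBin : ∀ q ∈ KB, q ∈ inputSet T R₀ 𝒜 := by
      rintro _ ⟨⟨u, k⟩, ⟨hu, hk⟩, rfl⟩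
      exact add_mem_inputSet (subPath_lowPath_mem hstab hu.1) hk.1
    obtain ⟨θ, hθ, 𝓡c, hdiff, hbd, hext⟩ := SplitData.exists_complexRecon hG hS hR hRR.le hε hcS0
      hcK0 hcon (fun p hp => hgood _ (hin p hp)) (fun p hp t => (hin p hp t).1)
      (fun p hp => ⟨(h𝓡 p hp).1, (h𝓡 p hp).2.1⟩) hK₁ hlip hBD hKBc
      (fun q hq => hgood q (hKBin q hq)) (fun q hq => hbound q (hKBin q hq))
      (fun q hq t => (hKBin q hq t).1)
      (by
        rintro ⟨v, k, h⟩ ⟨⟨u, hu, rfl⟩, -, hk, -⟩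
        exact ⟨(u, k), ⟨hu, hk⟩, rfl⟩)
      (Rh := R₁) (fun p hp => hp.2.2.2.1) (fun p hp => hp.2.1)
    -- real and imaginary parts bounded by `θ / 3` add up to a distance less than `θ`
    refine ⟨θ / 3, R, by positivity, hR, fun u hu _ _ _ _ hsol => ?_⟩
    have hnear : ∀ p ∈ complexDomain n T R₀ R₁ (θ / 3) 𝒜 K (lowPath n u),
        ∃ p₀ ∈ Bs, ‖p - SplitData.ofRTriple p₀‖ < θ := fun p hp => by
      have h1 : 0 ≤ θ / 3 := by positivity
      have h2 : 2 * (θ / 3) < θ := by linarith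
      obtain ⟨k, hk, h, hh, hlt⟩ := exists_near_of_mem_complexDomain h1 h2 hp
      have hmem : (lowPath n u, k, h) ∈ Bs := ⟨⟨u, hu, rfl⟩, hcut u hu.1 hsol.2, hk, hh⟩
      exact ⟨_, hmem, hlt⟩
    exact ⟨𝓡c, ⟨_, isOpen_near _ _ _, hnear, hdiff⟩,
      fun p hp => mem_pathCylinder_of_norm_le (hbd p (hnear p hp)),
      fun p hp hpc => hext p hp (hnear _ hpc)⟩
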